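/- **Setting.** Let $G$ be a simply connected simple complex Lie group with Lie algebra $\mathfrak g$, Cartan subalgebra $\mathfrak h$ and simple roots $\alpha_1,\dots,\alpha_r$, and let $\lambda_1,\dots,\lambda_r$ be the fundamental weights. For a simple root $\alpha_j$ let $P=P(\alpha_j)$ be the maximal parabolic subgroup whose Lie algebra $\mathfrak p$ is spanned by $\mathfrak h$, the root spaces of the negative roots, and the root spaces of the positive roots $\sum_i n_i\alpha_i$ with $n_j=0$; let $\mathfrak n$ be its nilpotent radical. The variety $X=G/P(\alpha_j)$ is an irreducible Hermitian symmetric variety if $[\mathfrak n,\mathfrak n]=0$. The quiver $\mathcal Q_X$ has as its points the irreducible representations of $P$, i.e. the irreducible $G$-homogeneous bundles $E_\lambda$ on $X$, labelled by their maximal weights $\lambda=\sum_i x_i\lambda_i$ with $x_i\in\mathbf Z$ and $x_i\ge 0$ for $i\ne j$. There is one arrow from $E_\lambda$ to $E_\mu$ if $\mathrm{Ext}^1(E_\lambda,E_\mu)^G\neq 0$, i.e. if there is a non-split extension $0\to E_\mu\to E\to E_\lambda\to 0$ of $G$-homogeneous bundles (equivalently, of finite-dimensional representations of $P$), and no arrow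 otherwise. Connected components are those of the underlying undirected graph. **Theorem.** Let $X=G/P(\alpha_j)$ be an irreducible Hermitian symmetric variety. Then the number of connected components of $\mathcal Q_X$ is finite and equals the index of the root lattice $\langle\alpha_1,\dots,\alpha_r\rangle_{\mathbf Z}$ in the weight lattice $\langle\lambda_1,\dots,\lambda_r\rangle_{\mathbf Z}$, that is, the determinant of the Cartan matrix of $\mathfrak g$. The following varieties are irreducible Hermitian symmetric, and the number of connected components of $\mathcal Q_X$ is: - Grassmannians $Gr(\mathbf P^k,\mathbf P^n)=SL(n+1)/P(\alpha_{k+1})$, $0\le k\le n-1$: $n+1$; - odd quadrics $Q_{2n-1}=Spin(2n+1)/P(\alpha_1)$, $n\ge2$: $2$; - even quadrics $Q_{2n}=Spin(2n+2)/P(\alpha_1)$, $n\ge 2$: $4$; - spinor varieties $Spin(2n+2)/P(\alpha_{n+1})$, $n\ge3$: $4$; - Lagrangian Grassmannians $Sp(2n)/P(\alpha_n)$, $n\ge2$: $2$; - the Cayley plane $E_6/P$, with $P$ given by an end of a long arm of the Dynkin diagram: $3$; - the $27$-dimensional variety $E_7/P$, with $P$ given by the end of the longest arm of the Dynkin diagram: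 $2$. -/

import Mathlib

/-!
# The quiver of homogeneous bundles on `X = G / P(α_j)`

`𝔤` is the Lie algebra of a simply connected complex semisimple group `G`, `H` is a Cartan
subalgebra, `b` is a system of simple roots `α_i` (`i ∈ b.support`) and `j` is one of its nodes.
Since `P = P(α_j)` is connected, its (finite-dimensional, holomorphic) representations, that is the
`G`-homogeneous vector bundles on `X`, are the finite-dimensional modules over `𝔭 = Lie P` on which
`H` acts diagonalizably with integral weights.
-/

namespace HomogeneousQuiver

open LieAlgebra LieAlgebra.IsKilling Module

section

variable {𝔤 : Type*} [LieRing 𝔤] [LieAlgebra ℂ 𝔤] [FiniteDimensional ℂ 𝔤] [IsKilling ℂ 𝔤]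
  {H : LieSubalgebra ℂ 𝔤} [H.IsCartanSubalgebra]

/-- The coefficient `n_j` of the simple root `α_j` in the root `α = ∑ n_i α_i`. -/
noncomputable def coeff (b : (rootSystem H).Base) (j : b.support) (α : H.root) : ℤ :=
  b.toWeightBasisInt.repr ((rootSystem H).rootSpanMem ℤ α) j

theorem coeff_add (b : (rootSystem H).Base) (j : b.support) {α β γ : H.root}
    (h : (rootSystem H).root γ = (rootSystem H).root α + (rootSystem H).root β) :
    coeff b j γ = coeff b j α + coeff b j β := by
  have : (rootSystem H).rootSpanMem ℤ γ =
      (rootSystem H).rootSpanMem ℤ α + (rootSystem H).rootSpanMem ℤ β := Subtype.ext h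
  rw [coeff, this, map_add, Finsupp.add_apply, coeff, coeff]

/-- The vector space underlying `Lie P(α_j)`: the span of `H`, of the root spaces of the negative
roots, and of the root spaces of the positive roots `∑ n_i α_i` with `n_j = 0`. As the coefficients
of a root all have the same sign, these roots are the roots with `n_j ≤ 0`. -/
noncomputable def parabolicSubmodule (b : (rootSystem H).Base) (j : b.support) : Submodule ℂ 𝔤 :=
  H.toSubmodule ⊔ ⨆ α : {α : H.root // coeff b j α ≤ 0}, (rootSpace H α.1.1).toSubmodule

theorem cartan_le_parabolicSubmodule (b : (rootSystem H).Base) (j : b.support) :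
    H.toSubmodule ≤ parabolicSubmodule b j := le_sup_left

theorem rootSpace_le_parabolicSubmodule (b : (rootSystem H).Base) (j : b.support) (α : H.root)
    (h : coeff b j α ≤ 0) : (rootSpace H α.1).toSubmodule ≤ parabolicSubmodule b j :=
  (le_iSup (fun α : {α : H.root // coeff b j α ≤ 0} ↦ (rootSpace H α.1.1).toSubmodule)
    ⟨α, h⟩).trans le_sup_right

theorem parabolicSubmodule_induction (b : (rootSystem H).Base) (j : b.support) {p : 𝔤 → Prop}
    (hH : ∀ x ∈ H, p x)
    (hr : ∀ α : H.root, coeff b j α ≤ 0 → ∀ x ∈ rootSpace H α.1, p x)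
    (hadd : ∀ x y, p x → p y → p (x + y)) {x : 𝔤} (hx : x ∈ parabolicSubmodule b j) : p x := by
  obtain ⟨y, hy, z, hz, rfl⟩ := Submodule.mem_sup.mp hx
  refine hadd _ _ (hH y hy) ?_
  refine Submodule.iSup_induction _ (motive := p) hz (fun α x hx ↦ hr α.1 α.2 x hx)
    (hH 0 H.zero_mem) hadd

theorem lie_mem_parabolicSubmodule (b : (rootSystem H).Base) (j : b.support) {x y : 𝔤}
    (hx : x ∈ parabolicSubmodule b j) (hy : y ∈ parabolicSubmodule b j) :
    ⁅x, y⁆ ∈ parabolicSubmodule b j := by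
  have hHr : ∀ α : H.root, coeff b j α ≤ 0 → ∀ h ∈ H, ∀ x ∈ rootSpace H α.1,
      ⁅h, x⁆ ∈ parabolicSubmodule b j := by
    intro α hα h hh x hx
    apply rootSpace_le_parabolicSubmodule b j α hα
    exact (rootSpace H α.1).lie_mem (x := (⟨h, hh⟩ : H)) hx
  refine parabolicSubmodule_induction b j (p := fun x ↦ ⁅x, y⁆ ∈ parabolicSubmodule b j)
    ?_ ?_ ?_ hx
  · intro h hh
    refine parabolicSubmodule_induction b j (p := fun y ↦ ⁅h, y⁆ ∈ parabolicSubmodule b j)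
      ?_ ?_ ?_ hy
    · exact fun k hk ↦ cartan_le_parabolicSubmodule b j (H.lie_mem hh hk)
    · exact fun α hα z hz ↦ hHr α hα h hh z hz
    · intro u v hu hv
      rw [lie_add]
      exact add_mem hu hv
  · intro α hα u hu
    refine parabolicSubmodule_induction b j (p := fun y ↦ ⁅u, y⁆ ∈ parabolicSubmodule b j)
      ?_ ?_ ?_ hy
    · intro k hk
      rw [← lie_skew]
      exact neg_mem (hHr α hα k hk u hu)
    · intro β hβ v hv
      have huv : ⁅u, v⁆ ∈ rootSpace H (α.1 + β.1 : H → ℂ) :=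
        lie_mem_genWeightSpace_of_mem_genWeightSpace hu hv
      by_cases h0 : (α.1 + β.1 : H → ℂ) = 0
      · rw [h0] at huv
        refine cartan_le_parabolicSubmodule b j ?_
        rw [← LieSubalgebra.coe_toLieSubmodule, ← rootSpace_zero_eq ℂ 𝔤 H]
        exact huv
      · by_cases h1 : rootSpace H (α.1 + β.1 : H → ℂ) = ⊥
        · rw [h1] at huv
          rw [(LieSubmodule.mem_bot _).mp huv]
          exact zero_mem _
        · let w : LieModule.Weight ℂ H 𝔤 := ⟨α.1 + β.1, h1⟩
          let γ : H.root := ⟨w, by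
            rw [LieSubalgebra.root, Finset.mem_filter]
            exact ⟨Finset.mem_univ _, h0⟩⟩
          have hγ : coeff b j γ = coeff b j α + coeff b j β := by
            apply coeff_add
            ext h
            rfl
          exact rootSpace_le_parabolicSubmodule b j γ (by omega) huv
    · intro v w hv hw
      rw [lie_add]
      exact add_mem hv hw
  · intro u v hu hv
    rw [add_lie]
    exact add_mem hu hv

/-- The Lie algebra `𝔭` of the maximal parabolic subgroup `P(α_j)`. -/
noncomputable def parabolic (b : (rootSystem H).Base) (j : b.support) : LieSubalgebra ℂ 𝔤 where
  __ := parabolicSubmodule b j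
  lie_mem' := lie_mem_parabolicSubmodule b j

/-- The nilpotent radical `𝔫` of `𝔭`, spanned by the root spaces of the roots with `n_j < 0`. -/
noncomputable def nilradical (b : (rootSystem H).Base) (j : b.support) : Submodule ℂ 𝔤 :=
  ⨆ α : {α : H.root // coeff b j α < 0}, (rootSpace H α.1.1).toSubmodule

/-- `X = G / P(α_j)` is Hermitian symmetric: `[𝔫, 𝔫] = 0`. -/
def IsHermitianSymmetric (b : (rootSystem H).Base) (j : b.support) : Prop :=
  ∀ x ∈ nilradical b j, ∀ y ∈ nilradical b j, ⁅x, y⁆ = 0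

/-- The fundamental weight `λ_i`, defined by `2 (λ_i, α_k) / (α_k, α_k) = δ_{ik}`. -/
noncomputable def fundamentalWeight (b : (rootSystem H).Base) (i : b.support) : Dual ℂ H :=
  b.toCoweightBasis.coord i

/-- The weight lattice, generated by the fundamental weights. -/
noncomputable def weightLattice (b : (rootSystem H).Base) : AddSubgroup (Dual ℂ H) :=
  AddSubgroup.closure (Set.range (fundamentalWeight b))

/-- The root lattice, generated by the simple roots. -/
noncomputable def rootLattice (b : (rootSystem H).Base) : AddSubgroup (Dual ℂ H) :=
  AddSubgroup.closure (Set.range fun i : b.support ↦ (rootSystem H).root i)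

/-- `v` is a vector of weight `χ` in the `𝔭`-module `V`. -/
def IsWeightVector (b : (rootSystem H).Base) (j : b.support) {V : Type*} [AddCommGroup V]
    [Module ℂ V] [LieRingModule (parabolic b j) V] (χ : Dual ℂ H) (v : V) : Prop :=
  ∀ (x : parabolic b j) (hx : (x : 𝔤) ∈ H), ⁅x, v⁆ = χ ⟨x, hx⟩ • v

/-- The finite-dimensional `𝔭`-module `V` comes from a representation of the group `P(α_j)`: it is
spanned by vectors of integral weight. -/
def IsIntegrable (b : (rootSystem H).Base) (j : b.support) (V : Type*) [AddCommGroup V]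
    [Module ℂ V] [LieRingModule (parabolic b j) V] : Prop :=
  Submodule.span ℂ {v : V | ∃ χ ∈ weightLattice b, IsWeightVector b j χ v} = ⊤

/-- The `𝔭`-module `V` is irreducible with maximal weight `lam`: it has a nonzero vector of weight
`lam` that is killed by the positive root vectors contained in `𝔭`. (As `V` is irreducible and
finite-dimensional, `𝔫` acts by zero, and `V` is an irreducible module over the reductive part.) -/
structure IsIrreducibleOfMaximalWeight (b : (rootSystem H).Base) (j : b.support) (V : Type*)
    [AddCommGroup V] [Module ℂ V] [LieRingModule (parabolic b j) V]
    [LieModule ℂ (parabolic b j) V] (lam : Dual ℂ H) : Prop where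
  irreducible : LieModule.IsIrreducible ℂ (parabolic b j) V
  exists_maximal_vector : ∃ v : V, v ≠ 0 ∧ IsWeightVector b j lam v ∧
    ∀ α : H.root, b.IsPos α → ∀ x : parabolic b j, (x : 𝔤) ∈ rootSpace H α.1 → ⁅x, v⁆ = 0

/-- `Ext¹(E_lam, E_mu)^G ≠ 0`: there is a non-split extension `0 → E_mu → E → E_lam → 0` of
`G`-homogeneous bundles, that is of finite-dimensional representations of `P(α_j)`. -/
def ExtNeZero (b : (rootSystem H).Base) (j : b.support) (lam mu : Dual ℂ H) : Prop :=
  ∃ (E : Type) (_ : AddCommGroup E) (_ : Module ℂ E) (_ : LieRingModule (parabolic b j) E)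
    (_ : LieModule ℂ (parabolic b j) E) (F : LieSubmodule ℂ (parabolic b j) E),
    FiniteDimensional ℂ E ∧ IsIntegrable b j E ∧
    IsIrreducibleOfMaximalWeight b j F mu ∧
    IsIrreducibleOfMaximalWeight b j (E ⧸ F) lam ∧
    ¬ ∃ F' : LieSubmodule ℂ (parabolic b j) E, IsCompl F F'

/-- The points of the quiver: the irreducible representations of `P(α_j)`, given by their maximal
weights, which are the `∑ x_i λ_i` with `x_i ∈ ℤ` for all `i` and `x_i ≥ 0` for `i ≠ j`. -/
def QuiverOf (b : (rootSystem H).Base) (j : b.support) : Type _ :=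
  {lam : Dual ℂ H // lam ∈ weightLattice b ∧
    ∀ i : b.support, i ≠ j → ∃ m : ℕ, lam ((rootSystem H).coroot i) = m}

/-- The quiver of `X = G / P(α_j)`: there is one arrow from `E_lam` to `E_mu` if
`Ext¹(E_lam, E_mu)^G ≠ 0`, and none otherwise. -/
instance (b : (rootSystem H).Base) (j : b.support) : Quiver (QuiverOf b j) where
  Hom lam mu := PLift (ExtNeZero b j lam.1 mu.1)

/-- The connected components of the quiver (regardless of the directions of the arrows). -/
abbrev Components (b : (rootSystem H).Base) (j : b.support) : Type _ :=
  Quiver.WeaklyConnectedComponent (QuiverOf b j)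

open Classical in
/-- The determinant of the Cartan matrix. -/
noncomputable def cartanDet (b : (rootSystem H).Base) : ℤ :=
  b.cartanMatrix.det

/-- `(𝔤, α_j)` is of the type `(A, k)`: the simple roots can be numbered (from `0`) so that the
Cartan matrix becomes `A` and `α_j` gets the number `k`. -/
def HasType (b : (rootSystem H).Base) (j : b.support) {n : ℕ} (A : Matrix (Fin n) (Fin n) ℤ)
    (k : ℕ) : Prop :=
  ∃ e : b.support ≃ Fin n, (∀ i i', b.cartanMatrix i i' = A (e i) (e i')) ∧ (e j : ℕ) = k

end

end HomogeneousQuiver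

/-!
The vertices of the quiver are weights, and two vertices are connected if and only if they are
congruent modulo the root lattice (`mk_eq_mk_iff`). As every coset of the root lattice in the weight
lattice contains a vertex (`exists_quiverOf_sub_mem`), the components are the elements of the
quotient, and their number is the index, which is the determinant of the Cartan matrix
(`relIndex_eq_cartanDet`).

An arrow cannot leave a coset, because the decomposition of the weights of a `𝔭`-module into cosets
of the root lattice is a decomposition of the module (`ExtNeZero.sub_mem_rootLattice`).

For the converse, let `S` be a union of components. A finite-dimensional `𝔭`-module lies in the
blocks of `S` if the maximal weights of all its simple subquotients are in `S` (`AllWeightsIn`).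

* A module generated by a maximal vector lies in a single block (`allWeightsIn_of_lieSpan_eq_top`):
  a simple submodule with weight outside of `S` would split off (`exists_complement`).
* Let `ϖ_j` be the coweight with `α_i(ϖ_j) = δ_{ij}`. Then `𝔞 = ℂ ϖ_j ⊕ 𝔫` is an ideal of `𝔭`, and
  `𝔞 ⊗ V` lies in the block of `V` for irreducible `V`, since it is generated by `ϖ_j ⊗ v` for a
  maximal vector `v`. Hence tensoring with `𝔞` preserves blocks (`AllWeightsIn.tensor`).
* Therefore `⋀^k 𝔞 ⊗ V` lies in the blocks of `V`. If `I` is a set of roots of `𝔫` closed under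
  adding positive roots, then `⋀_{γ ∈ I} e_γ ⊗ v` is a maximal vector of it, so that the weight of
  `v` is connected to its sum with `∑_{γ ∈ I} γ` (`exists_maximal_add_sum`).
* The differences of these sums include all roots of `𝔫` (`exists_closed_sets`), and these generate
  the root lattice (`closure_nilradical_roots`).

The argument starts from an irreducible finite-dimensional module for each vertex
(`exists_irreducible`). Maximal vectors of arbitrary weight exist on (twisted) functions: if `w`
is a maximal vector of weight `τ` then `w ^ z` has weight `z • τ`
(`IsMaximalMod.hasMaximalVector_smul`), and the weights `τ` that occur in the modules `⋀^k 𝔞 ⊗ 𝔞`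
span the dual of `H`. The irreducible quotient is finite-dimensional because its weights are
stable under the Weyl group of the Levi part, which bounds their heights
(`IsIrreducibleOfMaximalWeight.exists_height_le`).

None of this uses `[𝔫, 𝔫] = 0`. For the varieties in the list, that property follows from
`|n_j| ≤ 1` for all roots. For the classical types this holds because the orbit of the fundamental
coweight under the Weyl group is minuscule (`HasType.isHermitianSymmetric_of_orbit`), and for `E₆`
and `E₇` because the roots have square length `2` for the Cartan matrix
(`HasType.isHermitianSymmetric_of_isSymm`).
-/

namespace HomogeneousQuiver

open LieAlgebra LieAlgebra.IsKilling Module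

open scoped Matrix

set_option linter.unusedSectionVars false

section

variable {𝔤 : Type*} [LieRing 𝔤] [LieAlgebra ℂ 𝔤] [FiniteDimensional ℂ 𝔤] [IsKilling ℂ 𝔤]
  {H : LieSubalgebra ℂ 𝔤} [H.IsCartanSubalgebra]
  {b : (rootSystem H).Base} {j : b.support}

/-! ### The structure of the parabolic subalgebra -/

variable (b j)

/-- The Cartan subalgebra inside `𝔭`. -/
noncomputable def cartanIncl : H →ₗ[ℂ] parabolic b j where
  toFun h := ⟨h, cartan_le_parabolicSubmodule b j h.2⟩
  map_add' _ _ := rfl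
  map_smul' _ _ := rfl

@[simp] theorem coe_cartanIncl (h : H) : (cartanIncl b j h : 𝔤) = h := rfl

/-- `x ∈ 𝔭` is a root vector (or zero) for the root `α`. -/
def IsRootVector (α : H.root) (x : parabolic b j) : Prop := (x : 𝔤) ∈ rootSpace H α.1

variable {b j}

theorem parabolic_induction {p : parabolic b j → Prop}
    (hH : ∀ h, p (cartanIncl b j h))
    (hr : ∀ α : H.root, coeff b j α ≤ 0 → ∀ x, IsRootVector b j α x → p x)
    (hadd : ∀ x y, p x → p y → p (x + y)) (x : parabolic b j) : p x := by
  obtain ⟨x, hx⟩ := x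
  suffices h : ∃ hx : x ∈ parabolic b j, p ⟨x, hx⟩ from h.2
  refine parabolicSubmodule_induction b j (p := fun x ↦ ∃ hx : x ∈ parabolic b j, p ⟨x, hx⟩)
    ?_ ?_ ?_ hx
  · exact fun y hy ↦ ⟨_, hH ⟨y, hy⟩⟩
  · exact fun α hα y hy ↦ ⟨rootSpace_le_parabolicSubmodule b j α hα hy, hr α hα _ hy⟩
  · rintro y z ⟨hy, hy'⟩ ⟨hz, hz'⟩
    exact ⟨add_mem hy hz, hadd _ _ hy' hz'⟩

theorem lie_cartanIncl (h h' : H) : ⁅cartanIncl b j h, cartanIncl b j h'⁆ = 0 := by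
  ext
  rw [LieSubalgebra.coe_bracket, coe_cartanIncl, coe_cartanIncl, ← LieSubalgebra.coe_bracket,
    LieModule.IsTrivial.trivial]
  rfl

theorem IsRootVector.lie_cartan {α : H.root} {x : parabolic b j} (hx : IsRootVector b j α x)
    (h : H) : ⁅cartanIncl b j h, x⁆ = (rootSystem H).root α h • x := by
  ext
  exact lie_eq_smul_of_mem_rootSpace hx h

/-- The sum of two roots of `𝔭` is zero, a root, or contributes a zero bracket. -/
theorem IsRootVector.lie {α β : H.root} {x y : parabolic b j} (hx : IsRootVector b j α x)
    (hy : IsRootVector b j β y) :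
    (rootSystem H).root α + (rootSystem H).root β = 0 ∨
    (∃ γ : H.root, (rootSystem H).root γ = (rootSystem H).root α + (rootSystem H).root β ∧
      IsRootVector b j γ ⁅x, y⁆) ∨ ⁅x, y⁆ = 0 := by
  have huv : ⁅(x : 𝔤), (y : 𝔤)⁆ ∈ rootSpace H (α.1 + β.1 : H → ℂ) :=
    lie_mem_genWeightSpace_of_mem_genWeightSpace hx hy
  by_cases h0 : (α.1 + β.1 : H → ℂ) = 0
  · left
    ext h
    exact congrFun h0 h
  by_cases h1 : rootSpace H (α.1 + β.1 : H → ℂ) = ⊥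
  · right; right
    rw [h1] at huv
    ext
    exact (LieSubmodule.mem_bot _).mp huv
  · right; left
    let w : LieModule.Weight ℂ H 𝔤 := ⟨α.1 + β.1, h1⟩
    refine ⟨⟨w, by rw [LieSubalgebra.root, Finset.mem_filter]; exact ⟨Finset.mem_univ _, h0⟩⟩,
      ?_, huv⟩
    ext h
    rfl

/-! ### Weight vectors -/

section Weights

variable {V : Type*} [AddCommGroup V] [Module ℂ V] [LieRingModule (parabolic b j) V]
  [LieModule ℂ (parabolic b j) V]
  {V' : Type*} [AddCommGroup V'] [Module ℂ V'] [LieRingModule (parabolic b j) V']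
  [LieModule ℂ (parabolic b j) V']

theorem isWeightVector_iff {χ : Dual ℂ H} {v : V} :
    IsWeightVector b j χ v ↔ ∀ h, ⁅cartanIncl b j h, v⁆ = χ h • v :=
  ⟨fun hv h ↦ hv (cartanIncl b j h) h.2, fun hv x hx ↦ hv ⟨x, hx⟩⟩

theorem IsWeightVector.lie_cartan {χ : Dual ℂ H} {v : V} (hv : IsWeightVector b j χ v) (h : H) :
    ⁅cartanIncl b j h, v⁆ = χ h • v := isWeightVector_iff.mp hv h

theorem isWeightVector_zero (χ : Dual ℂ H) : IsWeightVector b j χ (0 : V) :=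
  fun x _ ↦ by rw [lie_zero, smul_zero]

theorem IsWeightVector.add {χ : Dual ℂ H} {v w : V} (hv : IsWeightVector b j χ v)
    (hw : IsWeightVector b j χ w) : IsWeightVector b j χ (v + w) :=
  fun x hx ↦ by rw [lie_add, hv x hx, hw x hx, smul_add]

theorem IsWeightVector.smul {χ : Dual ℂ H} {v : V} (c : ℂ) (hv : IsWeightVector b j χ v) :
    IsWeightVector b j χ (c • v) :=
  fun x hx ↦ by rw [lie_smul, hv x hx, smul_comm]

theorem IsWeightVector.sub {χ : Dual ℂ H} {v w : V} (hv : IsWeightVector b j χ v)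
    (hw : IsWeightVector b j χ w) : IsWeightVector b j χ (v - w) :=
  fun x hx ↦ by rw [lie_sub, hv x hx, hw x hx, smul_sub]

theorem IsWeightVector.map {χ : Dual ℂ H} {v : V} (hv : IsWeightVector b j χ v)
    (f : V →ₗ⁅ℂ, parabolic b j⁆ V') : IsWeightVector b j χ (f v) :=
  fun x hx ↦ by rw [← LieModuleHom.map_lie, hv x hx, map_smul]

theorem IsWeightVector.lie_root {χ : Dual ℂ H} {v : V} (hv : IsWeightVector b j χ v)
    {α : H.root} {x : parabolic b j} (hx : IsRootVector b j α x) :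
    IsWeightVector b j (χ + (rootSystem H).root α) ⁅x, v⁆ := by
  rw [isWeightVector_iff]
  intro h
  rw [leibniz_lie, hx.lie_cartan, hv.lie_cartan, smul_lie, lie_smul, ← add_smul, add_comm,
    LinearMap.add_apply]

theorem IsWeightVector.tmul {χ ψ : Dual ℂ H} {v : V} {w : V'} (hv : IsWeightVector b j χ v)
    (hw : IsWeightVector b j ψ w) : IsWeightVector b j (χ + ψ) (v ⊗ₜ[ℂ] w) := by
  intro x hx
  rw [TensorProduct.LieModule.lie_tmul_right, hv x hx, hw x hx, ← TensorProduct.smul_tmul',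
    TensorProduct.tmul_smul, ← add_smul, LinearMap.add_apply]

/-- Weight vectors of distinct weights are linearly independent. -/
theorem eq_zero_of_sum_weightVectors_eq_zero (s : Finset (Dual ℂ H)) (f : Dual ℂ H → V)
    (hf : ∀ χ ∈ s, IsWeightVector b j χ (f χ)) (h0 : ∑ χ ∈ s, f χ = 0) :
    ∀ χ ∈ s, f χ = 0 := by
  classical
  induction s using Finset.induction_on generalizing f with
  | empty => simp
  | insert a s ha ih =>
    have key : ∀ χ ∈ s, f χ = 0 := by
      intro χ hχ
      have hne : χ ≠ a := fun h ↦ ha (h ▸ hχ)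
      obtain ⟨h, hh⟩ : ∃ h, χ h - a h ≠ 0 := by
        by_contra! hc
        exact hne (LinearMap.ext fun h ↦ sub_eq_zero.mp (hc h))
      have := ih (fun χ ↦ (χ h - a h) • f χ)
        (fun χ hχ ↦ (hf χ (Finset.mem_insert_of_mem hχ)).smul _) ?_ χ hχ
      · exact (smul_eq_zero.mp this).resolve_left hh
      · have h1 : ⁅cartanIncl b j h, ∑ χ ∈ insert a s, f χ⁆ = ∑ χ ∈ insert a s, χ h • f χ := by
          rw [lie_sum]
          exact Finset.sum_congr rfl fun χ hχ ↦ (hf χ hχ).lie_cartan h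
        have h2 : ∑ χ ∈ insert a s, (χ h - a h) • f χ = 0 := by
          simp_rw [sub_smul, Finset.sum_sub_distrib, ← h1, ← Finset.smul_sum, h0, lie_zero,
            smul_zero, sub_zero]
        rwa [Finset.sum_insert ha, sub_self, zero_smul, zero_add] at h2
    intro χ hχ
    rcases Finset.mem_insert.mp hχ with rfl | hχ
    · rwa [Finset.sum_insert ha, Finset.sum_eq_zero key, add_zero] at h0
    · exact key χ hχ

variable (b j V) in
/-- The span of the weight vectors whose weight lies in `A`. -/
def weightSpan (A : Set (Dual ℂ H)) : Submodule ℂ V :=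
  Submodule.span ℂ {v : V | ∃ χ ∈ A, IsWeightVector b j χ v}

theorem IsWeightVector.mem_weightSpan {A : Set (Dual ℂ H)} {χ : Dual ℂ H} {v : V}
    (hv : IsWeightVector b j χ v) (hχ : χ ∈ A) : v ∈ weightSpan b j V A :=
  Submodule.subset_span ⟨χ, hχ, hv⟩

theorem weightSpan_mono {A B : Set (Dual ℂ H)} (h : A ⊆ B) :
    weightSpan b j V A ≤ weightSpan b j V B :=
  Submodule.span_mono fun _ ⟨χ, hχ, hv⟩ ↦ ⟨χ, h hχ, hv⟩

theorem exists_sum_of_mem_weightSpan {A : Set (Dual ℂ H)} {v : V} (hv : v ∈ weightSpan b j V A) :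
    ∃ (s : Finset (Dual ℂ H)) (f : Dual ℂ H → V), (∀ χ ∈ s, χ ∈ A) ∧
      (∀ χ, IsWeightVector b j χ (f χ)) ∧ (∀ χ ∉ s, f χ = 0) ∧ v = ∑ χ ∈ s, f χ := by
  classical
  induction hv using Submodule.span_induction with
  | mem x hx =>
    obtain ⟨χ, hχ, hx⟩ := hx
    refine ⟨{χ}, Pi.single χ x, by simpa using hχ, fun ψ ↦ ?_, fun ψ hψ ↦ ?_, by simp⟩
    · rcases eq_or_ne ψ χ with rfl | h
      · simpa using hx
      · simpa [h] using isWeightVector_zero ψ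
    · have h : ψ ≠ χ := by simpa using hψ
      simp [h]
  | zero => exact ⟨∅, 0, by simp, fun χ ↦ isWeightVector_zero χ, by simp, by simp⟩
  | add x y _ _ hx hy =>
    obtain ⟨s, f, hs, hf, hf0, rfl⟩ := hx
    obtain ⟨t, g, ht, hg, hg0, rfl⟩ := hy
    refine ⟨s ∪ t, f + g, ?_, fun χ ↦ (hf χ).add (hg χ), ?_, ?_⟩
    · intro χ hχ
      rcases Finset.mem_union.mp hχ with h | h
      exacts [hs χ h, ht χ h]
    · intro χ hχ
      rw [Finset.mem_union, not_or] at hχ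
      simp [hf0 χ hχ.1, hg0 χ hχ.2]
    · simp only [Pi.add_apply, Finset.sum_add_distrib]
      congr 1
      · exact Finset.sum_subset Finset.subset_union_left fun χ _ h ↦ hf0 χ h
      · exact Finset.sum_subset Finset.subset_union_right fun χ _ h ↦ hg0 χ h
  | smul c x _ hx =>
    obtain ⟨s, f, hs, hf, hf0, rfl⟩ := hx
    exact ⟨s, c • f, hs, fun χ ↦ (hf χ).smul c, fun χ h ↦ by simp [hf0 χ h],
      by simp [Finset.smul_sum]⟩

/-- A weight vector in the image of a module spanned by weight vectors lifts to a weight vector of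
the same weight. -/
theorem exists_weightVector_lift {A : Set (Dual ℂ H)} (f : V →ₗ⁅ℂ, parabolic b j⁆ V') {v : V}
    (hv : v ∈ weightSpan b j V A) {χ : Dual ℂ H} (hχ : IsWeightVector b j χ (f v)) :
    ∃ w, IsWeightVector b j χ w ∧ f w = f v ∧ (χ ∉ A → w = 0) := by
  classical
  obtain ⟨s, g, hs, hg, hg0, rfl⟩ := exists_sum_of_mem_weightSpan hv
  refine ⟨g χ, hg χ, ?_, fun h ↦ hg0 χ fun h' ↦ h (hs χ h')⟩
  have key := eq_zero_of_sum_weightVectors_eq_zero (b := b) (j := j) (insert χ s)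
    (fun ψ ↦ f (g ψ) - (Pi.single χ (f (∑ ψ ∈ s, g ψ)) : Dual ℂ H → V') ψ) ?_ ?_
  · simpa [sub_eq_zero] using key χ (Finset.mem_insert_self _ _)
  · intro ψ _
    refine ((hg ψ).map f).sub ?_
    rcases eq_or_ne ψ χ with rfl | h
    · simpa using hχ
    · simpa [h] using isWeightVector_zero ψ
  · rw [Finset.sum_sub_distrib, Finset.sum_pi_single']
    rw [if_pos (Finset.mem_insert_self _ _), ← map_sum, sub_eq_zero]
    congr 1
    exact (Finset.sum_subset (Finset.subset_insert _ _) fun ψ _ h ↦ hg0 ψ h).symm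

theorem eq_zero_of_mem_weightSpan {A : Set (Dual ℂ H)} {v : V} (hv : v ∈ weightSpan b j V A)
    {χ : Dual ℂ H} (hχ : IsWeightVector b j χ v) (hA : χ ∉ A) : v = 0 := by
  obtain ⟨w, -, h, h0⟩ := exists_weightVector_lift (LieModuleHom.id : V →ₗ⁅ℂ, parabolic b j⁆ V)
    hv hχ
  rw [h0 hA] at h
  simpa using h.symm

theorem disjoint_weightSpan {A B : Set (Dual ℂ H)} (h : Disjoint A B) :
    Disjoint (weightSpan b j V A) (weightSpan b j V B) := by
  classical
  rw [Submodule.disjoint_def]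
  intro v hA hB
  obtain ⟨s, f, hs, hf, hf0, rfl⟩ := exists_sum_of_mem_weightSpan hA
  obtain ⟨t, g, ht, hg, hg0, he⟩ := exists_sum_of_mem_weightSpan hB
  have h1 : ∑ χ ∈ s ∪ t, (f χ - g χ) = 0 := by
    rw [Finset.sum_sub_distrib, sub_eq_zero,
      ← Finset.sum_subset Finset.subset_union_left fun χ _ h ↦ hf0 χ h, he]
    exact Finset.sum_subset Finset.subset_union_right fun χ _ h ↦ hg0 χ h
  refine Finset.sum_eq_zero fun χ hχ ↦ ?_
  have h2 := eq_zero_of_sum_weightVectors_eq_zero (b := b) (j := j) _ _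
    (fun χ _ ↦ (hf χ).sub (hg χ)) h1 χ (Finset.mem_union_left _ hχ)
  have h3 : χ ∉ t := fun h' ↦ (Set.disjoint_left.mp h (hs χ hχ)) (ht χ h')
  rwa [hg0 χ h3, sub_zero] at h2

/-- Submodules contain the weight components of their elements. -/
theorem mem_of_sum_mem (N : LieSubmodule ℂ (parabolic b j) V) (s : Finset (Dual ℂ H))
    (f : Dual ℂ H → V) (hf : ∀ χ ∈ s, IsWeightVector b j χ (f χ)) (h : ∑ χ ∈ s, f χ ∈ N) :
    ∀ χ ∈ s, f χ ∈ N := by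
  intro χ hχ
  rw [← LieSubmodule.Quotient.mk_eq_zero']
  refine eq_zero_of_sum_weightVectors_eq_zero (b := b) (j := j) s
    (fun χ ↦ LieSubmodule.Quotient.mk' N (f χ)) (fun χ hχ ↦ (hf χ hχ).map _) ?_ χ hχ
  rw [← map_sum]
  exact (LieSubmodule.Quotient.mk_eq_zero N).mpr h

theorem isWeightVector_coe {N : LieSubmodule ℂ (parabolic b j) V} {χ : Dual ℂ H} {v : N} :
    IsWeightVector b j χ (v : V) ↔ IsWeightVector b j χ v := by
  constructor
  · intro h x hx
    exact Subtype.ext (h x hx)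
  · intro h
    exact h.map N.incl

theorem weightSpan_sub_eq_top {A : Set (Dual ℂ H)} (hA : weightSpan b j V A = ⊤)
    (N : LieSubmodule ℂ (parabolic b j) V) : weightSpan b j N A = ⊤ := by
  rw [eq_top_iff]
  rintro ⟨v, hv⟩ -
  have hvA : v ∈ weightSpan b j V A := hA ▸ Submodule.mem_top
  obtain ⟨s, f, hs, hf, hf0, rfl⟩ := exists_sum_of_mem_weightSpan hvA
  have hN := mem_of_sum_mem N s f (fun χ _ ↦ hf χ) hv
  have : (⟨∑ χ ∈ s, f χ, hv⟩ : N) = ∑ χ ∈ s.attach, ⟨f χ, hN χ χ.2⟩ := by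
    ext
    simp [Finset.sum_attach s f]
  rw [this]
  refine Submodule.sum_mem _ fun χ _ ↦ ?_
  exact IsWeightVector.mem_weightSpan (isWeightVector_coe.mp (hf χ)) (hs χ χ.2)

theorem weightSpan_eq_top_of_surjective {A : Set (Dual ℂ H)} (hA : weightSpan b j V A = ⊤)
    (f : V →ₗ⁅ℂ, parabolic b j⁆ V') (hf : Function.Surjective f) : weightSpan b j V' A = ⊤ := by
  rw [eq_top_iff]
  rintro v -
  obtain ⟨v, rfl⟩ := hf v
  have hv : v ∈ weightSpan b j V A := hA ▸ Submodule.mem_top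
  induction hv using Submodule.span_induction with
  | mem x hx =>
    obtain ⟨χ, hχ, hx⟩ := hx
    exact (hx.map f).mem_weightSpan hχ
  | zero => rw [map_zero]; exact zero_mem _
  | add x y _ _ hx hy => rw [map_add]; exact add_mem hx hy
  | smul c x _ hx => rw [map_smul]; exact Submodule.smul_mem _ c hx

theorem weightSpan_tensor_eq_top {A : AddSubgroup (Dual ℂ H)} (hV : weightSpan b j V A = ⊤)
    (hV' : weightSpan b j V' A = ⊤) : weightSpan b j (TensorProduct ℂ V V') A = ⊤ := by
  rw [eq_top_iff]
  rintro t -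
  induction t using TensorProduct.induction_on with
  | zero => exact zero_mem _
  | add x y hx hy => exact add_mem hx hy
  | tmul v w =>
    have hv : v ∈ weightSpan b j V A := hV ▸ Submodule.mem_top
    have hw : w ∈ weightSpan b j V' A := hV' ▸ Submodule.mem_top
    induction hv using Submodule.span_induction with
    | mem x hx =>
      obtain ⟨χ, hχ, hx⟩ := hx
      induction hw using Submodule.span_induction with
      | mem y hy =>
        obtain ⟨ψ, hψ, hy⟩ := hy
        exact (hx.tmul hy).mem_weightSpan (add_mem hχ hψ)
      | zero => rw [TensorProduct.tmul_zero]; exact zero_mem _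
      | add x y _ _ hx hy => rw [TensorProduct.tmul_add]; exact add_mem hx hy
      | smul c x _ hx => rw [TensorProduct.tmul_smul]; exact Submodule.smul_mem _ c hx
    | zero => rw [TensorProduct.zero_tmul]; exact zero_mem _
    | add x y _ _ hx hy => rw [TensorProduct.add_tmul]; exact add_mem hx hy
    | smul c x _ hx => rw [← TensorProduct.smul_tmul']; exact Submodule.smul_mem _ c hx

/-- A set of weights that is stable under adding the roots of `𝔭` gives a submodule. -/
def weightSubmodule (A : Set (Dual ℂ H))
    (hA : ∀ χ ∈ A, ∀ α : H.root, coeff b j α ≤ 0 → χ + (rootSystem H).root α ∈ A) :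
    LieSubmodule ℂ (parabolic b j) V where
  __ := weightSpan b j V A
  lie_mem := by
    intro x v hv
    change v ∈ weightSpan b j V A at hv
    change ⁅x, v⁆ ∈ weightSpan b j V A
    induction hv using Submodule.span_induction with
    | mem v hv =>
      obtain ⟨χ, hχ, hv⟩ := hv
      refine parabolic_induction (p := fun x ↦ ⁅x, v⁆ ∈ weightSpan b j V A) ?_ ?_ ?_ x
      · intro h
        rw [hv.lie_cartan]
        exact Submodule.smul_mem _ _ (hv.mem_weightSpan hχ)
      · intro α hα x hx
        exact (hv.lie_root hx).mem_weightSpan (hA χ hχ α hα)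
      · intro x y hx hy
        rw [add_lie]
        exact add_mem hx hy
    | zero => rw [lie_zero]; exact zero_mem _
    | add v w _ _ hv hw => rw [lie_add]; exact add_mem hv hw
    | smul c v _ hv => rw [lie_smul]; exact Submodule.smul_mem _ c hv

end Weights

/-! ### Heights, coefficients and the positive cone -/

variable (b j)

/-- The monoid generated by the simple roots. -/
def posCone : AddSubmonoid (Dual ℂ H) :=
  AddSubmonoid.closure (Set.range fun i : b.support ↦ (rootSystem H).root i)

/-- The linear form taking the value `1` on all simple roots. -/
noncomputable def heightForm : Dual ℂ H →ₗ[ℂ] ℂ := b.toWeightBasis.constr ℂ fun _ ↦ 1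

/-- The coefficient of a weight at the simple root `α_i`. -/
noncomputable def coeffForm (i : b.support) : Dual ℂ H →ₗ[ℂ] ℂ := b.toWeightBasis.coord i

variable {b j}

theorem heightForm_root (i : b.support) : heightForm b ((rootSystem H).root i) = 1 := by
  rw [← b.toWeightBasis_apply, heightForm, Basis.constr_basis]

open Classical in
theorem coeffForm_root (i k : b.support) :
    coeffForm b i ((rootSystem H).root k) = if k = i then 1 else 0 := by
  rw [← b.toWeightBasis_apply, coeffForm, Basis.coord_apply, Basis.repr_self,
    Finsupp.single_apply]

theorem root_mem_posCone (i : b.support) : (rootSystem H).root i ∈ posCone b :=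
  AddSubmonoid.subset_closure ⟨i, rfl⟩

theorem root_mem_posCone_or (α : H.root) :
    (rootSystem H).root α ∈ posCone b ∨ -(rootSystem H).root α ∈ posCone b := by
  have := b.root_mem_or_neg_mem α
  rwa [Set.image_eq_range] at this

theorem exists_heightForm_eq_nat {β : Dual ℂ H} (hβ : β ∈ posCone b) :
    ∃ n : ℕ, heightForm b β = n := by
  induction hβ using AddSubmonoid.closure_induction with
  | mem x hx => obtain ⟨i, rfl⟩ := hx; exact ⟨1, by rw [heightForm_root, Nat.cast_one]⟩
  | zero => exact ⟨0, by simp⟩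
  | add x y _ _ hx hy =>
    obtain ⟨m, hm⟩ := hx
    obtain ⟨n, hn⟩ := hy
    exact ⟨m + n, by rw [map_add, hm, hn, Nat.cast_add]⟩

theorem exists_coeffForm_eq_nat {β : Dual ℂ H} (hβ : β ∈ posCone b) (i : b.support) :
    ∃ n : ℕ, coeffForm b i β = n := by
  induction hβ using AddSubmonoid.closure_induction with
  | mem x hx =>
    obtain ⟨k, rfl⟩ := hx
    classical
    exact ⟨if k = i then 1 else 0, by simp only [coeffForm_root]; split_ifs <;> simp⟩
  | zero => exact ⟨0, by simp⟩
  | add x y _ _ hx hy =>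
    obtain ⟨m, hm⟩ := hx
    obtain ⟨n, hn⟩ := hy
    exact ⟨m + n, by rw [map_add, hm, hn, Nat.cast_add]⟩

theorem eq_zero_of_mem_posCone_of_neg_mem {β : Dual ℂ H} (hβ : β ∈ posCone b)
    (hβ' : -β ∈ posCone b) : β = 0 := by
  refine b.toWeightBasis.ext_elem fun i ↦ ?_
  obtain ⟨m, hm⟩ := exists_coeffForm_eq_nat hβ i
  obtain ⟨n, hn⟩ := exists_coeffForm_eq_nat hβ' i
  change coeffForm b i β = coeffForm b i 0
  rw [map_neg, hm] at hn
  have h : m + n = 0 := by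
    have h1 : ((m + n : ℕ) : ℂ) = 0 := by push_cast; rw [← hn]; ring
    exact_mod_cast h1
  rw [hm, map_zero, show m = 0 by lia, Nat.cast_zero]

theorem root_ne_zero (α : H.root) : (rootSystem H).root α ≠ 0 := (rootSystem H).ne_zero α

theorem heightForm_eq_height (α : H.root) :
    heightForm b ((rootSystem H).root α) = b.height α := by
  obtain ⟨f, -, -, hf⟩ := b.exists_root_eq_sum_int α
  rw [RootPairing.Base.height_eq_sum hf, hf, map_sum, Int.cast_sum]
  refine Finset.sum_congr rfl fun i hi ↦ ?_
  rw [map_zsmul, heightForm_root ⟨i, hi⟩, zsmul_eq_mul, mul_one]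

theorem isPos_iff_mem_posCone {α : H.root} :
    b.IsPos α ↔ (rootSystem H).root α ∈ posCone b := by
  constructor
  · intro h
    rcases root_mem_posCone_or (b := b) α with h' | h'
    · exact h'
    · obtain ⟨n, hn⟩ := exists_heightForm_eq_nat h'
      rw [map_neg, heightForm_eq_height] at hn
      have : -b.height α = n := by exact_mod_cast hn
      rw [b.isPos_iff] at h
      lia
  · intro h
    obtain ⟨n, hn⟩ := exists_heightForm_eq_nat h
    rw [heightForm_eq_height] at hn
    have : b.height α = n := by exact_mod_cast hn
    rw [b.isPos_iff']
    lia

theorem neg_root_mem_posCone {α : H.root} (h : ¬ b.IsPos α) :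
    -(rootSystem H).root α ∈ posCone b :=
  (root_mem_posCone_or α).resolve_left fun h' ↦ h (isPos_iff_mem_posCone.mpr h')

theorem coeffForm_eq_coeff (α : H.root) :
    coeffForm b j ((rootSystem H).root α) = coeff b j α := by
  classical
  obtain ⟨c, hc⟩ : ∃ c, c = b.toWeightBasisInt.repr ((rootSystem H).rootSpanMem ℤ α) := ⟨_, rfl⟩
  have h1 : (rootSystem H).rootSpanMem ℤ α = ∑ i, c i • b.toWeightBasisInt i := by
    rw [hc, Basis.sum_repr]
  have h2 : (rootSystem H).root α = ∑ i, c i • (rootSystem H).root i := by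
    have := congrArg (Subtype.val) h1
    simpa using this
  rw [coeff, ← hc, h2, map_sum]
  simp_rw [map_zsmul, coeffForm_root]
  simp

theorem coeff_nonneg {α : H.root} (h : b.IsPos α) : 0 ≤ coeff b j α := by
  obtain ⟨n, hn⟩ := exists_coeffForm_eq_nat (isPos_iff_mem_posCone.mp h) j
  rw [coeffForm_eq_coeff] at hn
  have : coeff b j α = n := by exact_mod_cast hn
  lia

/-! ### Highest weight modules over `𝔭` -/

section HighestWeight

variable {V : Type*} [AddCommGroup V] [Module ℂ V] [LieRingModule (parabolic b j) V]
  [LieModule ℂ (parabolic b j) V]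

variable (b j) in
/-- `v` is a vector of weight `lam` which the positive root vectors of `𝔭` map into `N`. For
`N = ⊥` this is a maximal vector; in general its image in `V ⧸ N` is one. -/
def IsMaximalMod (N : Submodule ℂ V) (lam : Dual ℂ H) (v : V) : Prop :=
  IsWeightVector b j lam v ∧ ∀ α : H.root, b.IsPos α → ∀ x, IsRootVector b j α x → ⁅x, v⁆ ∈ N

/-- The subspace spanned by the `y_1 ⋯ y_l v` with `l ≤ k` and negative root vectors `y_i`. -/
def negFiltration (v : V) : ℕ → Submodule ℂ V
  | 0 => Submodule.span ℂ {v}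
  | k + 1 => negFiltration v k ⊔ Submodule.span ℂ {w | ∃ α : H.root, ¬ b.IsPos α ∧
      ∃ x : parabolic b j, IsRootVector b j α x ∧ ∃ s ∈ negFiltration v k, w = ⁅x, s⁆}

theorem negFiltration_mono (v : V) : Monotone (negFiltration (b := b) (j := j) v) :=
  monotone_nat_of_le_succ fun _ ↦ le_sup_left

theorem lie_mem_negFiltration {v : V} {lam : Dual ℂ H}
    (hv : IsMaximalMod b j (⊥ : Submodule ℂ V) lam v) (k : ℕ) :
    (∀ s ∈ negFiltration (b := b) (j := j) v k,
      (∀ h, ⁅cartanIncl b j h, s⁆ ∈ negFiltration (b := b) (j := j) v k) ∧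
      (∀ α : H.root, b.IsPos α → ∀ x, IsRootVector b j α x →
        ⁅x, s⁆ ∈ negFiltration (b := b) (j := j) v k)) ∧
    ∀ s ∈ negFiltration (b := b) (j := j) v k, ∀ x : parabolic b j,
      ⁅x, s⁆ ∈ negFiltration (b := b) (j := j) v (k + 1) := by
  have step : ∀ k, (∀ s ∈ negFiltration (b := b) (j := j) v k,
      (∀ h, ⁅cartanIncl b j h, s⁆ ∈ negFiltration (b := b) (j := j) v k) ∧
      (∀ α : H.root, b.IsPos α → ∀ x, IsRootVector b j α x →
        ⁅x, s⁆ ∈ negFiltration (b := b) (j := j) v k)) →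
      ∀ s ∈ negFiltration (b := b) (j := j) v k, ∀ x : parabolic b j,
      ⁅x, s⁆ ∈ negFiltration (b := b) (j := j) v (k + 1) := by
    intro k h s hs x
    refine parabolic_induction (p := fun x ↦ ⁅x, s⁆ ∈ negFiltration (b := b) (j := j) v (k + 1))
      ?_ ?_ ?_ x
    · exact fun y ↦ (negFiltration_mono v k.le_succ) ((h s hs).1 y)
    · intro α hα y hy
      by_cases hp : b.IsPos α
      · exact (negFiltration_mono v k.le_succ) ((h s hs).2 α hp y hy)
      · exact Submodule.mem_sup_right (Submodule.subset_span ⟨α, hp, y, hy, s, hs, rfl⟩)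
    · intro y z hy hz
      rw [add_lie]
      exact add_mem hy hz
  suffices h : ∀ s ∈ negFiltration (b := b) (j := j) v k,
      (∀ h, ⁅cartanIncl b j h, s⁆ ∈ negFiltration (b := b) (j := j) v k) ∧
      (∀ α : H.root, b.IsPos α → ∀ x, IsRootVector b j α x →
        ⁅x, s⁆ ∈ negFiltration (b := b) (j := j) v k) from ⟨h, step k h⟩
  induction k with
  | zero =>
    intro s hs
    obtain ⟨c, rfl⟩ := Submodule.mem_span_singleton.mp hs
    constructor
    · intro h
      rw [lie_smul, hv.1.lie_cartan]
      exact Submodule.smul_mem _ _ (Submodule.smul_mem _ _ (Submodule.mem_span_singleton_self v))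
    · intro α hα x hx
      rw [lie_smul, (Submodule.mem_bot _).mp (hv.2 α hα x hx), smul_zero]
      exact zero_mem _
  | succ k ih =>
    have key : ∀ x : parabolic b j,
        (∀ s ∈ negFiltration (b := b) (j := j) v k,
          ⁅x, s⁆ ∈ negFiltration (b := b) (j := j) v k) →
        ∀ s ∈ negFiltration (b := b) (j := j) v (k + 1),
          ⁅x, s⁆ ∈ negFiltration (b := b) (j := j) v (k + 1) := by
      intro x hx _ hst
      obtain ⟨s, hs, t, ht, rfl⟩ := Submodule.mem_sup.mp hst
      clear hst
      rw [lie_add]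
      refine add_mem (negFiltration_mono v k.le_succ (hx s hs)) ?_
      induction ht using Submodule.span_induction with
      | mem t ht =>
        obtain ⟨α, hα, y, hy, u, hu, rfl⟩ := ht
        rw [leibniz_lie]
        refine add_mem (step k ih u hu _) ?_
        exact Submodule.mem_sup_right (Submodule.subset_span ⟨α, hα, y, hy, _, hx u hu, rfl⟩)
      | zero => rw [lie_zero]; exact zero_mem _
      | add y z _ _ hy hz => rw [lie_add]; exact add_mem hy hz
      | smul c y _ hy => rw [lie_smul]; exact Submodule.smul_mem _ c hy
    intro s hs
    exact ⟨fun h ↦ key _ (fun t ht ↦ (ih t ht).1 h) s hs,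
      fun α hα x hx ↦ key x (fun t ht ↦ (ih t ht).2 α hα x hx) s hs⟩

/-- The submodule generated by a maximal vector is obtained by applying negative root vectors. -/
theorem mem_lieSpan_iff {v : V} {lam : Dual ℂ H}
    (hv : IsMaximalMod b j (⊥ : Submodule ℂ V) lam v) {w : V} :
    w ∈ LieSubmodule.lieSpan ℂ (parabolic b j) {v} ↔
      ∃ k, w ∈ negFiltration (b := b) (j := j) v k := by
  have hdir : Directed (· ≤ ·) (negFiltration (b := b) (j := j) v) :=
    (negFiltration_mono v).directed_le
  let S : LieSubmodule ℂ (parabolic b j) V :=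
    { (⨆ k, negFiltration (b := b) (j := j) v k) with
      lie_mem := by
        intro x m hm
        change m ∈ ⨆ k, negFiltration (b := b) (j := j) v k at hm
        change ⁅x, m⁆ ∈ ⨆ k, negFiltration (b := b) (j := j) v k
        obtain ⟨k, hk⟩ := (Submodule.mem_iSup_of_directed _ hdir).mp hm
        exact Submodule.mem_iSup_of_mem (k + 1) ((lie_mem_negFiltration hv k).2 m hk x) }
  constructor
  · intro h
    have : LieSubmodule.lieSpan ℂ (parabolic b j) {v} ≤ S := by
      rw [LieSubmodule.lieSpan_le, Set.singleton_subset_iff]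
      exact Submodule.mem_iSup_of_mem (p := negFiltration (b := b) (j := j) v) 0
        (Submodule.mem_span_singleton_self v)
    exact (Submodule.mem_iSup_of_directed _ hdir).mp (this h)
  · rintro ⟨k, hk⟩
    induction k generalizing w with
    | zero =>
      obtain ⟨c, rfl⟩ := Submodule.mem_span_singleton.mp hk
      exact SMulMemClass.smul_mem c (LieSubmodule.subset_lieSpan (Set.mem_singleton v))
    | succ k ih =>
      obtain ⟨s, hs, t, ht, rfl⟩ := Submodule.mem_sup.mp hk
      clear hk
      refine add_mem (ih hs) ?_
      induction ht using Submodule.span_induction with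
      | mem t ht =>
        obtain ⟨α, hα, y, hy, u, hu, rfl⟩ := ht
        exact LieSubmodule.lie_mem _ (ih hu)
      | zero => exact zero_mem _
      | add y z _ _ hy hz => exact add_mem hy hz
      | smul c y _ hy => exact SMulMemClass.smul_mem c hy

theorem negFiltration_le {v : V} {lam : Dual ℂ H} (hv : IsWeightVector b j lam v) (k : ℕ) :
    negFiltration (b := b) (j := j) v k ≤
      Submodule.span ℂ {v} ⊔ weightSpan b j V {χ | lam - χ ∈ posCone b ∧ χ ≠ lam} := by
  induction k with
  | zero => exact le_sup_left
  | succ k ih =>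
    refine sup_le ih (Submodule.span_le.mpr ?_)
    rintro _ ⟨α, hα, x, hx, _, hs, rfl⟩
    refine Submodule.mem_sup_right ?_
    have hα' := neg_root_mem_posCone hα
    obtain ⟨t, ht, u, hu, rfl⟩ := Submodule.mem_sup.mp (ih hs)
    obtain ⟨c, rfl⟩ := Submodule.mem_span_singleton.mp ht
    clear hs ht
    rw [lie_add, lie_smul]
    refine add_mem (Submodule.smul_mem _ c ((hv.lie_root hx).mem_weightSpan ⟨?_, ?_⟩)) ?_
    · simpa using hα'
    · simp
    · induction hu using Submodule.span_induction with
      | mem u hu =>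
        obtain ⟨χ, hχ, hu⟩ := hu
        refine (hu.lie_root hx).mem_weightSpan ⟨?_, ?_⟩
        · rw [← sub_sub, sub_eq_add_neg (lam - χ)]
          exact add_mem hχ.1 hα'
        · intro h
          refine root_ne_zero α (eq_zero_of_mem_posCone_of_neg_mem (b := b) ?_ hα')
          rw [eq_sub_of_add_eq' h]
          exact hχ.1
      | zero => rw [lie_zero]; exact zero_mem _
      | add y z _ _ hy hz => rw [lie_add]; exact add_mem hy hz
      | smul c y _ hy => rw [lie_smul]; exact Submodule.smul_mem _ c hy

theorem exists_sub_smul_mem_weightSpan {v : V} {lam : Dual ℂ H}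
    (hv : IsMaximalMod b j (⊥ : Submodule ℂ V) lam v) {w : V}
    (hw : w ∈ LieSubmodule.lieSpan ℂ (parabolic b j) {v}) :
    ∃ c : ℂ, w - c • v ∈ weightSpan b j V {χ | lam - χ ∈ posCone b ∧ χ ≠ lam} := by
  obtain ⟨k, hk⟩ := (mem_lieSpan_iff hv).mp hw
  obtain ⟨t, ht, u, hu, rfl⟩ := Submodule.mem_sup.mp (negFiltration_le hv.1 k hk)
  obtain ⟨c, rfl⟩ := Submodule.mem_span_singleton.mp ht
  exact ⟨c, by simpa using hu⟩

theorem lieSpan_le_weightSpan {v : V} {lam : Dual ℂ H}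
    (hv : IsMaximalMod b j (⊥ : Submodule ℂ V) lam v) :
    (LieSubmodule.lieSpan ℂ (parabolic b j) {v}).toSubmodule ≤
      weightSpan b j V {χ | lam - χ ∈ posCone b} := by
  intro w hw
  obtain ⟨c, hc⟩ := exists_sub_smul_mem_weightSpan hv hw
  rw [← sub_add_cancel w (c • v)]
  refine add_mem (weightSpan_mono (fun χ h ↦ h.1) hc) (Submodule.smul_mem _ c ?_)
  exact hv.1.mem_weightSpan (by simp [zero_mem])

/-- The weights of a highest weight module are below the highest weight. -/
theorem sub_mem_posCone_of_mem_lieSpan {v : V} {lam : Dual ℂ H}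
    (hv : IsMaximalMod b j (⊥ : Submodule ℂ V) lam v) {w : V}
    (hw : w ∈ LieSubmodule.lieSpan ℂ (parabolic b j) {v}) {μ : Dual ℂ H}
    (hμ : IsWeightVector b j μ w) (h0 : w ≠ 0) : lam - μ ∈ posCone b := by
  by_contra h
  exact h0 (eq_zero_of_mem_weightSpan (lieSpan_le_weightSpan hv hw) hμ h)

/-- The highest weight space is one-dimensional. -/
theorem exists_smul_eq_of_mem_lieSpan {v : V} {lam : Dual ℂ H}
    (hv : IsMaximalMod b j (⊥ : Submodule ℂ V) lam v) {w : V}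
    (hw : w ∈ LieSubmodule.lieSpan ℂ (parabolic b j) {v})
    (hμ : IsWeightVector b j lam w) : ∃ c : ℂ, w = c • v := by
  obtain ⟨c, hc⟩ := exists_sub_smul_mem_weightSpan hv hw
  refine ⟨c, sub_eq_zero.mp (eq_zero_of_mem_weightSpan hc (hμ.sub (hv.1.smul c)) ?_)⟩
  simp

end HighestWeight

/-! ### Existence and dominance of maximal vectors -/

section MaximalVectors

variable {V : Type*} [AddCommGroup V] [Module ℂ V] [LieRingModule (parabolic b j) V]
  [LieModule ℂ (parabolic b j) V]
  {V' : Type*} [AddCommGroup V'] [Module ℂ V'] [LieRingModule (parabolic b j) V']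
  [LieModule ℂ (parabolic b j) V']

theorem isMaximalMod_bot_iff {lam : Dual ℂ H} {v : V} :
    IsMaximalMod b j (⊥ : Submodule ℂ V) lam v ↔ IsWeightVector b j lam v ∧
      ∀ α : H.root, b.IsPos α → ∀ x, IsRootVector b j α x → ⁅x, v⁆ = 0 := Iff.rfl

theorem IsMaximalMod.mono {N N' : Submodule ℂ V} {lam : Dual ℂ H} {v : V}
    (hv : IsMaximalMod b j N lam v) (h : N ≤ N') : IsMaximalMod b j N' lam v :=
  ⟨hv.1, fun α hα x hx ↦ h (hv.2 α hα x hx)⟩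

theorem IsMaximalMod.map_bot {N : LieSubmodule ℂ (parabolic b j) V} {lam : Dual ℂ H} {v : V}
    (hv : IsMaximalMod b j N.toSubmodule lam v) (f : V →ₗ⁅ℂ, parabolic b j⁆ V')
    (hf : ∀ x ∈ N, f x = 0) : IsMaximalMod b j (⊥ : Submodule ℂ V') lam (f v) := by
  refine ⟨hv.1.map f, fun α hα x hx ↦ ?_⟩
  rw [Submodule.mem_bot, ← LieModuleHom.map_lie]
  exact hf _ (hv.2 α hα x hx)

theorem IsMaximalMod.mk {N : LieSubmodule ℂ (parabolic b j) V} {lam : Dual ℂ H} {v : V}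
    (hv : IsMaximalMod b j N.toSubmodule lam v) :
    IsMaximalMod b j (⊥ : Submodule ℂ (V ⧸ N)) lam (LieSubmodule.Quotient.mk' N v) :=
  hv.map_bot _ fun _ hx ↦ (LieSubmodule.Quotient.mk_eq_zero N).mpr hx

theorem mk_mem_lieSpan {N : LieSubmodule ℂ (parabolic b j) V} {v w : V}
    (hw : w ∈ N ⊔ LieSubmodule.lieSpan ℂ (parabolic b j) {v}) :
    LieSubmodule.Quotient.mk' N w ∈
      LieSubmodule.lieSpan ℂ (parabolic b j) {LieSubmodule.Quotient.mk' N v} := by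
  obtain ⟨y, hy, z, hz, rfl⟩ := (LieSubmodule.mem_sup _ _ _).mp hw
  rw [map_add, (LieSubmodule.Quotient.mk_eq_zero N).mpr hy, zero_add]
  have : LieSubmodule.lieSpan ℂ (parabolic b j) {v} ≤
      (LieSubmodule.lieSpan ℂ (parabolic b j) {LieSubmodule.Quotient.mk' N v}).comap
        (LieSubmodule.Quotient.mk' N) := by
    rw [LieSubmodule.lieSpan_le, Set.singleton_subset_iff]
    exact LieSubmodule.subset_lieSpan (Set.mem_singleton _)
  exact this hz

/-- Weights of a subquotient generated by a maximal vector are below its weight. -/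
theorem IsMaximalMod.sub_mem_posCone {N : LieSubmodule ℂ (parabolic b j) V} {lam μ : Dual ℂ H}
    {v w : V} (hv : IsMaximalMod b j N.toSubmodule lam v)
    (hw : w ∈ N ⊔ LieSubmodule.lieSpan ℂ (parabolic b j) {v}) (hμ : IsWeightVector b j μ w)
    (h0 : w ∉ N) : lam - μ ∈ posCone b :=
  sub_mem_posCone_of_mem_lieSpan hv.mk (mk_mem_lieSpan hw) (hμ.map _)
    fun h ↦ h0 ((LieSubmodule.Quotient.mk_eq_zero N).mp h)

/-- A simple subquotient has only one maximal weight. -/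
theorem IsMaximalMod.eq_of_covBy {A F : LieSubmodule ℂ (parabolic b j) V} (hAF : A ⋖ F)
    {lam μ : Dual ℂ H} {v w : V} (hv : IsMaximalMod b j A.toSubmodule lam v)
    (hw : IsMaximalMod b j A.toSubmodule μ w) (hvF : v ∈ F) (hwF : w ∈ F) (hvA : v ∉ A)
    (hwA : w ∉ A) : lam = μ := by
  have gen : ∀ u ∈ F, u ∉ A → F = A ⊔ LieSubmodule.lieSpan ℂ (parabolic b j) {u} := by
    intro u huF huA
    have hu : u ∈ A ⊔ LieSubmodule.lieSpan ℂ (parabolic b j) {u} :=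
      (le_sup_right : _ ≤ A ⊔ _) (LieSubmodule.subset_lieSpan (Set.mem_singleton u))
    rcases hAF.eq_or_eq (c := A ⊔ LieSubmodule.lieSpan ℂ (parabolic b j) {u}) le_sup_left
      (sup_le hAF.le (by rwa [LieSubmodule.lieSpan_le, Set.singleton_subset_iff])) with h | h
    · rw [h] at hu
      exact absurd hu huA
    · exact h.symm
  refine sub_eq_zero.mp (eq_zero_of_mem_posCone_of_neg_mem
    (hv.sub_mem_posCone (gen v hvF hvA ▸ hwF) hw.1 hwA) ?_)
  rw [neg_sub]
  exact hw.sub_mem_posCone (gen w hwF hwA ▸ hvF) hv.1 hvA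

variable (b j V) in
theorem finite_weights [FiniteDimensional ℂ V] :
    {χ : Dual ℂ H | ∃ v : V, v ≠ 0 ∧ IsWeightVector b j χ v}.Finite := by
  classical
  choose f hf using fun χ : {χ : Dual ℂ H | ∃ v : V, v ≠ 0 ∧ IsWeightVector b j χ v} ↦ χ.2
  have : LinearIndependent ℂ f := by
    rw [linearIndependent_iff']
    intro s g hs χ hχ
    have key := eq_zero_of_sum_weightVectors_eq_zero (b := b) (j := j)
      (s.map (Function.Embedding.subtype _))
      (fun ψ ↦ if h : ∃ v : V, v ≠ 0 ∧ IsWeightVector b j ψ v then g ⟨ψ, h⟩ • f ⟨ψ, h⟩ else 0)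
      ?_ ?_ χ (Finset.mem_map_of_mem _ hχ)
    · have hχ' : ∃ v : V, v ≠ 0 ∧ IsWeightVector b j χ v := χ.2
      simp only [dif_pos hχ'] at key
      exact (smul_eq_zero.mp key).resolve_right (hf χ).1
    · intro ψ hψ
      obtain ⟨ψ, -, rfl⟩ := Finset.mem_map.mp hψ
      rw [dif_pos (by exact ψ.2)]
      exact (hf ψ).2.smul _
    · rw [Finset.sum_map]
      refine (Finset.sum_congr rfl fun ψ _ ↦ ?_).trans hs
      rw [dif_pos (by exact ψ.2)]
      rfl
  exact this.finite

/-- A nonzero finite-dimensional module spanned by weight vectors contains a maximal vector. -/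
theorem exists_maximal_vector [FiniteDimensional ℂ V] [Nontrivial V] {A : Set (Dual ℂ H)}
    (hA : weightSpan b j V A = ⊤) :
    ∃ lam ∈ A, ∃ v : V, v ≠ 0 ∧ IsMaximalMod b j (⊥ : Submodule ℂ V) lam v := by
  have hne : {χ : Dual ℂ H | ∃ v : V, v ≠ 0 ∧ IsWeightVector b j χ v}.Nonempty := by
    by_contra hc
    rw [Set.not_nonempty_iff_eq_empty] at hc
    obtain ⟨v, hv⟩ := exists_ne (0 : V)
    refine hv ?_
    have : weightSpan b j V A ≤ ⊥ := by
      refine Submodule.span_le.mpr ?_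
      rintro w ⟨χ, -, hw⟩
      by_contra h0
      have : χ ∈ {χ : Dual ℂ H | ∃ v : V, v ≠ 0 ∧ IsWeightVector b j χ v} := ⟨w, h0, hw⟩
      rw [hc] at this
      exact this
    exact (Submodule.mem_bot ℂ).mp (this (hA ▸ Submodule.mem_top))
  obtain ⟨lam, ⟨v, hv0, hv⟩, hmax⟩ := Set.exists_max_image _ (fun χ ↦ (heightForm b χ).re)
    (finite_weights b j V) hne
  refine ⟨lam, ?_, v, hv0, hv, fun α hα x hx ↦ ?_⟩
  · by_contra h
    exact hv0 (eq_zero_of_mem_weightSpan (hA ▸ Submodule.mem_top) hv h)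
  · by_contra h0
    have := hmax _ ⟨_, h0, hv.lie_root hx⟩
    rw [map_add, heightForm_eq_height, Complex.add_re, Complex.intCast_re] at this
    have hp : (0 : ℝ) < b.height α := by exact_mod_cast hα
    linarith

theorem exists_maximal_between [FiniteDimensional ℂ V] {A : Set (Dual ℂ H)}
    (hA : weightSpan b j V A = ⊤) {F B : LieSubmodule ℂ (parabolic b j) V} (hFB : F < B) :
    ∃ lam ∈ A, ∃ v ∈ B, v ∉ F ∧ IsMaximalMod b j F.toSubmodule lam v := by
  let f : B →ₗ⁅ℂ, parabolic b j⁆ V ⧸ F := (LieSubmodule.Quotient.mk' F).comp B.incl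
  obtain ⟨u, huB, huF⟩ := SetLike.exists_of_lt hFB
  have hf : ∀ x : B, f x = 0 ↔ (x : V) ∈ F := fun x ↦ LieSubmodule.Quotient.mk_eq_zero F
  have hr : weightSpan b j f.range A = ⊤ :=
    weightSpan_sub_eq_top (weightSpan_eq_top_of_surjective hA _
      (LieSubmodule.Quotient.surjective_mk' F)) _
  have : Nontrivial f.range := by
    refine ⟨⟨f ⟨u, huB⟩, ?_⟩, 0, ?_⟩
    · exact (LieModuleHom.mem_range f _).mpr ⟨_, rfl⟩
    · intro h
      exact huF ((hf _).mp (congrArg Subtype.val h))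
  obtain ⟨lam, hlam, ⟨v, hvr⟩, hv0, hv⟩ := exists_maximal_vector hr
  obtain ⟨w, rfl⟩ := (LieModuleHom.mem_range f _).mp hvr
  have hvw : IsWeightVector b j lam (f w) := isWeightVector_coe.mpr hv.1
  obtain ⟨w', hw', hww', -⟩ := exists_weightVector_lift f
    ((weightSpan_sub_eq_top hA B).symm ▸ Submodule.mem_top) hvw
  refine ⟨lam, hlam, w', w'.2, ?_, isWeightVector_coe.mpr hw', fun α hα x hx ↦ ?_⟩
  · intro h
    rw [← hf, hww'] at h
    exact hv0 (Subtype.ext h)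
  · have h := congrArg Subtype.val ((Submodule.mem_bot ℂ).mp (hv.2 α hα x hx))
    have h' : f ⁅x, w'⁆ = 0 := by
      rw [LieModuleHom.map_lie, hww']
      exact h
    exact (hf _).mp h'

theorem exists_neg_root (α : H.root) :
    ∃ α' : H.root, (rootSystem H).root α' = -(rootSystem H).root α ∧
      ((α'.1 : LieModule.Weight ℂ H 𝔤) : H → ℂ) = -(α.1 : H → ℂ) := by
  refine ⟨⟨-α.1, ?_⟩, ?_, rfl⟩
  · simpa using LieSubalgebra.isNonZero_coe_root α
  · ext h
    rfl

theorem coeff_root (i : b.support) (hi : i ≠ j) : coeff b j i = 0 := by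
  classical
  have := coeffForm_eq_coeff (b := b) (j := j) (i : H.root)
  rw [coeffForm_root, if_neg hi] at this
  exact_mod_cast this.symm

/-- The `𝔰𝔩₂`-triples of the simple roots of the Levi part of `𝔭`. -/
theorem exists_isSl2Triple {i : b.support} (hi : i ≠ j) :
    ∃ (e f : parabolic b j) (α' : H.root),
      IsSl2Triple (cartanIncl b j ((rootSystem H).coroot i)) e f ∧ IsRootVector b j i e ∧
      IsRootVector b j α' f ∧ (rootSystem H).root α' = -(rootSystem H).root i := by
  obtain ⟨h, e, f, ht, he, hf⟩ := exists_isSl2Triple_of_weight_isNonZero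
    (LieSubalgebra.isNonZero_coe_root (i : H.root))
  have hh := ht.h_eq_coroot (LieSubalgebra.isNonZero_coe_root (i : H.root)) he hf
  obtain ⟨α', hα', hα''⟩ := exists_neg_root (i : H.root)
  rw [← hα''] at hf
  have hc : coeff b j α' = 0 := by
    have h1 := coeffForm_eq_coeff (b := b) (j := j) α'
    rw [hα', map_neg, coeffForm_eq_coeff, coeff_root i hi] at h1
    simpa using h1.symm
  refine ⟨⟨e, rootSpace_le_parabolicSubmodule b j i (coeff_root i hi).le he⟩,
    ⟨f, rootSpace_le_parabolicSubmodule b j α' hc.le hf⟩, α', ?_, he, hf, hα'⟩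
  have hh' : cartanIncl b j ((rootSystem H).coroot i) =
      ⟨h, hh ▸ cartan_le_parabolicSubmodule b j ((rootSystem H).coroot i).2⟩ :=
    Subtype.ext hh.symm
  rw [hh']
  exact ⟨fun h0 ↦ ht.h_ne_zero (congrArg Subtype.val h0), Subtype.ext ht.lie_e_f,
    Subtype.ext ht.lie_h_e_nsmul, Subtype.ext ht.lie_h_f_nsmul⟩

/-- The weight of a maximal vector of a finite-dimensional module is dominant for the Levi part. -/
theorem IsMaximalMod.exists_nat [FiniteDimensional ℂ V] {lam : Dual ℂ H} {v : V}
    (hv : IsMaximalMod b j (⊥ : Submodule ℂ V) lam v) (h0 : v ≠ 0) (i : b.support) (hi : i ≠ j) :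
    ∃ m : ℕ, lam ((rootSystem H).coroot i) = m := by
  obtain ⟨e, f, α', ht, he, -, -⟩ := exists_isSl2Triple hi
  exact IsSl2Triple.HasPrimitiveVectorWith.exists_nat (t := ht) (m := v)
    ⟨h0, hv.1.lie_cartan _, hv.2 i (b.isPos_of_mem_support i.2) e he⟩

end MaximalVectors

/-! ### Simple subquotients and extensions -/

section Blocks

variable {V : Type*} [AddCommGroup V] [Module ℂ V] [LieRingModule (parabolic b j) V]
  [LieModule ℂ (parabolic b j) V]
  {V' : Type*} [AddCommGroup V'] [Module ℂ V'] [LieRingModule (parabolic b j) V']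
  [LieModule ℂ (parabolic b j) V']
  {V'' : Type*} [AddCommGroup V''] [Module ℂ V''] [LieRingModule (parabolic b j) V'']
  [LieModule ℂ (parabolic b j) V'']

variable (b j V) in
/-- Finite-dimensional modules have isomorphic copies in `Type`. -/
theorem exists_small_copy [FiniteDimensional ℂ V] :
    ∃ (E : Type) (_ : AddCommGroup E) (_ : Module ℂ E) (_ : LieRingModule (parabolic b j) E)
      (_ : LieModule ℂ (parabolic b j) E) (f : V →ₗ⁅ℂ, parabolic b j⁆ E),
      FiniteDimensional ℂ E ∧ Function.Bijective f := by
  let e : V ≃ₗ[ℂ] (Fin (finrank ℂ V) → ℂ) := (finBasis ℂ V).equivFun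
  let i1 : LieRingModule (parabolic b j) (Fin (finrank ℂ V) → ℂ) :=
    { bracket := fun x w ↦ e ⁅x, e.symm w⁆
      add_lie := fun x y w ↦ by
        change e ⁅x + y, e.symm w⁆ = e ⁅x, e.symm w⁆ + e ⁅y, e.symm w⁆
        rw [add_lie, map_add]
      lie_add := fun x v w ↦ by
        change e ⁅x, e.symm (v + w)⁆ = e ⁅x, e.symm v⁆ + e ⁅x, e.symm w⁆
        rw [map_add, lie_add, map_add]
      leibniz_lie := fun x y w ↦ by
        change e ⁅x, e.symm (e ⁅y, e.symm w⁆)⁆ =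
          e ⁅⁅x, y⁆, e.symm w⁆ + e ⁅y, e.symm (e ⁅x, e.symm w⁆)⁆
        rw [e.symm_apply_apply, e.symm_apply_apply, leibniz_lie, map_add] }
  have hb : ∀ (x : parabolic b j) (w : Fin (finrank ℂ V) → ℂ), ⁅x, w⁆ = e ⁅x, e.symm w⁆ :=
    fun _ _ ↦ rfl
  have i2 : LieModule ℂ (parabolic b j) (Fin (finrank ℂ V) → ℂ) :=
    { smul_lie := fun t x w ↦ by rw [hb, hb, smul_lie, map_smul]
      lie_smul := fun t x w ↦ by rw [hb, hb, map_smul, lie_smul, map_smul] }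
  refine ⟨Fin (finrank ℂ V) → ℂ, inferInstance, inferInstance, i1, i2,
    { e.toLinearMap with map_lie' := ?_ }, inferInstance, e.bijective⟩
  intro x m
  change e ⁅x, m⁆ = ⁅x, e m⁆
  rw [hb, e.symm_apply_apply]

theorem isIrreducibleOfMaximalWeight_of_covBy {A F : LieSubmodule ℂ (parabolic b j) V}
    (hAF : A ⋖ F) (φ : F →ₗ⁅ℂ, parabolic b j⁆ V') (hφ : Function.Surjective φ)
    (hker : ∀ x, φ x = 0 ↔ (x : V) ∈ A) {μ : Dual ℂ H} {v : V} (hvF : v ∈ F) (hvA : v ∉ A)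
    (hv : IsMaximalMod b j A.toSubmodule μ v) : IsIrreducibleOfMaximalWeight b j V' μ := by
  have h0 : φ ⟨v, hvF⟩ ≠ 0 := fun h ↦ hvA ((hker _).mp h)
  refine ⟨?_, φ ⟨v, hvF⟩, h0, ((isWeightVector_coe (N := F) (v := ⟨v, hvF⟩)).mp hv.1).map φ,
    fun α hα x hx ↦ ?_⟩
  · have : Nontrivial V' := ⟨_, _, h0⟩
    refine LieModule.IsIrreducible.mk fun N hN ↦ ?_
    have h1 : A ≤ (N.comap φ).map F.incl := by
      intro x hx
      refine (LieSubmodule.mem_map _).mpr ⟨⟨x, hAF.le hx⟩, ?_, rfl⟩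
      rw [LieSubmodule.mem_comap, (hker _).mpr hx]
      exact zero_mem _
    have h2 : (N.comap φ).map F.incl ≤ F := by
      intro x hx
      obtain ⟨y, -, rfl⟩ := (LieSubmodule.mem_map _).mp hx
      exact y.2
    rcases hAF.eq_or_eq h1 h2 with h | h
    · refine absurd ?_ hN
      rw [LieSubmodule.eq_bot_iff]
      intro w hw
      obtain ⟨y, rfl⟩ := hφ w
      rw [hker, ← h]
      exact (LieSubmodule.mem_map _).mpr ⟨y, hw, rfl⟩
    · rw [eq_top_iff]
      intro w _
      obtain ⟨y, rfl⟩ := hφ w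
      have hy : (y : V) ∈ (N.comap φ).map F.incl := by rw [h]; exact y.2
      obtain ⟨z, hz, hzy⟩ := (LieSubmodule.mem_map _).mp hy
      rwa [← Subtype.ext hzy]
  · rw [← LieModuleHom.map_lie]
    exact (hker _).mpr (hv.2 α hα x hx)

/-- A non-split subquotient `B / A` with simple pieces `F / A` and `B / F` gives an arrow. -/
theorem extNeZero_of_covBy [FiniteDimensional ℂ V]
    (hV : weightSpan b j V (weightLattice b) = ⊤) {A F B : LieSubmodule ℂ (parabolic b j) V}
    (hAF : A ⋖ F) (hFB : F ⋖ B) {lam μ : Dual ℂ H} {v w : V}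
    (hv : IsMaximalMod b j A.toSubmodule μ v) (hvF : v ∈ F) (hvA : v ∉ A)
    (hw : IsMaximalMod b j F.toSubmodule lam w) (hwB : w ∈ B) (hwF : w ∉ F)
    (hsplit : ¬ ∃ F', F ⊓ F' = A ∧ F ⊔ F' = B) : ExtNeZero b j lam μ := by
  obtain ⟨E, i1, i2, i3, i4, f, hfd, hf⟩ := exists_small_copy b j (B ⧸ A.comap B.incl)
  let φ : B →ₗ⁅ℂ, parabolic b j⁆ E := f.comp (LieSubmodule.Quotient.mk' (A.comap B.incl))
  have hφ : Function.Surjective φ :=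
    hf.2.comp (LieSubmodule.Quotient.surjective_mk' _)
  have hφ0 : ∀ x : B, φ x = 0 ↔ (x : V) ∈ A := by
    intro x
    change f (LieSubmodule.Quotient.mk' (A.comap B.incl) x) = 0 ↔ _
    rw [map_eq_zero_iff f hf.1, LieSubmodule.Quotient.mk_eq_zero]
    rfl
  let G : LieSubmodule ℂ (parabolic b j) E := (F.comap B.incl).map φ
  have hG : ∀ x : B, φ x ∈ G ↔ (x : V) ∈ F := by
    intro x
    constructor
    · intro h
      obtain ⟨y, hy, hyx⟩ := (LieSubmodule.mem_map _).mp h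
      have h1 : ((x - y : B) : V) ∈ A := by rw [← hφ0, map_sub, hyx, sub_self]
      have h2 : (x : V) = ((x - y : B) : V) + y := by simp
      rw [h2]
      exact add_mem (hAF.le h1) hy
    · intro h
      exact (LieSubmodule.mem_map _).mpr ⟨x, h, rfl⟩
  have hint : weightSpan b j E (weightLattice b) = ⊤ :=
    weightSpan_eq_top_of_surjective (weightSpan_sub_eq_top hV B) φ hφ
  refine ⟨E, i1, i2, i3, i4, G, hfd, hint, ?_, ?_, ?_⟩
  · let ψ : F →ₗ⁅ℂ, parabolic b j⁆ G := LieModuleHom.codRestrict G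
      (φ.comp (LieSubmodule.inclusion hFB.le)) fun x ↦ (hG _).mpr x.2
    refine isIrreducibleOfMaximalWeight_of_covBy hAF ψ ?_ ?_ hvF hvA hv
    · rintro ⟨y, hy⟩
      obtain ⟨x, rfl⟩ := hφ y
      exact ⟨⟨x, (hG x).mp hy⟩, rfl⟩
    · intro x
      exact Subtype.ext_iff.trans (hφ0 (LieSubmodule.inclusion hFB.le x))
  · refine isIrreducibleOfMaximalWeight_of_covBy hFB ((LieSubmodule.Quotient.mk' G).comp φ) ?_ ?_
      hwB hwF hw
    · exact (LieSubmodule.Quotient.surjective_mk' G).comp hφ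
    · intro x
      rw [← hG x]
      exact LieSubmodule.Quotient.mk_eq_zero G
  · rintro ⟨G', hG'⟩
    have key : ∀ x : V, x ∈ (G'.comap φ).map B.incl ↔ ∃ hx : x ∈ B, φ ⟨x, hx⟩ ∈ G' := by
      intro x
      constructor
      · intro h
        obtain ⟨y, hy, rfl⟩ := (LieSubmodule.mem_map _).mp h
        exact ⟨y.2, hy⟩
      · rintro ⟨hx, h⟩
        exact (LieSubmodule.mem_map _).mpr ⟨⟨x, hx⟩, h, rfl⟩
    refine hsplit ⟨(G'.comap φ).map B.incl, le_antisymm ?_ ?_, le_antisymm ?_ ?_⟩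
    · rintro x ⟨hxF, hx⟩
      obtain ⟨hxB, hx⟩ := (key x).mp hx
      have h1 : φ ⟨x, hxB⟩ ∈ G ⊓ G' := ⟨(hG _).mpr hxF, hx⟩
      rw [hG'.inf_eq_bot, LieSubmodule.mem_bot] at h1
      exact (hφ0 _).mp h1
    · intro x hx
      have hxB : x ∈ B := hFB.le (hAF.le hx)
      refine ⟨hAF.le hx, (key x).mpr ⟨hxB, ?_⟩⟩
      rw [(hφ0 _).mpr hx]
      exact zero_mem _
    · refine sup_le hFB.le fun x hx ↦ ((key x).mp hx).1
    · intro x hx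
      have h1 : φ ⟨x, hx⟩ ∈ G ⊔ G' := by rw [hG'.sup_eq_top]; exact LieSubmodule.mem_top _
      obtain ⟨y, hy, z, hz, hyz⟩ := (LieSubmodule.mem_sup _ _ _).mp h1
      obtain ⟨u, hu, rfl⟩ := (LieSubmodule.mem_map _).mp hy
      refine (LieSubmodule.mem_sup _ _ _).mpr ⟨u, hu, x - u, (key _).mpr ⟨sub_mem hx u.2, ?_⟩,
        by simp⟩
      have h2 : (⟨x - u, sub_mem hx u.2⟩ : B) = ⟨x, hx⟩ - u := rfl
      rw [h2, map_sub, ← hyz, add_sub_cancel_left]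
      exact hz

/-! ### Blocks -/

variable (b j V) in
/-- All maximal weights of simple subquotients of `V` lie in `S`. -/
def AllWeightsIn (S : Set (Dual ℂ H)) : Prop :=
  ∀ (N : LieSubmodule ℂ (parabolic b j) V) (μ : Dual ℂ H) (x : V),
    IsMaximalMod b j N.toSubmodule μ x → x ∉ N → μ ∈ S

variable (b j) in
/-- No arrow of the quiver joins a weight in `S` to a weight outside `S`. -/
def IsLinkClosed (S : Set (Dual ℂ H)) : Prop :=
  ∀ lam μ, ExtNeZero b j lam μ → (lam ∈ S ↔ μ ∈ S)

/-- A simple submodule whose weight lies outside of a union of components of the quiver splits off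
if the quotient belongs to this union. -/
theorem exists_complement [FiniteDimensional ℂ V]
    (hV : weightSpan b j V (weightLattice b) = ⊤) {S : Set (Dual ℂ H)} (hS : IsLinkClosed b j S)
    {A F B : LieSubmodule ℂ (parabolic b j) V} (hAF : A ⋖ F) (hFB : F ≤ B) {μ : Dual ℂ H} {v : V}
    (hv : IsMaximalMod b j A.toSubmodule μ v) (hvF : v ∈ F) (hvA : v ∉ A) (hμ : μ ∉ S)
    (hB : ∀ N, F ≤ N → ∀ y ∈ B, y ∉ N → ∀ ν, IsMaximalMod b j N.toSubmodule ν y → ν ∈ S) :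
    ∃ F', F ⊓ F' = A ∧ F ⊔ F' = B := by
  have : WellFoundedLT (LieSubmodule ℂ (parabolic b j) V) :=
    LieSubmodule.wellFoundedLT_of_isArtinian ℂ (parabolic b j) V
  have hlt : ∀ {X Y : LieSubmodule ℂ (parabolic b j) V}, X < Y →
      finrank ℂ X.toSubmodule < finrank ℂ Y.toSubmodule := fun h ↦
    Submodule.finrank_lt_finrank_of_lt (by exact h)
  obtain ⟨n, hn⟩ : ∃ n, finrank ℂ B.toSubmodule ≤ finrank ℂ A.toSubmodule + n :=
    ⟨finrank ℂ B.toSubmodule, Nat.le_add_left _ _⟩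
  induction n generalizing A F B with
  | zero => exact absurd (hlt (hAF.lt.trans_le hFB)) (by lia)
  | succ n ih =>
    rcases hFB.eq_or_lt with rfl | hFB
    · exact ⟨A, by rw [inf_eq_right]; exact hAF.le, by rw [sup_eq_left]; exact hAF.le⟩
    obtain ⟨E, hFE, hEB⟩ := exists_covBy_le_of_lt hFB
    rcases hEB.eq_or_lt with rfl | hEB
    · by_contra hc
      obtain ⟨lam, -, w, hwB, hwF, hw⟩ := exists_maximal_between hV hFE.lt
      have := hS _ _ (extNeZero_of_covBy hV hAF hFE hv hvF hvA hw hwB hwF hc)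
      exact hμ (this.mp (hB F le_rfl w hwB hwF lam hw))
    · obtain ⟨F₁, h1, h2⟩ := ih hAF hFE.le hv hvF hvA
        (fun N hN y hy ↦ hB N hN y (hEB.le hy)) (by have := hlt hEB; lia)
      have hcov : F₁ ⋖ E := by
        rw [← h2]
        exact covBy_sup_of_inf_covBy_left (h1 ▸ hAF)
      have hAF₁ : A ≤ F₁ := h1 ▸ inf_le_right
      have hne : A ≠ F₁ := by
        rintro rfl
        rw [sup_eq_left.mpr hAF.le] at h2
        exact hFE.ne h2
      have hvF₁ : v ∉ F₁ := fun h ↦ hvA (h1 ▸ ⟨hvF, h⟩)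
      obtain ⟨E₂, h3, h4⟩ := ih hcov hEB.le (hv.mono hAF₁) (hFE.le hvF) hvF₁
        (fun N hN ↦ hB N (hFE.le.trans hN)) (by have := hlt (hAF₁.lt_of_ne hne); lia)
      refine ⟨E₂, ?_, ?_⟩
      · rw [← h1, ← h3, ← inf_assoc, inf_eq_left.mpr hFE.le]
      · rw [← h4, ← h2, sup_assoc, sup_eq_right.mpr (h3 ▸ inf_le_right : F₁ ≤ E₂)]

theorem lift_mem {N F : LieSubmodule ℂ (parabolic b j) V} {A : Set (Dual ℂ H)}
    (hV : weightSpan b j V A = ⊤) {x : V} {μ : Dual ℂ H} (hx : IsWeightVector b j μ x)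
    (hxN : x ∈ N ⊔ F) : ∃ y ∈ F, IsWeightVector b j μ y ∧ x - y ∈ N := by
  obtain ⟨n, hn, f, hf, rfl⟩ := (LieSubmodule.mem_sup _ _ _).mp hxN
  let φ : F →ₗ⁅ℂ, parabolic b j⁆ V ⧸ N := (LieSubmodule.Quotient.mk' N).comp F.incl
  have h1 : φ ⟨f, hf⟩ = LieSubmodule.Quotient.mk' N (n + f) := by
    rw [map_add, (LieSubmodule.Quotient.mk_eq_zero N).mpr hn, zero_add]
    rfl
  obtain ⟨y, hy, hyf, -⟩ := exists_weightVector_lift φ (v := ⟨f, hf⟩)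
    ((weightSpan_sub_eq_top hV F).symm ▸ Submodule.mem_top) (h1 ▸ hx.map _)
  refine ⟨y, y.2, isWeightVector_coe.mpr hy, ?_⟩
  rw [← LieSubmodule.Quotient.mk_eq_zero, map_sub, ← h1, ← hyf]
  exact sub_self _

/-- A finite-dimensional module generated by a maximal vector lies in a single block. -/
theorem allWeightsIn_of_lieSpan_eq_top [FiniteDimensional ℂ V]
    (hV : weightSpan b j V (weightLattice b) = ⊤) {S : Set (Dual ℂ H)} (hS : IsLinkClosed b j S)
    {v : V} {lam : Dual ℂ H} (hv : IsMaximalMod b j (⊥ : Submodule ℂ V) lam v) (hlam : lam ∈ S)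
    (hgen : LieSubmodule.lieSpan ℂ (parabolic b j) {v} = ⊤) : AllWeightsIn b j V S := by
  have : WellFoundedLT (LieSubmodule ℂ (parabolic b j) V) :=
    LieSubmodule.wellFoundedLT_of_isArtinian ℂ (parabolic b j) V
  have : WellFoundedGT (LieSubmodule ℂ (parabolic b j) V) :=
    LieSubmodule.wellFoundedGT_of_noetherian ℂ (parabolic b j) V
  have htop : ∀ {N : LieSubmodule ℂ (parabolic b j) V}, v ∈ N → N = ⊤ := by
    intro N h
    rw [eq_top_iff, ← hgen, LieSubmodule.lieSpan_le, Set.singleton_subset_iff]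
    exact h
  suffices h : ∀ A : LieSubmodule ℂ (parabolic b j) V, ∀ N, A ≤ N → ∀ (μ : Dual ℂ H) (x : V),
      IsMaximalMod b j N.toSubmodule μ x → x ∉ N → μ ∈ S from fun N ↦ h N N le_rfl
  intro A
  induction A using WellFoundedGT.induction with
  | ind A ih =>
    intro N hAN μ x hx hxN
    have hA : A < ⊤ := by
      rw [lt_top_iff_ne_top]
      rintro rfl
      exact hxN (hAN (LieSubmodule.mem_top x))
    obtain ⟨F, hAF, -⟩ := exists_covBy_le_of_lt hA
    obtain ⟨μ₀, -, x₀, hx₀F, hx₀A, hx₀⟩ := exists_maximal_between hV hAF.lt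
    have hμ₀ : μ₀ ∈ S := by
      by_contra hc
      obtain ⟨F', h1, h2⟩ := exists_complement hV hS hAF le_top hx₀ hx₀F hx₀A hc
        fun N hN y _ hy ν hν ↦ ih F hAF.lt N hN ν y hν hy
      obtain ⟨y, hy, hyl, hvy⟩ := lift_mem (N := F) (F := F') hV hv.1
        (h2 ▸ LieSubmodule.mem_top v)
      obtain ⟨c, rfl⟩ := exists_smul_eq_of_mem_lieSpan hv (hgen ▸ LieSubmodule.mem_top y) hyl
      rcases eq_or_ne c 0 with rfl | hc0
      · rw [zero_smul, sub_zero] at hvy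
        have hvA : v ∉ A := fun h ↦ hA.ne (htop h)
        exact hc ((hx₀.eq_of_covBy hAF (hv.mono bot_le) hx₀F hvy hx₀A hvA) ▸ hlam)
      · have hvF' : v ∈ F' := by
          have := SMulMemClass.smul_mem c⁻¹ hy
          rwa [smul_smul, inv_mul_cancel₀ hc0, one_smul] at this
        rw [htop hvF', inf_top_eq] at h1
        exact hAF.ne h1.symm
    by_cases hFN : F ≤ N
    · exact ih F hAF.lt N hFN μ x hx hxN
    have hNF : N ⊓ F = A := by
      rcases hAF.eq_or_eq (le_inf hAN hAF.le) inf_le_right with h | h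
      · exact h
      · exact absurd (inf_eq_right.mp h) hFN
    by_cases hxNF : x ∈ N ⊔ F
    · obtain ⟨y, hyF, hy, hxy⟩ := lift_mem hV hx.1 hxNF
      have hyN : y ∉ N := fun h ↦ hxN (by simpa using add_mem hxy h)
      have hyA : IsMaximalMod b j A.toSubmodule μ y := by
        refine ⟨hy, fun α hα e he ↦ ?_⟩
        have h3 : ⁅e, y⁆ ∈ N ⊓ F := by
          refine ⟨?_, LieSubmodule.lie_mem _ hyF⟩
          have h4 : ⁅e, y⁆ = ⁅e, x⁆ - ⁅e, x - y⁆ := by rw [lie_sub]; abel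
          rw [h4]
          exact sub_mem (hx.2 α hα e he) (LieSubmodule.lie_mem _ hxy)
        rw [hNF] at h3
        exact h3
      have := hyA.eq_of_covBy hAF hx₀ hyF hx₀F (fun h ↦ hyN (hAN h)) hx₀A
      exact this ▸ hμ₀
    · exact ih F hAF.lt (N ⊔ F) le_sup_right μ x (hx.mono (by exact le_sup_left)) hxNF

theorem AllWeightsIn.of_surjective {S A : Set (Dual ℂ H)} (hV : weightSpan b j V A = ⊤)
    (h : AllWeightsIn b j V S) (f : V →ₗ⁅ℂ, parabolic b j⁆ V') (hf : Function.Surjective f) :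
    AllWeightsIn b j V' S := by
  intro N μ x hx hxN
  obtain ⟨y, rfl⟩ := hf x
  obtain ⟨y', hy', hyy', -⟩ := exists_weightVector_lift f (hV.symm ▸ Submodule.mem_top) hx.1
  rw [← hyy'] at hx hxN
  refine h (N.comap f) μ y' ⟨hy', fun α hα e he ↦ ?_⟩ hxN
  have := hx.2 α hα e he
  rw [← LieModuleHom.map_lie] at this
  exact this

theorem AllWeightsIn.of_exact {S A : Set (Dual ℂ H)} (hV' : weightSpan b j V' A = ⊤)
    (f : V →ₗ⁅ℂ, parabolic b j⁆ V') (g : V' →ₗ⁅ℂ, parabolic b j⁆ V'')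
    (hfg : ∀ x, g x = 0 → ∃ y, f y = x) (h : AllWeightsIn b j V S)
    (h'' : AllWeightsIn b j V'' S) (hV : weightSpan b j V A = ⊤) : AllWeightsIn b j V' S := by
  intro N μ x hx hxN
  by_cases hg : g x ∈ N.map g
  · obtain ⟨n, hn, hnx⟩ := (LieSubmodule.mem_map _).mp hg
    obtain ⟨z, hz⟩ := hfg (x - n) (by rw [map_sub, hnx, sub_self])
    obtain ⟨y, hy, hyμ, hxy⟩ := lift_mem (N := N) (F := f.range) hV' hx.1
      ((LieSubmodule.mem_sup _ _ _).mpr ⟨n, hn, x - n, (LieModuleHom.mem_range f _).mpr ⟨z, hz⟩,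
        by simp⟩)
    obtain ⟨u, rfl⟩ := (LieModuleHom.mem_range f _).mp hy
    obtain ⟨w, hw, hwu, -⟩ := exists_weightVector_lift f (hV.symm ▸ Submodule.mem_top) hyμ
    rw [← hwu] at hxy
    refine h (N.comap f) μ w ⟨hw, fun α hα e he ↦ ?_⟩ fun hwN ↦ ?_
    · change f ⁅e, w⁆ ∈ N
      have h4 : f ⁅e, w⁆ = ⁅e, x⁆ - ⁅e, x - f w⁆ := by rw [lie_sub, LieModuleHom.map_lie]; abel
      rw [h4]
      exact sub_mem (hx.2 α hα e he) (LieSubmodule.lie_mem _ hxy)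
    · exact hxN (by simpa using add_mem hxy (LieSubmodule.mem_comap.mp hwN))
  · refine h'' (N.map g) μ (g x) ⟨hx.1.map g, fun α hα e he ↦ ?_⟩ hg
    rw [← LieModuleHom.map_lie]
    exact (LieSubmodule.mem_map _).mpr ⟨_, hx.2 α hα e he, rfl⟩

end Blocks

/-! ### The weight lattice -/

theorem fundamentalWeight_coroot (i k : b.support) [Decidable (k = i)] :
    fundamentalWeight b i ((rootSystem H).coroot k) = if k = i then 1 else 0 := by
  rw [← b.toCoweightBasis_apply, fundamentalWeight, Basis.coord_apply, Basis.repr_self,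
    Finsupp.single_apply]

theorem eq_sum_fundamentalWeight (χ : Dual ℂ H) :
    χ = ∑ i : b.support, χ ((rootSystem H).coroot i) • fundamentalWeight b i := by
  have := b.toCoweightBasis.sum_dual_apply_smul_coord χ
  simp only [RootPairing.Base.toCoweightBasis_apply] at this
  exact this.symm

theorem mem_weightLattice_iff {χ : Dual ℂ H} :
    χ ∈ weightLattice b ↔ ∀ i : b.support, ∃ n : ℤ, χ ((rootSystem H).coroot i) = n := by
  classical
  constructor
  · intro h i
    induction h using AddSubgroup.closure_induction with
    | mem x hx =>
      obtain ⟨k, rfl⟩ := hx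
      exact ⟨if i = k then 1 else 0, by rw [fundamentalWeight_coroot]; split_ifs <;> simp⟩
    | zero => exact ⟨0, by simp⟩
    | add x y _ _ hx hy =>
      obtain ⟨m, hm⟩ := hx
      obtain ⟨n, hn⟩ := hy
      exact ⟨m + n, by rw [LinearMap.add_apply, hm, hn, Int.cast_add]⟩
    | neg x _ hx =>
      obtain ⟨m, hm⟩ := hx
      exact ⟨-m, by rw [LinearMap.neg_apply, hm, Int.cast_neg]⟩
  · intro h
    choose n hn using h
    rw [eq_sum_fundamentalWeight (b := b) χ]
    refine sum_mem fun i _ ↦ ?_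
    rw [hn, Int.cast_smul_eq_zsmul]
    have h1 : fundamentalWeight b i ∈ weightLattice b := AddSubgroup.subset_closure ⟨i, rfl⟩
    exact zsmul_mem h1 _

theorem root_mem_weightLattice (α : H.root) : (rootSystem H).root α ∈ weightLattice b := by
  rw [mem_weightLattice_iff]
  intro i
  refine ⟨(rootSystem H).pairingIn ℤ α i, ?_⟩
  have := (rootSystem H).algebraMap_pairingIn ℤ α i
  exact this.symm

theorem root_mem_rootLattice (α : H.root) : (rootSystem H).root α ∈ rootLattice b := by
  have h : ∀ x ∈ posCone b, x ∈ rootLattice b := fun x hx ↦ by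
    have : posCone b ≤ (rootLattice b).toAddSubmonoid :=
      (AddSubmonoid.closure_le).mpr AddSubgroup.subset_closure
    exact this hx
  rcases root_mem_posCone_or (b := b) α with h' | h'
  · exact h _ h'
  · rw [← neg_neg ((rootSystem H).root α)]
    exact neg_mem (h _ h')

theorem rootLattice_le_weightLattice : rootLattice b ≤ weightLattice b := by
  rw [rootLattice, AddSubgroup.closure_le]
  rintro _ ⟨i, rfl⟩
  exact root_mem_weightLattice _

theorem posCone_le_rootLattice {β : Dual ℂ H} (h : β ∈ posCone b) : β ∈ rootLattice b := by
  have : posCone b ≤ (rootLattice b).toAddSubmonoid :=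
    (AddSubmonoid.closure_le).mpr AddSubgroup.subset_closure
  exact this h

/-! ### The ideal spanned by the nilradical and the grading element -/

variable (b j) in
/-- The fundamental coweight `ϖ_j ∈ H`, on which `α_i` takes the value `δ_{ij}`. -/
noncomputable def coweight : H := (evalEquiv ℂ H).symm (coeffForm b j)

theorem apply_coweight (χ : Dual ℂ H) : χ (coweight b j) = coeffForm b j χ :=
  apply_evalEquiv_symm_apply ℂ H χ (coeffForm b j)

variable (b j) in
/-- The ideal `ℂ ϖ_j ⊕ 𝔫` of `𝔭`. -/
noncomputable def gradedIdeal : LieSubmodule ℂ (parabolic b j) (parabolic b j) where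
  __ := Submodule.span ℂ {y : parabolic b j | y = cartanIncl b j (coweight b j) ∨
    ∃ γ : H.root, coeff b j γ < 0 ∧ IsRootVector b j γ y}
  lie_mem := by
    intro x m hm
    change m ∈ Submodule.span ℂ _ at hm
    change ⁅x, m⁆ ∈ Submodule.span ℂ _
    induction hm using Submodule.span_induction with
    | zero => rw [lie_zero]; exact zero_mem _
    | add y z _ _ hy hz => rw [lie_add]; exact add_mem hy hz
    | smul c y _ hy => rw [lie_smul]; exact Submodule.smul_mem _ c hy
    | mem y hy =>
      refine parabolic_induction (p := fun x ↦ ⁅x, y⁆ ∈ Submodule.span ℂ _) ?_ ?_ ?_ x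
      · intro h
        rcases hy with rfl | ⟨γ, hγ, hy⟩
        · rw [lie_cartanIncl]
          exact zero_mem _
        · rw [hy.lie_cartan]
          exact Submodule.smul_mem _ _ (Submodule.subset_span (Or.inr ⟨γ, hγ, hy⟩))
      · intro α hα x hx
        rcases hy with rfl | ⟨γ, hγ, hy⟩
        · rw [← lie_skew, hx.lie_cartan, apply_coweight, coeffForm_eq_coeff]
          rcases hα.eq_or_lt with h | h
          · rw [h, Int.cast_zero, zero_smul, neg_zero]
            exact zero_mem _
          · exact neg_mem (Submodule.smul_mem _ _ (Submodule.subset_span (Or.inr ⟨α, h, hx⟩)))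
        · rcases hx.lie hy with h | ⟨δ, hδ, h⟩ | h
          · exfalso
            have := congrArg (coeffForm b j) h
            rw [map_add, coeffForm_eq_coeff, coeffForm_eq_coeff, map_zero] at this
            have : coeff b j α + coeff b j γ = 0 := by exact_mod_cast this
            lia
          · exact Submodule.subset_span (Or.inr ⟨δ, by rw [coeff_add b j hδ]; lia, h⟩)
          · rw [h]
            exact zero_mem _
      · intro x z hx hz
        rw [add_lie]
        exact add_mem hx hz

theorem coweight_mem_gradedIdeal : cartanIncl b j (coweight b j) ∈ gradedIdeal b j :=
  Submodule.subset_span (Or.inl rfl)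

theorem mem_gradedIdeal {γ : H.root} (hγ : coeff b j γ < 0) {y : parabolic b j}
    (hy : IsRootVector b j γ y) : y ∈ gradedIdeal b j :=
  Submodule.subset_span (Or.inr ⟨γ, hγ, hy⟩)

theorem IsRootVector.isWeightVector {γ : H.root} {y : parabolic b j}
    (hy : IsRootVector b j γ y) : IsWeightVector b j ((rootSystem H).root γ) y :=
  isWeightVector_iff.mpr hy.lie_cartan

theorem isWeightVector_coweight :
    IsWeightVector b j (0 : Dual ℂ H) (cartanIncl b j (coweight b j)) :=
  isWeightVector_iff.mpr fun h ↦ by rw [lie_cartanIncl, LinearMap.zero_apply, zero_smul]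

/-- The root space of a root with positive coefficient meets `𝔭` trivially. -/
theorem IsRootVector.coeff_nonpos {α : H.root} {x : parabolic b j} (hx : IsRootVector b j α x)
    (h0 : x ≠ 0) : coeff b j α ≤ 0 := by
  have key : ∀ y : parabolic b j, y ∈ weightSpan b j (parabolic b j)
      ({0} ∪ {χ | ∃ β : H.root, coeff b j β ≤ 0 ∧ χ = (rootSystem H).root β}) := by
    refine parabolic_induction ?_ ?_ ?_
    · intro h
      refine IsWeightVector.mem_weightSpan (χ := 0) (isWeightVector_iff.mpr fun h' ↦ ?_)
        (Or.inl rfl)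
      rw [lie_cartanIncl, LinearMap.zero_apply, zero_smul]
    · exact fun β hβ y hy ↦ hy.isWeightVector.mem_weightSpan (Or.inr ⟨β, hβ, rfl⟩)
    · exact fun y z hy hz ↦ add_mem hy hz
  by_contra hc
  refine h0 (eq_zero_of_mem_weightSpan (key x) hx.isWeightVector ?_)
  rintro (h | ⟨β, hβ, h⟩)
  · exact root_ne_zero α h
  · rw [(rootSystem H).root.injective h] at hc
    exact hc hβ

/-- The grading element is a maximal vector. -/
theorem isMaximalMod_coweight : IsMaximalMod b j (⊥ : Submodule ℂ (gradedIdeal b j)) 0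
    ⟨cartanIncl b j (coweight b j), coweight_mem_gradedIdeal⟩ := by
  refine ⟨isWeightVector_coe.mp isWeightVector_coweight, fun α hα x hx ↦ ?_⟩
  rw [Submodule.mem_bot]
  ext1
  change ⁅x, cartanIncl b j (coweight b j)⁆ = 0
  rw [← lie_skew, hx.lie_cartan, apply_coweight, coeffForm_eq_coeff]
  by_cases h2 : x = 0
  · rw [h2, smul_zero, neg_zero]
  · rw [le_antisymm (hx.coeff_nonpos h2) (coeff_nonneg hα), Int.cast_zero, zero_smul, neg_zero]

variable (b j) in
theorem weightSpan_gradedIdeal : weightSpan b j (gradedIdeal b j) (rootLattice b) = ⊤ := by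
  rw [eq_top_iff]
  rintro ⟨y, hy⟩ -
  have hy' : y ∈ Submodule.span ℂ {y : parabolic b j | y = cartanIncl b j (coweight b j) ∨
    ∃ γ : H.root, coeff b j γ < 0 ∧ IsRootVector b j γ y} := hy
  suffices h : ∀ y (_ : y ∈ Submodule.span ℂ {y : parabolic b j |
      y = cartanIncl b j (coweight b j) ∨ ∃ γ : H.root, coeff b j γ < 0 ∧ IsRootVector b j γ y})
      (hy : y ∈ gradedIdeal b j), (⟨y, hy⟩ : gradedIdeal b j) ∈
        weightSpan b j (gradedIdeal b j) (rootLattice b) from h y hy' hy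
  clear hy' hy y
  intro y hy'
  induction hy' using Submodule.span_induction with
  | zero => intro _; exact zero_mem _
  | add y z hy hz hy' hz' => intro h; exact add_mem (hy' hy) (hz' hz)
  | smul c y hy hy' => intro h; exact Submodule.smul_mem _ c (hy' hy)
  | mem y hy =>
    intro h
    rcases hy with rfl | ⟨γ, hγ, hy⟩
    · exact IsWeightVector.mem_weightSpan (isWeightVector_coe.mp isWeightVector_coweight)
        (zero_mem _)
    · exact IsWeightVector.mem_weightSpan
        ((isWeightVector_coe (N := gradedIdeal b j) (v := ⟨y, h⟩)).mp hy.isWeightVector)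
        (root_mem_rootLattice γ)

/-! ### Irreducible modules -/

section Irreducible

variable {V : Type*} [AddCommGroup V] [Module ℂ V] [LieRingModule (parabolic b j) V]
  [LieModule ℂ (parabolic b j) V]

theorem lieSpan_eq_top [LieModule.IsIrreducible ℂ (parabolic b j) V] {v : V} (h0 : v ≠ 0) :
    LieSubmodule.lieSpan ℂ (parabolic b j) {v} = ⊤ := by
  refine (IsSimpleOrder.eq_bot_or_eq_top _).resolve_left fun h ↦ h0 ?_
  rw [← LieSubmodule.mem_bot (R := ℂ) (L := parabolic b j), ← h]
  exact LieSubmodule.subset_lieSpan (Set.mem_singleton v)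

theorem IsIrreducibleOfMaximalWeight.weightSpan_eq_top {lam : Dual ℂ H}
    (hV : IsIrreducibleOfMaximalWeight b j V lam) :
    weightSpan b j V {χ | lam - χ ∈ posCone b} = ⊤ := by
  obtain ⟨v, h0, hv⟩ := hV.exists_maximal_vector
  have := hV.irreducible
  rw [eq_top_iff, ← LieSubmodule.top_toSubmodule (R := ℂ) (L := parabolic b j),
    ← lieSpan_eq_top (b := b) (j := j) h0]
  exact lieSpan_le_weightSpan hv

/-- All weights of an irreducible module have the same coefficient at `α_j`. -/
theorem IsIrreducibleOfMaximalWeight.coeffForm_eq {lam : Dual ℂ H}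
    (hV : IsIrreducibleOfMaximalWeight b j V lam) {χ : Dual ℂ H} {w : V}
    (hw : IsWeightVector b j χ w) (h0 : w ≠ 0) :
    lam - χ ∈ posCone b ∧ coeffForm b j (lam - χ) = 0 := by
  obtain ⟨v, hv0, hv⟩ := hV.exists_maximal_vector
  have hirr := hV.irreducible
  have hpos : lam - χ ∈ posCone b :=
    sub_mem_posCone_of_mem_lieSpan hv
      (lieSpan_eq_top (b := b) (j := j) hv0 ▸ LieSubmodule.mem_top w) hw h0
  refine ⟨hpos, ?_⟩
  obtain ⟨n, hn⟩ := exists_coeffForm_eq_nat hpos j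
  rcases n with - | n
  · rw [hn, Nat.cast_zero]
  exfalso
  let U : LieSubmodule ℂ (parabolic b j) V :=
    weightSubmodule {χ | ∃ n : ℕ, coeffForm b j (lam - χ) = (n + 1 : ℕ)} (by
      rintro ψ ⟨m, hm⟩ α hα
      obtain ⟨k, hk⟩ := Int.eq_ofNat_of_zero_le (neg_nonneg.mpr hα)
      refine ⟨m + k, ?_⟩
      have hk' : (coeff b j α : ℂ) = -(k : ℂ) := by
        rw [show coeff b j α = -(k : ℤ) by lia]
        push_cast
        ring
      rw [← sub_sub, map_sub, hm, coeffForm_eq_coeff, hk']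
      push_cast
      ring)
  have hU : U = ⊤ := by
    refine (IsSimpleOrder.eq_bot_or_eq_top U).resolve_left fun h ↦ h0 ?_
    rw [← LieSubmodule.mem_bot (R := ℂ) (L := parabolic b j), ← h]
    exact hw.mem_weightSpan ⟨n, hn⟩
  have hvU : v ∈ weightSpan b j V {χ | ∃ n : ℕ, coeffForm b j (lam - χ) = (n + 1 : ℕ)} := by
    have : v ∈ U := hU ▸ LieSubmodule.mem_top v
    exact this
  refine hv0 (eq_zero_of_mem_weightSpan hvU hv.1 ?_)
  rintro ⟨m, hm⟩
  rw [sub_self, map_zero] at hm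
  have : 0 = m + 1 := by exact_mod_cast hm
  lia

/-- The nilradical acts by zero on irreducible modules. -/
theorem IsIrreducibleOfMaximalWeight.lie_eq_zero {lam : Dual ℂ H}
    (hV : IsIrreducibleOfMaximalWeight b j V lam) {γ : H.root} (hγ : coeff b j γ < 0)
    {x : parabolic b j} (hx : IsRootVector b j γ x) (w : V) : ⁅x, w⁆ = 0 := by
  have hw : w ∈ weightSpan b j V {χ | lam - χ ∈ posCone b} :=
    hV.weightSpan_eq_top ▸ Submodule.mem_top
  induction hw using Submodule.span_induction with
  | zero => rw [lie_zero]
  | add y z _ _ hy hz => rw [lie_add, hy, hz, add_zero]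
  | smul c y _ hy => rw [lie_smul, hy, smul_zero]
  | mem w hw =>
    obtain ⟨χ, -, hw⟩ := hw
    by_contra h
    have h1 := (hV.coeffForm_eq hw fun h0 ↦ h (by rw [h0, lie_zero])).2
    have h2 := (hV.coeffForm_eq (hw.lie_root hx) h).2
    rw [← sub_sub, map_sub, h1, coeffForm_eq_coeff, zero_sub, neg_eq_zero] at h2
    exact hγ.ne (by exact_mod_cast h2)

/-- For an irreducible module `V` of maximal weight `lam`, the module `(ℂ ϖ_j ⊕ 𝔫) ⊗ V` lies in
the block of `lam`: it is generated by `ϖ_j ⊗ v`, as `y (ϖ_j ⊗ w)` is a nonzero multiple of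
`y ⊗ w` for root vectors `y` in `𝔫`. -/
theorem IsIrreducibleOfMaximalWeight.allWeightsIn_tensor [FiniteDimensional ℂ V]
    {lam : Dual ℂ H} (hV : IsIrreducibleOfMaximalWeight b j V lam)
    (hV' : weightSpan b j V (weightLattice b) = ⊤) {S : Set (Dual ℂ H)}
    (hS : IsLinkClosed b j S) (hlam : lam ∈ S) :
    AllWeightsIn b j (TensorProduct ℂ (gradedIdeal b j) V) S := by
  obtain ⟨v, hv0, hv⟩ := hV.exists_maximal_vector
  have hirr := hV.irreducible
  let z : gradedIdeal b j := ⟨cartanIncl b j (coweight b j), coweight_mem_gradedIdeal⟩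
  have hz : IsMaximalMod b j (⊥ : Submodule ℂ (gradedIdeal b j)) 0 z := isMaximalMod_coweight
  have hmax : IsMaximalMod b j (⊥ : Submodule ℂ (TensorProduct ℂ (gradedIdeal b j) V)) lam
      (z ⊗ₜ[ℂ] v) := by
    refine ⟨by simpa using hz.1.tmul hv.1, fun α hα x hx ↦ ?_⟩
    rw [Submodule.mem_bot, TensorProduct.LieModule.lie_tmul_right, hv.2 α hα x hx,
      (Submodule.mem_bot ℂ).mp (hz.2 α hα x hx), TensorProduct.zero_tmul, TensorProduct.tmul_zero,
      add_zero]
  refine allWeightsIn_of_lieSpan_eq_top (weightSpan_tensor_eq_top (top_le_iff.mp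
    ((weightSpan_gradedIdeal b j).ge.trans (weightSpan_mono rootLattice_le_weightLattice))) hV')
    hS hmax hlam ?_
  set N := LieSubmodule.lieSpan ℂ (parabolic b j) {z ⊗ₜ[ℂ] v} with hN
  have hvN : z ⊗ₜ[ℂ] v ∈ N := LieSubmodule.subset_lieSpan (Set.mem_singleton _)
  have hzlie : ∀ (α : H.root) (x : parabolic b j) (hx : IsRootVector b j α x),
      ((⁅x, z⁆ : gradedIdeal b j) : parabolic b j) = -((coeff b j α : ℂ) • x) := by
    intro α x hx
    change ⁅x, cartanIncl b j (coweight b j)⁆ = _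
    rw [← lie_skew, hx.lie_cartan, apply_coweight, coeffForm_eq_coeff]
  -- the vectors `w` with `ϖ_j ⊗ w ∈ N` form a submodule
  have h1 : ∀ w : V, z ⊗ₜ[ℂ] w ∈ N := by
    let U : LieSubmodule ℂ (parabolic b j) V :=
      { N.toSubmodule.comap (TensorProduct.mk ℂ (gradedIdeal b j) V z) with
        lie_mem := by
          intro x w hw
          have hw' : z ⊗ₜ[ℂ] w ∈ N := hw
          change z ⊗ₜ[ℂ] ⁅x, w⁆ ∈ N
          refine parabolic_induction (p := fun x ↦ z ⊗ₜ[ℂ] ⁅x, w⁆ ∈ N) ?_ ?_ ?_ x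
          · intro h
            have := LieSubmodule.lie_mem (x := cartanIncl b j h) N hw'
            rw [TensorProduct.LieModule.lie_tmul_right, hz.1.lie_cartan, LinearMap.zero_apply,
              zero_smul, TensorProduct.zero_tmul, zero_add] at this
            exact this
          · intro α hα x hx
            rcases hα.eq_or_lt with h | h
            · have := LieSubmodule.lie_mem (x := x) N hw'
              have h0 : ⁅x, z⁆ = 0 := by
                ext1
                rw [hzlie α x hx, h, Int.cast_zero, zero_smul, neg_zero]
                rfl
              rw [TensorProduct.LieModule.lie_tmul_right, h0, TensorProduct.zero_tmul,
                zero_add] at this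
              exact this
            · rw [hV.lie_eq_zero h hx, TensorProduct.tmul_zero]
              exact zero_mem _
          · intro x y hx hy
            rw [add_lie, TensorProduct.tmul_add]
            exact add_mem hx hy }
    have hU : U = ⊤ := by
      rw [eq_top_iff, ← lieSpan_eq_top hv0, LieSubmodule.lieSpan_le, Set.singleton_subset_iff]
      exact hvN
    intro w
    have : w ∈ U := hU ▸ LieSubmodule.mem_top w
    exact this
  have h2 : ∀ y ∈ Submodule.span ℂ {y : parabolic b j | y = cartanIncl b j (coweight b j) ∨
      ∃ γ : H.root, coeff b j γ < 0 ∧ IsRootVector b j γ y}, ∀ (hy : y ∈ gradedIdeal b j) (w : V),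
      (⟨y, hy⟩ : gradedIdeal b j) ⊗ₜ[ℂ] w ∈ N := by
    intro y hy'
    induction hy' using Submodule.span_induction with
    | zero =>
      intro hy w
      have : (⟨0, hy⟩ : gradedIdeal b j) = 0 := rfl
      rw [this, TensorProduct.zero_tmul]
      exact zero_mem _
    | add y z hy hz hy' hz' =>
      intro h w
      have : (⟨y + z, h⟩ : gradedIdeal b j) = ⟨y, hy⟩ + ⟨z, hz⟩ := rfl
      rw [this, TensorProduct.add_tmul]
      exact add_mem (hy' hy w) (hz' hz w)
    | smul c y hy hy' =>
      intro h w
      have : (⟨c • y, h⟩ : gradedIdeal b j) = c • ⟨y, hy⟩ := rfl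
      rw [this, ← TensorProduct.smul_tmul']
      exact SMulMemClass.smul_mem c (hy' hy w)
    | mem y hgen =>
      intro hy w
      rcases hgen with rfl | ⟨γ, hγ, hgen⟩
      · exact h1 w
      · have h3 : ⁅y, z ⊗ₜ[ℂ] w⁆ ∈ N := LieSubmodule.lie_mem (x := y) N (h1 w)
        have h0 : ⁅y, z⁆ = (-(coeff b j γ : ℂ)) • (⟨y, hy⟩ : gradedIdeal b j) := by
          ext1
          rw [hzlie γ y hgen, neg_smul]
          rfl
        rw [TensorProduct.LieModule.lie_tmul_right, hV.lie_eq_zero hγ hgen,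
          TensorProduct.tmul_zero, add_zero, h0, ← TensorProduct.smul_tmul'] at h3
        have hc : -(coeff b j γ : ℂ) ≠ 0 := neg_ne_zero.mpr (Int.cast_ne_zero.mpr hγ.ne)
        have h4 := SMulMemClass.smul_mem (-(coeff b j γ : ℂ))⁻¹ h3
        rwa [smul_smul, inv_mul_cancel₀ hc, one_smul] at h4
  rw [eq_top_iff]
  intro t _
  induction t using TensorProduct.induction_on with
  | zero => exact zero_mem _
  | add x y hx hy => exact add_mem (hx trivial) (hy trivial)
  | tmul y w => exact h2 y.1 y.2 y.2 w

end Irreducible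

universe v

/-- Tensoring with `ℂ ϖ_j ⊕ 𝔫` preserves the blocks. -/
theorem AllWeightsIn.tensor {S : Set (Dual ℂ H)} (hS : IsLinkClosed b j S) (V : Type v)
    [AddCommGroup V] [Module ℂ V] [LieRingModule (parabolic b j) V]
    [LieModule ℂ (parabolic b j) V] [FiniteDimensional ℂ V]
    (hV : weightSpan b j V (weightLattice b) = ⊤) (h : AllWeightsIn b j V S) :
    AllWeightsIn b j (TensorProduct ℂ (gradedIdeal b j) V) S := by
  obtain ⟨n, hn⟩ : ∃ n, finrank ℂ V ≤ n := ⟨_, le_rfl⟩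
  induction n generalizing V with
  | zero =>
    have : Subsingleton V := finrank_zero_iff.mp (Nat.le_zero.mp hn)
    intro N μ x hx hxN
    refine absurd ?_ hxN
    rw [Subsingleton.elim x 0]
    exact zero_mem _
  | succ n ih =>
    rcases subsingleton_or_nontrivial V with hsub | hnt
    · exact ih V hV h (by rw [finrank_zero_of_subsingleton]; exact Nat.zero_le _)
    have : WellFoundedLT (LieSubmodule ℂ (parabolic b j) V) :=
      LieSubmodule.wellFoundedLT_of_isArtinian ℂ (parabolic b j) V
    obtain ⟨F, hF, -⟩ := exists_covBy_le_of_lt (bot_lt_top (α := LieSubmodule ℂ (parabolic b j) V))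
    obtain ⟨μ, -, v, hvF, hv0, hv⟩ := exists_maximal_between hV hF.lt
    have hFirr : IsIrreducibleOfMaximalWeight b j F μ :=
      isIrreducibleOfMaximalWeight_of_covBy hF (LieModuleHom.id : F →ₗ⁅ℂ, parabolic b j⁆ F)
        Function.surjective_id (fun x ↦ by
          rw [LieSubmodule.mem_bot]
          exact Subtype.ext_iff) hvF hv0 hv
    have hnz : weightSpan b j (gradedIdeal b j) (weightLattice b) = ⊤ := top_le_iff.mp
      ((weightSpan_gradedIdeal b j).ge.trans (weightSpan_mono rootLattice_le_weightLattice))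
    have h1 : AllWeightsIn b j (TensorProduct ℂ (gradedIdeal b j) F) S :=
      hFirr.allWeightsIn_tensor (weightSpan_sub_eq_top hV F) hS (h ⊥ μ v hv hv0)
    have hFpos : 0 < finrank ℂ F := by
      have : Nontrivial F := ⟨⟨v, hvF⟩, 0, fun h ↦ hv0 (by
        rw [LieSubmodule.mem_bot]; exact congrArg Subtype.val h)⟩
      exact finrank_pos
    have hq : finrank ℂ (V ⧸ F) + finrank ℂ F = finrank ℂ V :=
      F.toSubmodule.finrank_quotient_add_finrank
    have hVF : weightSpan b j (V ⧸ F) (weightLattice b) = ⊤ :=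
      weightSpan_eq_top_of_surjective hV _ (LieSubmodule.Quotient.surjective_mk' F)
    have : FiniteDimensional ℂ (V ⧸ F) := inferInstanceAs (FiniteDimensional ℂ (V ⧸ F.toSubmodule))
    have h2 : AllWeightsIn b j (TensorProduct ℂ (gradedIdeal b j) (V ⧸ F)) S :=
      ih (V ⧸ F) hVF (h.of_surjective hV _ (LieSubmodule.Quotient.surjective_mk' F)) (by lia)
    refine AllWeightsIn.of_exact (weightSpan_tensor_eq_top hnz hV)
      (TensorProduct.LieModule.map LieModuleHom.id F.incl)
      (TensorProduct.LieModule.map LieModuleHom.id (LieSubmodule.Quotient.mk' F)) ?_ h1 h2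
      (weightSpan_tensor_eq_top hnz (weightSpan_sub_eq_top hV F))
    have hex : Function.Exact (LinearMap.lTensor (gradedIdeal b j) F.toSubmodule.subtype)
        (LinearMap.lTensor (gradedIdeal b j) F.toSubmodule.mkQ) :=
      lTensor_exact _ (LinearMap.exact_subtype_mkQ _) (Submodule.mkQ_surjective _)
    intro x hx
    obtain ⟨y, hy⟩ := (hex x).mp hx
    exact ⟨y, hy⟩

/-! ### Exterior powers of the graded ideal -/

section Wedge

variable {V : Type*} [AddCommGroup V] [Module ℂ V] [LieRingModule (parabolic b j) V]
  [LieModule ℂ (parabolic b j) V] [FiniteDimensional ℂ V]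

/-- The image of `⋀^k (ℂ ϖ_j ⊕ 𝔫) ⊗ v` in `(ℂ ϖ_j ⊕ 𝔫)^{⊗ k} ⊗ V`, given by the alternating map
`w`. It suffices to let elements `x` act which have `v` as an eigenvector. -/
theorem exists_alternatingMap {S : Set (Dual ℂ H)} (hS : IsLinkClosed b j S)
    (hV : weightSpan b j V (weightLattice b) = ⊤) (hVS : AllWeightsIn b j V S) {v : V}
    (hv : v ≠ 0) (k : ℕ) :
    ∃ (T : Type) (_ : AddCommGroup T) (_ : Module ℂ T) (_ : LieRingModule (parabolic b j) T)
      (_ : LieModule ℂ (parabolic b j) T) (w : gradedIdeal b j [⋀^Fin k]→ₗ[ℂ] T),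
      FiniteDimensional ℂ T ∧ weightSpan b j T (weightLattice b) = ⊤ ∧ AllWeightsIn b j T S ∧
      (∀ (x : parabolic b j) (c : ℂ), ⁅x, v⁆ = c • v → ∀ m : Fin k → gradedIdeal b j,
        ⁅x, w m⁆ = ∑ i, w (Function.update m i ⁅x, m i⁆) + c • w m) ∧
      ∀ m : Fin k → gradedIdeal b j, LinearIndependent ℂ m → w m ≠ 0 := by
  induction k with
  | zero =>
    obtain ⟨E, e1, e2, e3, e4, f, hfd, hf⟩ := exists_small_copy b j V
    refine ⟨E, e1, e2, e3, e4,
      AlternatingMap.constOfIsEmpty ℂ (gradedIdeal b j) (Fin 0) (f v), hfd,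
      weightSpan_eq_top_of_surjective hV f hf.2, hVS.of_surjective hV f hf.2, ?_, ?_⟩
    · intro x c hx m
      rw [Finset.univ_eq_empty, Finset.sum_empty, zero_add]
      change ⁅x, f v⁆ = c • f v
      rw [← LieModuleHom.map_lie, hx, map_smul]
    · exact fun m _ h0 ↦ hv ((map_eq_zero_iff f hf.1).mp h0)
  | succ k ih =>
    obtain ⟨T, i1, i2, i3, i4, w, hT, hTw, hTS, hact, hne⟩ := ih
    have hnz : weightSpan b j (gradedIdeal b j) (weightLattice b) = ⊤ := top_le_iff.mp
      ((weightSpan_gradedIdeal b j).ge.trans (weightSpan_mono rootLattice_le_weightLattice))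
    have hT'w := weightSpan_tensor_eq_top hnz hTw
    have hT'S := AllWeightsIn.tensor hS T hTw hTS
    obtain ⟨E, e1, e2, e3, e4, f, hfd, hf⟩ :=
      exists_small_copy b j (TensorProduct ℂ (gradedIdeal b j) T)
    let φ : gradedIdeal b j →ₗ[ℂ]
        gradedIdeal b j [⋀^Fin k]→ₗ[ℂ] TensorProduct ℂ (gradedIdeal b j) T :=
      { toFun := fun a ↦ (TensorProduct.mk ℂ (gradedIdeal b j) T a).compAlternatingMap w
        map_add' := fun a a' ↦ by
          ext m
          exact TensorProduct.add_tmul _ _ _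
        map_smul' := fun c a ↦ by
          ext m
          exact (TensorProduct.smul_tmul' _ _ _).symm }
    let w' := AlternatingMap.alternatizeUncurryFin φ
    have hw' : ∀ m, w' m = ∑ i : Fin (k + 1), (-1 : ℤ) ^ (i : ℕ) • (m i ⊗ₜ[ℂ] w (i.removeNth m)) :=
      fun m ↦ AlternatingMap.alternatizeUncurryFin_apply φ m
    refine ⟨E, e1, e2, e3, e4, f.toLinearMap.compAlternatingMap w', hfd,
      weightSpan_eq_top_of_surjective hT'w f hf.2, hT'S.of_surjective hT'w f hf.2, ?_, ?_⟩
    · intro x c hx m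
      change ⁅x, f (w' m)⁆ = ∑ i, f (w' (Function.update m i ⁅x, m i⁆)) + c • f (w' m)
      rw [← LieModuleHom.map_lie, ← map_sum, ← map_smul, ← map_add]
      congr 1
      simp_rw [hw']
      rw [Finset.sum_comm, lie_sum, Finset.smul_sum, ← Finset.sum_add_distrib]
      refine Finset.sum_congr rfl fun i _ ↦ ?_
      rw [lie_zsmul, TensorProduct.LieModule.lie_tmul_right, hact x c hx,
        Fin.sum_univ_succAbove _ i,
        Function.update_self, Fin.removeNth_update, TensorProduct.tmul_add, TensorProduct.tmul_sum,
        TensorProduct.tmul_smul, smul_add, smul_add, smul_comm c, Finset.smul_sum, add_assoc]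
      congr 2
      refine Finset.sum_congr rfl fun l _ ↦ ?_
      rw [Function.update_of_ne (Fin.ne_succAbove i l), Fin.removeNth_update_succAbove]
      rfl
    · intro m hm h0
      change f (w' m) = 0 at h0
      rw [map_eq_zero_iff f hf.1, hw'] at h0
      -- contract with a linear form taking the value one at the first vector only
      obtain ⟨g, hg⟩ : ∃ g : gradedIdeal b j →ₗ[ℂ] ℂ, ∀ i, g (m i) = if i = 0 then 1 else 0 := by
        obtain ⟨G, hG⟩ := LinearMap.exists_leftInverse_of_injective
          (Finsupp.linearCombination ℂ m) (LinearMap.ker_eq_bot.mpr hm)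
        refine ⟨Finsupp.lapply 0 ∘ₗ G, fun i ↦ ?_⟩
        have h1 := LinearMap.congr_fun hG (Finsupp.single i 1)
        rw [LinearMap.comp_apply, Finsupp.linearCombination_single, one_smul] at h1
        rw [LinearMap.comp_apply, h1, LinearMap.id_apply, Finsupp.lapply_apply,
          Finsupp.single_apply]
      have h1 := congrArg ((TensorProduct.lid ℂ T).toLinearMap ∘ₗ LinearMap.rTensor T g) h0
      rw [map_zero, map_sum, Fin.sum_univ_succ] at h1
      simp only [map_zsmul, LinearMap.comp_apply, LinearMap.rTensor_tmul, hg, Fin.succ_ne_zero,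
        if_true, if_false, LinearEquiv.coe_coe, TensorProduct.lid_tmul, zero_smul, smul_zero,
        Finset.sum_const_zero, add_zero, one_smul, Fin.val_zero, pow_zero] at h1
      refine hne _ ?_ h1
      exact hm.comp _ (Fin.succAbove_right_injective)

end Wedge

theorem exists_rootVector {γ : H.root} (hγ : coeff b j γ ≤ 0) :
    ∃ y : parabolic b j, y ≠ 0 ∧ IsRootVector b j γ y := by
  obtain ⟨y, hy, h0⟩ := (rootSpace H γ.1).toSubmodule.exists_mem_ne_zero_of_ne_bot
    fun h ↦ γ.1.genWeightSpace_ne_bot _ ((LieSubmodule.toSubmodule_eq_bot _).mp h)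
  exact ⟨⟨y, rootSpace_le_parabolicSubmodule b j γ hγ hy⟩, fun h ↦ h0 (congrArg Subtype.val h), hy⟩

theorem IsRootVector.exists_eq_smul {γ : H.root} {x y : parabolic b j}
    (hx : IsRootVector b j γ x) (hy : IsRootVector b j γ y) (h0 : y ≠ 0) :
    ∃ c : ℂ, x = c • y := by
  have h1 : finrank ℂ (rootSpace H γ.1) = 1 :=
    finrank_rootSpace_eq_one γ.1 (LieSubalgebra.isNonZero_coe_root γ)
  obtain ⟨c, hc⟩ := (finrank_eq_one_iff_of_nonzero' (⟨y, hy⟩ : rootSpace H γ.1)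
    fun h ↦ h0 (Subtype.ext (congrArg (fun z : rootSpace H γ.1 ↦ (z : 𝔤)) h))).mp h1 ⟨x, hx⟩
  exact ⟨c, Subtype.ext (congrArg Subtype.val hc).symm⟩

theorem linearIndependent_rootVectors {ι : Type*} {γ : ι → H.root} (hγ : Function.Injective γ)
    {y : ι → parabolic b j} (hy : ∀ i, IsRootVector b j (γ i) (y i)) (h0 : ∀ i, y i ≠ 0) :
    LinearIndependent ℂ y := by
  refine LinearIndependent.of_comp (parabolic b j).toSubmodule.subtype ?_
  have h1 : iSupIndep fun i ↦ (rootSpace H (γ i).1).toSubmodule := by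
    rw [LieSubmodule.iSupIndep_toSubmodule]
    refine (LieModule.iSupIndep_genWeightSpace' ℂ H 𝔤).comp (f := fun i ↦ (γ i).1) ?_
    exact Subtype.val_injective.comp hγ
  exact h1.linearIndependent _ hy fun i h ↦ h0 i (Subtype.ext h)

/-- If `lam` is the weight of a maximal vector of `V` and `I` is a set of roots of `𝔫` that is
closed under adding positive roots, then `lam + ∑_{γ ∈ I} γ` is the weight of a maximal vector in
a module in the same blocks as `V`, namely of `⋀_{γ ∈ I} e_γ ⊗ v`. -/
theorem exists_maximal_add_sum {V : Type*} [AddCommGroup V] [Module ℂ V]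
    [LieRingModule (parabolic b j) V] [LieModule ℂ (parabolic b j) V] [FiniteDimensional ℂ V]
    {S : Set (Dual ℂ H)} (hS : IsLinkClosed b j S)
    (hV : weightSpan b j V (weightLattice b) = ⊤) (hVS : AllWeightsIn b j V S) {v : V}
    (hv0 : v ≠ 0) {lam : Dual ℂ H} (hv : IsMaximalMod b j (⊥ : Submodule ℂ V) lam v)
    {I : Finset H.root} (hI : ∀ γ ∈ I, coeff b j γ < 0)
    (hclosed : ∀ α : H.root, b.IsPos α → ∀ γ ∈ I, ∀ δ : H.root,
      (rootSystem H).root δ = (rootSystem H).root α + (rootSystem H).root γ →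
      coeff b j δ < 0 → δ ∈ I) :
    ∃ (T : Type) (_ : AddCommGroup T) (_ : Module ℂ T) (_ : LieRingModule (parabolic b j) T)
      (_ : LieModule ℂ (parabolic b j) T) (t : T),
      FiniteDimensional ℂ T ∧ weightSpan b j T (weightLattice b) = ⊤ ∧ AllWeightsIn b j T S ∧
      t ≠ 0 ∧ IsMaximalMod b j (⊥ : Submodule ℂ T) (lam + ∑ γ ∈ I, (rootSystem H).root γ) t := by
  obtain ⟨T, i1, i2, i3, i4, w, hT, hTw, hTS, hact, hne⟩ :=
    exists_alternatingMap hS hV hVS hv0 I.card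
  let γ : Fin I.card → H.root := fun i ↦ (I.equivFin.symm i).1
  have hγI : ∀ i, γ i ∈ I := fun i ↦ (I.equivFin.symm i).2
  have hγinj : Function.Injective γ := Subtype.val_injective.comp I.equivFin.symm.injective
  choose y hy0 hy using fun i ↦ exists_rootVector (hI (γ i) (hγI i)).le
  let m : Fin I.card → gradedIdeal b j := fun i ↦ ⟨y i, mem_gradedIdeal (hI _ (hγI i)) (hy i)⟩
  have hm : LinearIndependent ℂ m :=
    LinearIndependent.of_comp (gradedIdeal b j).toSubmodule.subtype
      (linearIndependent_rootVectors hγinj hy hy0)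
  refine ⟨T, i1, i2, i3, i4, w m, hT, hTw, hTS, hne m hm, ?_, ?_⟩
  · rw [isWeightVector_iff]
    intro h
    rw [hact _ _ (hv.1.lie_cartan h), LinearMap.add_apply, LinearMap.sum_apply, add_smul, add_comm,
      Finset.sum_smul]
    congr 1
    have h1 : ∀ i, ⁅cartanIncl b j h, m i⁆ = (rootSystem H).root (γ i) h • m i := fun i ↦
      Subtype.ext ((hy i).lie_cartan h)
    simp_rw [h1, AlternatingMap.map_update_smul, Function.update_eq_self]
    rw [← Finset.sum_coe_sort I, ← I.equivFin.symm.sum_comp]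
  · intro α hα x hx
    rw [Submodule.mem_bot]
    by_cases hx0 : x = 0
    · rw [hx0, zero_lie]
    have hα0 : coeff b j α = 0 := le_antisymm (hx.coeff_nonpos hx0) (coeff_nonneg hα)
    have h0 : ⁅x, v⁆ = 0 := (Submodule.mem_bot ℂ).mp (hv.2 α hα x hx)
    rw [hact x 0 (by rw [h0, zero_smul]), zero_smul, add_zero]
    refine Finset.sum_eq_zero fun i _ ↦ ?_
    rcases hx.lie (hy i) with h | ⟨δ, hδ, h⟩ | h
    · have h2 := congrArg (coeffForm b j) h
      rw [map_add, coeffForm_eq_coeff, coeffForm_eq_coeff, map_zero, hα0, Int.cast_zero,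
        zero_add, Int.cast_eq_zero] at h2
      exact absurd h2 (hI _ (hγI i)).ne
    · have h2 : coeff b j δ < 0 := by
        rw [coeff_add b j hδ, hα0, zero_add]
        exact hI _ (hγI i)
      have h3 : δ ∈ I := hclosed α hα _ (hγI i) δ hδ h2
      obtain ⟨i', rfl⟩ : ∃ i', γ i' = δ :=
        ⟨I.equivFin ⟨δ, h3⟩, congrArg Subtype.val (I.equivFin.symm_apply_apply ⟨δ, h3⟩)⟩
      have hii : i ≠ i' := by
        rintro rfl
        simp at hδ
      obtain ⟨c, hc⟩ := h.exists_eq_smul (hy i') (hy0 i')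
      have h4 : ⁅x, m i⁆ = c • m i' := Subtype.ext hc
      rw [h4, AlternatingMap.map_update_smul, AlternatingMap.map_update_self _ _ hii, smul_zero]
    · have h4 : ⁅x, m i⁆ = 0 := Subtype.ext h
      rw [h4]
      exact w.map_update_zero m i

/-! ### The roots of the nilradical -/

variable (b j) in
theorem exists_neg_root_self : ∃ γ : H.root,
    (rootSystem H).root γ = -(rootSystem H).root j ∧ coeff b j γ < 0 := by
  classical
  obtain ⟨γ, hγ, -⟩ := exists_neg_root (j : H.root)
  refine ⟨γ, hγ, ?_⟩
  have h1 := coeffForm_eq_coeff (b := b) (j := j) γ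
  rw [hγ, map_neg, coeffForm_root, if_pos rfl] at h1
  have h2 : coeff b j γ = -1 := by exact_mod_cast h1.symm
  lia

/-- The roots of the nilradical generate the root lattice: if `α_i` is not orthogonal to all of
them then it is the difference of two of them; otherwise they span an invariant subspace. -/
theorem closure_nilradical_roots [(rootSystem H).IsIrreducible] :
    AddSubgroup.closure {χ | ∃ γ : H.root, coeff b j γ < 0 ∧ χ = (rootSystem H).root γ} =
      rootLattice b := by
  classical
  refine le_antisymm ?_ ?_
  · rw [AddSubgroup.closure_le]
    rintro _ ⟨γ, -, rfl⟩
    exact root_mem_rootLattice γ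
  set Λ := AddSubgroup.closure {χ | ∃ γ : H.root, coeff b j γ < 0 ∧ χ = (rootSystem H).root γ}
    with hΛ
  have hmem : ∀ γ : H.root, coeff b j γ < 0 → (rootSystem H).root γ ∈ Λ := fun γ hγ ↦
    AddSubgroup.subset_closure ⟨γ, hγ, rfl⟩
  have hcoeff : ∀ (γ δ : H.root) (i : b.support), i ≠ j → (c : ℤ) →
      (rootSystem H).root δ = (rootSystem H).root γ + c • (rootSystem H).root i →
      coeff b j δ = coeff b j γ := by
    intro γ δ i hi c h
    have h1 := congrArg (coeffForm b j) h
    rw [map_add, map_zsmul, coeffForm_eq_coeff, coeffForm_eq_coeff, coeffForm_eq_coeff,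
      coeff_root i hi, Int.cast_zero, smul_zero, add_zero] at h1
    exact_mod_cast h1
  obtain ⟨j', hj', hj0⟩ := exists_neg_root_self b j
  have hj : (rootSystem H).root j ∈ Λ := by
    rw [← neg_neg ((rootSystem H).root j), ← hj']
    exact neg_mem (hmem j' hj0)
  rw [rootLattice, AddSubgroup.closure_le]
  rintro _ ⟨i, rfl⟩
  rcases eq_or_ne i j with rfl | hi
  · exact hj
  by_cases hex : ∃ γ : H.root, coeff b j γ < 0 ∧ (rootSystem H).pairingIn ℤ γ i ≠ 0
  · obtain ⟨γ, hγ, hne⟩ := hex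
    have hγi : ∀ c : ℤ, (rootSystem H).root γ ≠ c • (rootSystem H).root i := by
      intro c h
      have h1 := congrArg (coeffForm b j) h
      rw [map_zsmul, coeffForm_eq_coeff, coeffForm_eq_coeff, coeff_root i hi, Int.cast_zero,
        smul_zero, Int.cast_eq_zero] at h1
      exact hγ.ne h1
    rcases hne.lt_or_gt with h | h
    · obtain ⟨δ, hδ⟩ := (rootSystem H).root_add_root_mem_of_pairingIn_neg h
        fun h' ↦ hγi (-1) (by rw [h', neg_one_zsmul])
      have h1 := hcoeff γ δ i hi 1 (by rw [hδ, one_zsmul])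
      have h2 := sub_mem (hmem δ (h1 ▸ hγ)) (hmem γ hγ)
      rwa [hδ, add_sub_cancel_left] at h2
    · obtain ⟨δ, hδ⟩ := (rootSystem H).root_sub_root_mem_of_pairingIn_pos h
        fun h' ↦ hγi 1 (by rw [h', one_zsmul])
      have h1 := hcoeff γ δ i hi (-1) (by rw [hδ, neg_one_zsmul, sub_eq_add_neg])
      have h2 := sub_mem (hmem γ hγ) (hmem δ (h1 ▸ hγ))
      rwa [hδ, sub_sub_cancel] at h2
  · exfalso
    push Not at hex
    let U : Submodule ℂ (Dual ℂ H) :=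
      Submodule.span ℂ {χ | ∃ γ : H.root, coeff b j γ < 0 ∧ χ = (rootSystem H).root γ}
    have hU : ∀ γ : H.root, coeff b j γ < 0 → (rootSystem H).root γ ∈ U := fun γ hγ ↦
      Submodule.subset_span ⟨γ, hγ, rfl⟩
    have hinv : ∀ k ∈ b.support, U ∈ Module.End.invtSubmodule ((rootSystem H).reflection k) := by
      intro k hk
      rw [Module.End.mem_invtSubmodule]
      refine Submodule.span_le.mpr ?_
      rintro _ ⟨γ, hγ, rfl⟩
      change (rootSystem H).reflection k ((rootSystem H).root γ) ∈ U
      by_cases hkj : (⟨k, hk⟩ : b.support) = j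
      · rw [RootPairing.reflection_apply]
        refine sub_mem (hU γ hγ) (Submodule.smul_mem _ _ ?_)
        obtain rfl : k = j := congrArg Subtype.val hkj
        rw [← neg_neg ((rootSystem H).root j), ← hj']
        exact neg_mem (hU j' hj0)
      · have h1 := (rootSystem H).root_reflectionPerm k γ
        rw [← h1]
        refine hU _ ?_
        rw [hcoeff γ _ ⟨k, hk⟩ hkj (-(rootSystem H).pairingIn ℤ γ k) ?_]
        · exact hγ
        · rw [h1, RootPairing.reflection_apply_root, ← RootPairing.algebraMap_pairingIn _ ℤ,
            neg_smul, sub_eq_add_neg]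
          congr 2
          exact Int.cast_smul_eq_zsmul ℂ _ _
    have htop : U = ⊤ := RootPairing.IsIrreducible.eq_top_of_invtSubmodule_reflection U
      ((b.forall_mem_support_invtSubmodule_iff U).mp hinv)
      fun h ↦ root_ne_zero j' ((Submodule.mem_bot ℂ).mp (h ▸ hU j' hj0))
    have h0 : ∀ χ ∈ U, χ ((rootSystem H).coroot i) = 0 := by
      intro χ hχ
      induction hχ using Submodule.span_induction with
      | zero => rfl
      | add x y _ _ hx hy => rw [LinearMap.add_apply, hx, hy, add_zero]
      | smul c x _ hx => rw [LinearMap.smul_apply, hx, smul_zero]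
      | mem x hx =>
        obtain ⟨γ, hγ, rfl⟩ := hx
        have h1 := (rootSystem H).algebraMap_pairingIn ℤ γ i
        rw [hex γ hγ, map_zero] at h1
        exact h1.symm
    have h1 := h0 ((rootSystem H).root i) (htop ▸ Submodule.mem_top)
    have h2 : (rootSystem H).root i ((rootSystem H).coroot i) = 2 :=
      (rootSystem H).root_coroot_two i
    rw [h1] at h2
    norm_num at h2

/-- Each root of the nilradical is a difference of sums over sets of roots of the nilradical that
are closed under adding positive roots. -/
theorem exists_closed_sets (β : H.root) (hβ : coeff b j β < 0) :
    ∃ I J : Finset H.root, (∀ γ ∈ I, coeff b j γ < 0) ∧ (∀ γ ∈ J, coeff b j γ < 0) ∧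
      (∀ α : H.root, b.IsPos α → ∀ γ ∈ I, ∀ δ : H.root,
        (rootSystem H).root δ = (rootSystem H).root α + (rootSystem H).root γ →
        coeff b j δ < 0 → δ ∈ I) ∧
      (∀ α : H.root, b.IsPos α → ∀ γ ∈ J, ∀ δ : H.root,
        (rootSystem H).root δ = (rootSystem H).root α + (rootSystem H).root γ →
        coeff b j δ < 0 → δ ∈ J) ∧
      ∑ γ ∈ J, (rootSystem H).root γ = (rootSystem H).root β + ∑ γ ∈ I, (rootSystem H).root γ := by
  classical
  let I : Finset H.root := Finset.univ.filter fun γ ↦ coeff b j γ < 0 ∧ b.height β < b.height γ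
  have hI : ∀ γ, γ ∈ I ↔ coeff b j γ < 0 ∧ b.height β < b.height γ := fun γ ↦ by
    rw [Finset.mem_filter]
    exact and_iff_right (Finset.mem_univ _)
  have key : ∀ α γ δ : H.root, b.IsPos α →
      (rootSystem H).root δ = (rootSystem H).root α + (rootSystem H).root γ →
      b.height γ < b.height δ := by
    intro α γ δ hα h
    have h1 := congrArg (heightForm b) h
    rw [map_add, heightForm_eq_height, heightForm_eq_height, heightForm_eq_height] at h1
    have h2 : b.height δ = b.height α + b.height γ := by exact_mod_cast h1
    have h3 : 0 < b.height α := hα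
    lia
  refine ⟨I, insert β I, fun γ hγ ↦ ((hI γ).mp hγ).1, ?_, ?_, ?_, ?_⟩
  · intro γ hγ
    rcases Finset.mem_insert.mp hγ with rfl | hγ
    · exact hβ
    · exact ((hI γ).mp hγ).1
  · intro α hα γ hγ δ hδ hδ0
    exact (hI δ).mpr ⟨hδ0, ((hI γ).mp hγ).2.trans (key α γ δ hα hδ)⟩
  · intro α hα γ hγ δ hδ hδ0
    refine Finset.mem_insert_of_mem ((hI δ).mpr ⟨hδ0, ?_⟩)
    rcases Finset.mem_insert.mp hγ with rfl | hγ
    · exact key α γ δ hα hδ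
    · exact ((hI γ).mp hγ).2.trans (key α γ δ hα hδ)
  · rw [Finset.sum_insert]
    exact fun h ↦ lt_irrefl _ ((hI β).mp h).2

/-! ### Modules with prescribed maximal weight -/

variable (b j) in
/-- `lam` is the weight of a maximal vector of some `𝔭`-module, possibly of infinite dimension. -/
def HasMaximalVector (lam : Dual ℂ H) : Prop :=
  ∃ (M : Type) (_ : AddCommGroup M) (_ : Module ℂ M) (_ : LieRingModule (parabolic b j) M)
    (_ : LieModule ℂ (parabolic b j) M) (v : M),
    v ≠ 0 ∧ IsMaximalMod b j (⊥ : Submodule ℂ M) lam v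

theorem HasMaximalVector.add {lam μ : Dual ℂ H} (h : HasMaximalVector b j lam)
    (h' : HasMaximalVector b j μ) : HasMaximalVector b j (lam + μ) := by
  obtain ⟨M, i1, i2, i3, i4, v, hv0, hv⟩ := h
  obtain ⟨N, j1, j2, j3, j4, w, hw0, hw⟩ := h'
  refine ⟨TensorProduct ℂ M N, inferInstance, inferInstance, inferInstance, inferInstance,
    v ⊗ₜ w, fun h ↦ ?_, hv.1.tmul hw.1, fun α hα x hx ↦ ?_⟩
  · obtain ⟨f, hf⟩ : ∃ f : Dual ℂ M, f v ≠ 0 := by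
      by_contra! hc
      exact hv0 ((forall_dual_apply_eq_zero_iff ℂ v).mp hc)
    have h1 := congrArg ((TensorProduct.lid ℂ N).toLinearMap ∘ₗ LinearMap.rTensor N f) h
    rw [LinearMap.comp_apply, LinearMap.rTensor_tmul, LinearEquiv.coe_coe, TensorProduct.lid_tmul,
      map_zero] at h1
    exact (smul_ne_zero hf hw0) h1
  · rw [Submodule.mem_bot, TensorProduct.LieModule.lie_tmul_right,
      (Submodule.mem_bot ℂ).mp (hv.2 α hα x hx), (Submodule.mem_bot ℂ).mp (hw.2 α hα x hx),
      TensorProduct.zero_tmul, TensorProduct.tmul_zero, add_zero]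

section Twist

variable {W : Type} [AddCommGroup W] [Module ℂ W] [LieRingModule (parabolic b j) W]
  [LieModule ℂ (parabolic b j) W] {ι : Type} (B : Basis ι ℂ W) (i₀ : ι)

open Classical in
/-- The linear map from `W` to the polynomials in the coordinates of the affine space
`{w = 1} ⊆ W^*`, where `w = B i₀`. (There is an additional variable at `i₀`, which is not used.) -/
noncomputable def affineCoord : W →ₗ[ℂ] MvPolynomial ι ℂ :=
  B.constr ℂ fun i ↦ if i = i₀ then 1 else MvPolynomial.X i

theorem affineCoord_self : affineCoord B i₀ (B i₀) = 1 := by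
  rw [affineCoord, Basis.constr_basis, if_pos rfl]

theorem affineCoord_of_ne {i : ι} (hi : i ≠ i₀) : affineCoord B i₀ (B i) = MvPolynomial.X i := by
  rw [affineCoord, Basis.constr_basis, if_neg hi]

open Classical in
/-- The vector field on the affine space `{w = 1}`, an open subset of `ℙ(W^*)`, given by `x`. -/
noncomputable def vectorField (x : parabolic b j) :
    Derivation ℂ (MvPolynomial ι ℂ) (MvPolynomial ι ℂ) :=
  MvPolynomial.mkDerivation ℂ fun i ↦ if i = i₀ then 0 else
    affineCoord B i₀ ⁅x, B i⁆ - affineCoord B i₀ (B i) * affineCoord B i₀ ⁅x, B i₀⁆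

theorem vectorField_affineCoord (x : parabolic b j) (u : W) :
    vectorField B i₀ x (affineCoord B i₀ u) =
      affineCoord B i₀ ⁅x, u⁆ - affineCoord B i₀ u * affineCoord B i₀ ⁅x, B i₀⁆ := by
  have hu : u ∈ Submodule.span ℂ (Set.range B) := B.span_eq ▸ Submodule.mem_top
  induction hu using Submodule.span_induction with
  | zero => simp
  | add u v _ _ hu hv =>
    rw [map_add, map_add, lie_add, map_add, hu, hv]
    ring
  | smul c u _ hu =>
    rw [map_smul, Derivation.map_smul, lie_smul, map_smul, hu, smul_mul_assoc, smul_sub]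
  | mem u hu =>
    obtain ⟨i, rfl⟩ := hu
    by_cases hi : i = i₀
    · subst hi
      rw [affineCoord_self, Derivation.map_one_eq_zero, one_mul, sub_self]
    · conv_lhs =>
        rw [affineCoord_of_ne B i₀ hi, vectorField, MvPolynomial.mkDerivation_X, if_neg hi]

theorem vectorField_X_self (x : parabolic b j) :
    vectorField B i₀ x (MvPolynomial.X i₀) = 0 := by
  rw [vectorField, MvPolynomial.mkDerivation_X, if_pos rfl]

theorem vectorField_lie (x y : parabolic b j) (a : MvPolynomial ι ℂ) :
    vectorField B i₀ ⁅x, y⁆ a = vectorField B i₀ x (vectorField B i₀ y a) -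
      vectorField B i₀ y (vectorField B i₀ x a) := by
  have h : vectorField B i₀ ⁅x, y⁆ = ⁅vectorField B i₀ x, vectorField B i₀ y⁆ := by
    refine MvPolynomial.derivation_ext fun i ↦ ?_
    rw [Derivation.commutator_apply]
    by_cases hi : i = i₀
    · subst hi
      rw [vectorField_X_self, vectorField_X_self, vectorField_X_self, map_zero, map_zero, sub_self]
    · rw [← affineCoord_of_ne B i₀ hi]
      simp only [vectorField_affineCoord, map_sub, Derivation.leibniz, smul_eq_mul, lie_lie]
      ring
  rw [h, Derivation.commutator_apply]

theorem vectorField_add (x y : parabolic b j) (a : MvPolynomial ι ℂ) :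
    vectorField B i₀ (x + y) a = vectorField B i₀ x a + vectorField B i₀ y a := by
  have h : vectorField B i₀ (x + y) = vectorField B i₀ x + vectorField B i₀ y := by
    refine MvPolynomial.derivation_ext fun i ↦ ?_
    rw [Derivation.add_apply]
    by_cases hi : i = i₀
    · subst hi
      rw [vectorField_X_self, vectorField_X_self, vectorField_X_self, add_zero]
    · rw [← affineCoord_of_ne B i₀ hi]
      simp only [vectorField_affineCoord, add_lie, map_add]
      ring
  rw [h, Derivation.add_apply]

theorem vectorField_smul (c : ℂ) (x : parabolic b j) (a : MvPolynomial ι ℂ) :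
    vectorField B i₀ (c • x) a = c • vectorField B i₀ x a := by
  have h : vectorField B i₀ (c • x) = c • vectorField B i₀ x := by
    refine MvPolynomial.derivation_ext fun i ↦ ?_
    rw [Derivation.smul_apply]
    by_cases hi : i = i₀
    · subst hi
      rw [vectorField_X_self, vectorField_X_self, smul_zero]
    · rw [← affineCoord_of_ne B i₀ hi]
      simp only [vectorField_affineCoord, smul_lie, map_smul, smul_sub, mul_smul_comm]
  rw [h, Derivation.smul_apply]

end Twist

/-- A complex multiple of the weight of a maximal vector `w` is the weight of a maximal vector: the
function `w ^ z` on the locus where `w` is not zero. -/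
theorem IsMaximalMod.hasMaximalVector_smul {W : Type} [AddCommGroup W] [Module ℂ W]
    [LieRingModule (parabolic b j) W] [LieModule ℂ (parabolic b j) W] {τ : Dual ℂ H} {w : W}
    (hw0 : w ≠ 0) (hw : IsMaximalMod b j (⊥ : Submodule ℂ W) τ w) (z : ℂ) :
    HasMaximalVector b j (z • τ) := by
  obtain ⟨ι, B, i₀, rfl⟩ : ∃ (ι : Type) (B : Basis ι ℂ W) (i₀ : ι), B i₀ = w := by
    have h1 : LinearIndepOn ℂ id ({w} : Set W) := LinearIndepOn.singleton hw0
    exact ⟨_, Basis.extend h1, ⟨w, h1.subset_extend _ rfl⟩, Basis.extend_apply_self _ _⟩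
  let D := vectorField (b := b) (j := j) B i₀
  let l := affineCoord B i₀
  -- the polynomial `a` stands for the function `a * w ^ z`
  let i3 : LieRingModule (parabolic b j) (MvPolynomial ι ℂ) :=
    { bracket := fun x a ↦ D x a + z • (l ⁅x, B i₀⁆ * a)
      add_lie := fun x y a ↦ by
        change D (x + y) a + z • (l ⁅x + y, B i₀⁆ * a) = D x a + z • (l ⁅x, B i₀⁆ * a) +
          (D y a + z • (l ⁅y, B i₀⁆ * a))
        rw [vectorField_add, add_lie, map_add, add_mul, smul_add]
        abel
      lie_add := fun x a a' ↦ by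
        change D x (a + a') + z • (l ⁅x, B i₀⁆ * (a + a')) = D x a + z • (l ⁅x, B i₀⁆ * a) +
          (D x a' + z • (l ⁅x, B i₀⁆ * a'))
        rw [map_add, mul_add, smul_add]
        abel
      leibniz_lie := fun x y a ↦ by
        change D x (D y a + z • (l ⁅y, B i₀⁆ * a)) +
            z • (l ⁅x, B i₀⁆ * (D y a + z • (l ⁅y, B i₀⁆ * a))) =
          D ⁅x, y⁆ a + z • (l ⁅⁅x, y⁆, B i₀⁆ * a) + (D y (D x a + z • (l ⁅x, B i₀⁆ * a)) +
            z • (l ⁅y, B i₀⁆ * (D x a + z • (l ⁅x, B i₀⁆ * a))))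
        rw [vectorField_lie]
        have h1 := vectorField_affineCoord (b := b) (j := j) B i₀
        simp only [map_add, Derivation.leibniz, smul_eq_mul, lie_lie, map_sub, D, l, h1,
          Algebra.smul_def, Derivation.map_algebraMap]
        ring }
  have hb : ∀ (x : parabolic b j) (a : MvPolynomial ι ℂ), ⁅x, a⁆ = D x a + z • (l ⁅x, B i₀⁆ * a) :=
    fun _ _ ↦ rfl
  have i4 : LieModule ℂ (parabolic b j) (MvPolynomial ι ℂ) :=
    { smul_lie := fun c x a ↦ by
        rw [hb, hb, vectorField_smul, smul_lie, map_smul, smul_mul_assoc, smul_comm z c, smul_add]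
      lie_smul := fun c x a ↦ by
        rw [hb, hb, Derivation.map_smul, mul_smul_comm, smul_comm z c, smul_add] }
  have h1 : ∀ (x : parabolic b j), ⁅x, (1 : MvPolynomial ι ℂ)⁆ = z • l ⁅x, B i₀⁆ := fun x ↦ by
    rw [hb, Derivation.map_one_eq_zero, zero_add, mul_one]
  refine ⟨MvPolynomial ι ℂ, inferInstance, inferInstance, i3, i4, 1, one_ne_zero, ?_, ?_⟩
  · rw [isWeightVector_iff]
    intro h
    rw [h1, hw.1.lie_cartan, map_smul, affineCoord_self, smul_smul]
    rfl
  · intro α hα x hx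
    rw [h1, (Submodule.mem_bot ℂ).mp (hw.2 α hα x hx), map_zero, smul_zero]
    exact zero_mem _

theorem hasMaximalVector_smul_root (z : ℂ) (β : H.root) (hβ : coeff b j β < 0) :
    HasMaximalVector b j (z • (rootSystem H).root β) := by
  obtain ⟨I, J, hI, hJ, hIc, hJc, h⟩ := exists_closed_sets β hβ
  have hS : IsLinkClosed b j (Set.univ : Set (Dual ℂ H)) := fun _ _ _ ↦ Iff.rfl
  have hV : weightSpan b j (gradedIdeal b j) (weightLattice b) = ⊤ := top_le_iff.mp
    ((weightSpan_gradedIdeal b j).ge.trans (weightSpan_mono rootLattice_le_weightLattice))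
  have hVS : AllWeightsIn b j (gradedIdeal b j) Set.univ := fun _ _ _ _ _ ↦ Set.mem_univ _
  have h0 : (⟨cartanIncl b j (coweight b j), coweight_mem_gradedIdeal⟩ : gradedIdeal b j) ≠ 0 := by
    intro h
    have h1 : coweight b j = 0 := by
      have := congrArg (fun y : gradedIdeal b j ↦ ((y : parabolic b j) : 𝔤)) h
      exact Subtype.ext this
    have h2 := apply_coweight (b := b) (j := j) ((rootSystem H).root β)
    rw [h1, map_zero, coeffForm_eq_coeff] at h2
    exact hβ.ne (by exact_mod_cast h2.symm)
  obtain ⟨T, i1, i2, i3, i4, t, -, -, -, ht0, ht⟩ :=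
    exists_maximal_add_sum hS hV hVS h0 isMaximalMod_coweight hI hIc
  obtain ⟨T', i1', i2', i3', i4', t', -, -, -, ht0', ht'⟩ :=
    exists_maximal_add_sum hS hV hVS h0 isMaximalMod_coweight hJ hJc
  have := (ht'.hasMaximalVector_smul ht0' z).add (ht.hasMaximalVector_smul ht0 (-z))
  rw [zero_add, zero_add, h, smul_add, neg_smul, add_neg_cancel_right] at this
  exact this

theorem hasMaximalVector [(rootSystem H).IsIrreducible] (lam : Dual ℂ H) :
    HasMaximalVector b j lam := by
  let U : Submodule ℂ (Dual ℂ H) :=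
    Submodule.span ℂ {χ | ∃ γ : H.root, coeff b j γ < 0 ∧ χ = (rootSystem H).root γ}
  have h1 : ∀ i : b.support, (rootSystem H).root i ∈ U := by
    intro i
    have : rootLattice b ≤ U.toAddSubgroup := by
      rw [← closure_nilradical_roots (b := b) (j := j), AddSubgroup.closure_le]
      exact Submodule.subset_span
    exact this (root_mem_rootLattice (i : H.root))
  have h2 : lam ∈ U := by
    rw [← b.toWeightBasis.sum_repr lam]
    refine Submodule.sum_mem _ fun i _ ↦ Submodule.smul_mem _ _ ?_
    rw [b.toWeightBasis_apply]
    exact h1 i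
  induction h2 using Submodule.closure_induction with
  | zero =>
    obtain ⟨γ, -, hγ⟩ := exists_neg_root_self b j
    have := hasMaximalVector_smul_root 0 γ hγ
    rwa [zero_smul] at this
  | add x y _ _ hx hy => exact hx.add hy
  | smul_mem c x hx =>
    obtain ⟨γ, hγ, rfl⟩ := hx
    exact hasMaximalVector_smul_root c γ hγ

/-! ### Existence of irreducible modules -/

/-- Every weight is the maximal weight of an irreducible `𝔭`-module, possibly of infinite
dimension. -/
theorem exists_isIrreducibleOfMaximalWeight [(rootSystem H).IsIrreducible] (lam : Dual ℂ H) :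
    ∃ (Q : Type) (_ : AddCommGroup Q) (_ : Module ℂ Q) (_ : LieRingModule (parabolic b j) Q)
      (_ : LieModule ℂ (parabolic b j) Q), IsIrreducibleOfMaximalWeight b j Q lam := by
  obtain ⟨M, i1, i2, i3, i4, v, hv0, hv⟩ := hasMaximalVector (b := b) (j := j) lam
  let N := LieSubmodule.lieSpan ℂ (parabolic b j) {v}
  have hvN : v ∈ N := LieSubmodule.subset_lieSpan (Set.mem_singleton v)
  have htop : ∀ U : LieSubmodule ℂ (parabolic b j) N, ⟨v, hvN⟩ ∈ U → U = ⊤ := by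
    intro U hU
    have h1 : N ≤ U.map N.incl := by
      rw [LieSubmodule.lieSpan_le, Set.singleton_subset_iff]
      exact (LieSubmodule.mem_map _).mpr ⟨_, hU, rfl⟩
    rw [eq_top_iff]
    intro x _
    obtain ⟨y, hy, hyx⟩ := (LieSubmodule.mem_map _).mp (h1 x.2)
    rwa [← Subtype.ext hyx]
  have hN : weightSpan b j N {χ | lam - χ ∈ posCone b} = ⊤ := by
    rw [eq_top_iff]
    rintro ⟨x, hx⟩ -
    obtain ⟨s, f, hs, hf, -, rfl⟩ := exists_sum_of_mem_weightSpan (lieSpan_le_weightSpan hv hx)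
    have h1 := mem_of_sum_mem N s f (fun χ _ ↦ hf χ) hx
    have h2 : (⟨∑ χ ∈ s, f χ, hx⟩ : N) = ∑ χ ∈ s.attach, ⟨f χ, h1 χ χ.2⟩ := by
      ext1
      rw [AddSubmonoidClass.coe_finsetSum, Finset.sum_attach s f]
    rw [h2]
    exact sum_mem fun χ _ ↦ IsWeightVector.mem_weightSpan
      ((isWeightVector_coe (N := N) (v := ⟨f χ, h1 χ χ.2⟩)).mp (hf χ)) (hs χ χ.2)
  -- the largest proper submodule
  let K : LieSubmodule ℂ (parabolic b j) N :=
    sSup {U : LieSubmodule ℂ (parabolic b j) N | ⟨v, hvN⟩ ∉ U}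
  have hKle : K.toSubmodule ≤ weightSpan b j N {χ | χ ≠ lam} := by
    rw [LieSubmodule.sSup_toSubmodule_eq_iSup]
    refine iSup₂_le fun U hU ↦ ?_
    intro u hu
    have h1 : (⟨u, hu⟩ : U) ∈ weightSpan b j U {χ | lam - χ ∈ posCone b} :=
      (weightSpan_sub_eq_top hN U).symm ▸ Submodule.mem_top
    obtain ⟨s, f, hs, hf, -, h2⟩ := exists_sum_of_mem_weightSpan h1
    have h3 : u = ∑ χ ∈ s, (f χ : N) := by
      have := congrArg Subtype.val h2
      rwa [AddSubmonoidClass.coe_finsetSum] at this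
    rw [h3]
    refine sum_mem fun χ _ ↦ ?_
    have h4 : IsWeightVector b j χ (f χ : N) := isWeightVector_coe.mpr (hf χ)
    by_cases hχ : χ = lam
    · subst hχ
      obtain ⟨c, hc⟩ := exists_smul_eq_of_mem_lieSpan hv (f χ : N).2 (isWeightVector_coe.mpr h4)
      have hc0 : c = 0 := by
        by_contra hc0
        refine hU ?_
        have h5 : (⟨v, hvN⟩ : N) = c⁻¹ • (f χ : N) := by
          ext1
          rw [LieSubmodule.coe_smul, hc, smul_smul, inv_mul_cancel₀ hc0, one_smul]
        rw [h5]
        exact SMulMemClass.smul_mem _ (f χ).2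
      have h6 : (f χ : N) = 0 := Subtype.ext (by rw [hc, hc0, zero_smul]; rfl)
      rw [h6]
      exact zero_mem _
    · exact h4.mem_weightSpan hχ
  have hvw : IsWeightVector b j lam (⟨v, hvN⟩ : N) := isWeightVector_coe.mp hv.1
  have hvK : (⟨v, hvN⟩ : N) ∉ K := by
    intro h
    refine hv0 (congrArg Subtype.val (eq_zero_of_mem_weightSpan (hKle h) hvw ?_))
    exact fun h ↦ h rfl
  have hcov : K ⋖ ⊤ := by
    refine ⟨lt_top_iff_ne_top.mpr fun h ↦ hvK (h ▸ LieSubmodule.mem_top _), fun U hKU hU ↦ ?_⟩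
    by_cases hvU : ⟨v, hvN⟩ ∈ U
    · exact hU.ne (htop U hvU)
    · exact hKU.not_ge (le_sSup hvU)
  refine ⟨N ⧸ K, inferInstance, inferInstance, inferInstance, inferInstance,
    isIrreducibleOfMaximalWeight_of_covBy hcov ((LieSubmodule.Quotient.mk' K).comp
      (LieSubmodule.incl ⊤)) ?_ (fun x ↦ LieSubmodule.Quotient.mk_eq_zero K)
      (LieSubmodule.mem_top _) hvK ⟨hvw, fun α hα x hx ↦ ?_⟩⟩
  · intro x
    obtain ⟨y, rfl⟩ := LieSubmodule.Quotient.surjective_mk' K x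
    exact ⟨⟨y, LieSubmodule.mem_top _⟩, rfl⟩
  · have h1 : ⁅x, (⟨v, hvN⟩ : N)⁆ = 0 := Subtype.ext ((Submodule.mem_bot ℂ).mp (hv.2 α hα x hx))
    rw [h1]
    exact zero_mem _

/-! ### Finite-dimensionality -/

theorem IsSl2Triple.exists_pow_ne_zero {L M : Type*} [LieRing L] [LieAlgebra ℂ L] [AddCommGroup M]
    [Module ℂ M] [LieRingModule L M] [LieModule ℂ L M] {h e f : L} (t : IsSl2Triple h e f) {w : M}
    (hw0 : w ≠ 0) {n : ℕ} (hw : ⁅h, w⁆ = (n : ℂ) • w)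
    (he : ∃ k, (LieModule.toEnd ℂ L M e ^ k) w = 0) :
    ∃ k, (LieModule.toEnd ℂ L M f ^ (n + k)) ((LieModule.toEnd ℂ L M e ^ k) w) ≠ 0 := by
  obtain ⟨k, hk, hk'⟩ := Nat.exists_not_and_succ_of_not_zero_of_exists
    (p := fun k ↦ (LieModule.toEnd ℂ L M e ^ k) w = 0) (by simpa using hw0) he
  have P : t.HasPrimitiveVectorWith ((LieModule.toEnd ℂ L M e ^ k) w) ((n + 2 * k : ℕ) : ℂ) := by
    refine ⟨hk, ?_, ?_⟩
    · rw [t.lie_h_pow_toEnd_e hw]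
      push_cast
      rfl
    · rw [← hk', pow_succ', Module.End.mul_apply, LieModule.toEnd_apply_apply]
  exact ⟨k, P.pow_toEnd_f_ne_zero_of_eq_nat rfl (by lia)⟩

section Levi

variable {V : Type*} [AddCommGroup V] [Module ℂ V] [LieRingModule (parabolic b j) V]
  [LieModule ℂ (parabolic b j) V]

theorem IsWeightVector.pow_root {χ : Dual ℂ H} {w : V} (hw : IsWeightVector b j χ w)
    {α : H.root} {x : parabolic b j} (hx : IsRootVector b j α x) (k : ℕ) :
    IsWeightVector b j (χ + k • (rootSystem H).root α)
      ((LieModule.toEnd ℂ (parabolic b j) V x ^ k) w) := by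
  induction k with
  | zero => simpa using hw
  | succ k ih =>
    rw [pow_succ', succ_nsmul, ← add_assoc]
    exact ih.lie_root hx

/-- The simple root `α_i` is the only positive root that can be subtracted from its multiples. -/
theorem eq_of_nsmul_sub_mem_posCone {α : H.root} (hα : b.IsPos α) {i : b.support} {k : ℕ}
    (h : k • (rootSystem H).root i - (rootSystem H).root α ∈ posCone b) : α = i := by
  classical
  have hα' := isPos_iff_mem_posCone.mp hα
  have h1 : ∀ l, l ≠ i → coeffForm b l ((rootSystem H).root α) = 0 := by
    intro l hl
    obtain ⟨m, hm⟩ := exists_coeffForm_eq_nat hα' l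
    obtain ⟨n, hn⟩ := exists_coeffForm_eq_nat h l
    rw [map_sub, map_nsmul, coeffForm_root, if_neg hl.symm, smul_zero, hm, zero_sub] at hn
    have h2 : -(m : ℤ) = n := by exact_mod_cast hn
    rw [hm, show m = 0 by lia, Nat.cast_zero]
  obtain ⟨m, hm⟩ := exists_coeffForm_eq_nat hα' i
  have h2 : (rootSystem H).root α = (m : ℂ) • (rootSystem H).root i := by
    refine b.toWeightBasis.ext_elem fun l ↦ ?_
    change coeffForm b l _ = coeffForm b l _
    rw [map_smul, coeffForm_root]
    split_ifs with hl
    · rw [← hl, hm, smul_eq_mul, mul_one]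
    · rw [h1 l (Ne.symm hl), smul_zero]
  by_contra hne
  have h3 : (rootSystem H).root α ≠ -(rootSystem H).root i := by
    intro h4
    rw [h4, map_neg, coeffForm_root, if_pos rfl] at hm
    have h5 : (-1 : ℤ) = m := by exact_mod_cast hm
    lia
  have h4 := RootPairing.IsReduced.linearIndependent (rootSystem H) hne h3
  rw [LinearIndependent.pair_iff] at h4
  have h5 := h4 1 (-(m : ℂ)) (by rw [one_smul, neg_smul, ← h2, add_neg_cancel])
  exact one_ne_zero h5.1

theorem nsmul_root_notMem_posCone {i : b.support} (k : ℕ)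
    (h : -((k + 1) • (rootSystem H).root i) ∈ posCone b) : False := by
  have h1 := eq_zero_of_mem_posCone_of_neg_mem (nsmul_mem (root_mem_posCone i) (k + 1)) h
  exact root_ne_zero _ ((smul_eq_zero.mp h1).resolve_left (Nat.succ_ne_zero k))

variable {lam : Dual ℂ H}

/-- If the maximal weight is dominant for the Levi part then the root vectors of the simple roots of
the Levi part and of their negatives act nilpotently on each vector. -/
theorem IsIrreducibleOfMaximalWeight.exists_pow_eq_zero
    (hV : IsIrreducibleOfMaximalWeight b j V lam)
    {i : b.support} {m : ℕ} (hm : lam ((rootSystem H).coroot i) = m)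
    {e f : parabolic b j} (t : IsSl2Triple (cartanIncl b j ((rootSystem H).coroot i)) e f)
    (he : IsRootVector b j i e) {α' : H.root} (hf : IsRootVector b j α' f)
    (hα' : (rootSystem H).root α' = -(rootSystem H).root i) (w : V) :
    ∃ k, (LieModule.toEnd ℂ (parabolic b j) V f ^ k) w = 0 := by
  have hirr := hV.irreducible
  obtain ⟨v, hv0, hv⟩ := hV.exists_maximal_vector
  have P : t.HasPrimitiveVectorWith v (m : ℂ) :=
    ⟨hv0, by rw [← hm]; exact isWeightVector_iff.mp hv.1 _,
      hv.2 i (b.isPos_of_mem_support i.2) e he⟩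
  let u := (LieModule.toEnd ℂ (parabolic b j) V f ^ (m + 1)) v
  have hu : IsWeightVector b j (lam - (m + 1) • (rootSystem H).root i) u := by
    have := IsWeightVector.pow_root hv.1 hf (m + 1)
    rwa [hα', smul_neg, ← sub_eq_add_neg] at this
  have hu0 : u = 0 := by
    by_contra hu0
    have hmax : IsMaximalMod b j (⊥ : Submodule ℂ V) (lam - (m + 1) • (rootSystem H).root i) u := by
      refine ⟨hu, fun α hα x hx ↦ ?_⟩
      rw [Submodule.mem_bot]
      by_contra hne
      have h1 := (hV.coeffForm_eq (hu.lie_root hx) hne).1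
      rw [← sub_sub, sub_sub_cancel] at h1
      obtain rfl := eq_of_nsmul_sub_mem_posCone hα h1
      obtain ⟨c, rfl⟩ := hx.exists_eq_smul he t.e_ne_zero
      refine hne ?_
      rw [smul_lie, P.lie_e_pow_succ_toEnd_f, sub_self, mul_zero, zero_smul, smul_zero]
    have h1 := sub_mem_posCone_of_mem_lieSpan hmax
      (lieSpan_eq_top (b := b) (j := j) hu0 ▸ LieSubmodule.mem_top v) hv.1 hv0
    rw [sub_sub_cancel_left] at h1
    exact nsmul_root_notMem_posCone m h1
  let U : LieSubmodule ℂ (parabolic b j) V :=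
    { (LieModule.toEnd ℂ (parabolic b j) V f).maxGenEigenspace 0 with
      lie_mem := by
        intro x w hw
        have h1 : x ∈ (LieModule.toEnd ℂ (parabolic b j) (parabolic b j) f).maxGenEigenspace 0 := by
          obtain ⟨k, hk⟩ := LieAlgebra.isNilpotent_ad_of_mem_rootSpace H (x := (f : 𝔤))
            (LieSubalgebra.isNonZero_coe_root α') hf
          rw [Module.End.mem_maxGenEigenspace]
          refine ⟨k, ?_⟩
          rw [zero_smul, sub_zero]
          have h2 : ∀ n, (((LieModule.toEnd ℂ (parabolic b j) (parabolic b j) f ^ n) x :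
              parabolic b j) : 𝔤) = (LieAlgebra.ad ℂ 𝔤 (f : 𝔤) ^ n) x := by
            intro n
            induction n with
            | zero => rfl
            | succ n ih =>
              rw [pow_succ', pow_succ', Module.End.mul_apply, Module.End.mul_apply, ← ih]
              rfl
          ext1
          rw [h2, hk]
          rfl
        have := LieModule.lie_mem_maxGenEigenspace_toEnd h1 hw
        rwa [add_zero] at this }
  have hU : U = ⊤ := by
    rw [eq_top_iff, ← lieSpan_eq_top hv0, LieSubmodule.lieSpan_le, Set.singleton_subset_iff]
    refine (Module.End.mem_maxGenEigenspace _ _ _).mpr ⟨m + 1, ?_⟩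
    rw [zero_smul, sub_zero]
    exact hu0
  have hw : w ∈ U := hU ▸ LieSubmodule.mem_top w
  obtain ⟨k, hk⟩ := (Module.End.mem_maxGenEigenspace _ _ _).mp hw
  rw [zero_smul, sub_zero] at hk
  exact ⟨k, hk⟩

/-- The set of weights is invariant under the simple reflections of the Levi part. -/
theorem IsIrreducibleOfMaximalWeight.exists_reflection (hV : IsIrreducibleOfMaximalWeight b j V lam)
    {i : b.support} (hi : i ≠ j) {m : ℕ} (hm : lam ((rootSystem H).coroot i) = m)
    {χ : Dual ℂ H} {w : V} (hw : IsWeightVector b j χ w) (hw0 : w ≠ 0) :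
    ∃ w' : V, w' ≠ 0 ∧ IsWeightVector b j ((rootSystem H).reflection i χ) w' := by
  classical
  obtain ⟨e, f, α', t, he, hf, hα'⟩ := exists_isSl2Triple hi
  have hχ := (hV.coeffForm_eq hw hw0).1
  obtain ⟨n, hn⟩ : ∃ n : ℤ, χ ((rootSystem H).coroot i) = n := by
    obtain ⟨n, hn⟩ := mem_weightLattice_iff.mp
      (rootLattice_le_weightLattice (posCone_le_rootLattice hχ)) i
    refine ⟨m - n, ?_⟩
    rw [LinearMap.sub_apply, hm] at hn
    push_cast
    linear_combination -hn
  have hr : (rootSystem H).reflection i χ = χ - n • (rootSystem H).root i := by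
    rw [RootPairing.reflection_apply, ← Int.cast_smul_eq_zsmul ℂ, ← hn]
    rfl
  have hweight : ∀ p q : ℕ, (p : ℤ) - q = -n →
      (rootSystem H).reflection i χ =
        χ + p • (rootSystem H).root i + q • (rootSystem H).root α' := by
    intro p q h
    rw [hr, hα', show n = (q : ℤ) - p by lia, sub_smul, natCast_zsmul, natCast_zsmul, smul_neg]
    abel
  rcases le_total 0 n with h0 | h0
  · obtain ⟨n, rfl⟩ := Int.eq_ofNat_of_zero_le h0
    have hnil : ∃ k, (LieModule.toEnd ℂ (parabolic b j) V e ^ k) w = 0 := by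
      obtain ⟨c, hc⟩ := exists_coeffForm_eq_nat hχ i
      refine ⟨c + 1, ?_⟩
      by_contra hne
      obtain ⟨c', hc'⟩ := exists_coeffForm_eq_nat (hV.coeffForm_eq (hw.pow_root he _) hne).1 i
      rw [← sub_sub, map_sub, hc, map_nsmul, coeffForm_root, if_pos rfl, nsmul_one] at hc'
      have : (c : ℤ) - (c + 1 : ℕ) = c' := by exact_mod_cast hc'
      lia
    obtain ⟨k, hk⟩ := IsSl2Triple.exists_pow_ne_zero t hw0 (n := n)
      (by rw [hw.lie_cartan, hn]; rfl) hnil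
    exact ⟨_, hk, hweight k (n + k) (by push_cast; ring) ▸ (hw.pow_root he k).pow_root hf (n + k)⟩
  · obtain ⟨n', rfl⟩ := Int.exists_eq_neg_ofNat h0
    obtain ⟨k, hk⟩ := IsSl2Triple.exists_pow_ne_zero t.symm hw0 (n := n')
      (by rw [neg_lie, hw.lie_cartan, hn, ← neg_smul]; simp)
      (hV.exists_pow_eq_zero hm t he hf hα' w)
    refine ⟨_, hk, ?_⟩
    rw [hweight (n' + k) k (by push_cast; ring), add_right_comm]
    exact (hw.pow_root hf k).pow_root he (n' + k)

end Levi

/-! ### Averaging over the Weyl group of the Levi part -/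

variable (b j) in
/-- The Weyl group of the Levi part of `𝔭`. -/
noncomputable def leviWeylGroup : Subgroup (Dual ℂ H ≃ₗ[ℂ] Dual ℂ H) :=
  Subgroup.closure {g | ∃ i : b.support, i ≠ j ∧ g = (rootSystem H).reflection i}

instance : Finite (leviWeylGroup b j) := by
  have h1 : ∀ g ∈ leviWeylGroup b j, ∀ α : H.root, ∃ β : H.root,
      g ((rootSystem H).root α) = (rootSystem H).root β := by
    intro g hg
    induction hg using Subgroup.closure_induction'' with
    | one => exact fun α ↦ ⟨α, rfl⟩
    | mem g hg =>
      obtain ⟨i, -, rfl⟩ := hg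
      exact fun α ↦ ⟨_, ((rootSystem H).root_reflectionPerm i α).symm⟩
    | inv_mem g hg =>
      obtain ⟨i, -, rfl⟩ := hg
      rw [RootPairing.reflection_inv]
      exact fun α ↦ ⟨_, ((rootSystem H).root_reflectionPerm i α).symm⟩
    | mul g g' _ _ hg hg' =>
      intro α
      obtain ⟨β, hβ⟩ := hg' α
      obtain ⟨γ, hγ⟩ := hg β
      exact ⟨γ, by rw [LinearEquiv.mul_apply, hβ, hγ]⟩
  choose F hF using fun g : leviWeylGroup b j ↦ h1 g.1 g.2
  refine Finite.of_injective F fun g g' hgg ↦ ?_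
  ext1
  refine b.toWeightBasis.ext' fun i ↦ ?_
  rw [b.toWeightBasis_apply]
  exact (hF g i).trans ((congrArg (rootSystem H).root (congrFun hgg i)).trans (hF g' i).symm)

noncomputable instance : Fintype (leviWeylGroup b j) := Fintype.ofFinite _

variable (b j) in
/-- The sum of the elements of the Weyl group of the Levi part. -/
noncomputable def leviSum : Dual ℂ H →ₗ[ℂ] Dual ℂ H :=
  ∑ g : leviWeylGroup b j, (g : Dual ℂ H ≃ₗ[ℂ] Dual ℂ H).toLinearMap

theorem leviSum_root {i : b.support} (hi : i ≠ j) :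
    leviSum b j ((rootSystem H).root i) = 0 := by
  let s : leviWeylGroup b j := ⟨(rootSystem H).reflection i, Subgroup.subset_closure ⟨i, hi, rfl⟩⟩
  have h1 : leviSum b j (s.1 ((rootSystem H).root i)) = leviSum b j ((rootSystem H).root i) := by
    rw [leviSum, LinearMap.sum_apply, LinearMap.sum_apply]
    exact Equiv.sum_comp (Equiv.mulRight s) fun g : leviWeylGroup b j ↦ g.1 ((rootSystem H).root i)
  have h2 : s.1 ((rootSystem H).root i) = -(rootSystem H).root i :=
    (rootSystem H).reflection_apply_self i
  rw [h2, map_neg] at h1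
  have : IsAddTorsionFree (Dual ℂ H) := .of_isTorsionFree ℂ _
  exact self_eq_neg.mp h1.symm

theorem leviSum_eq_zero {χ : Dual ℂ H} (h : coeffForm b j χ = 0) : leviSum b j χ = 0 := by
  rw [← b.toWeightBasis.sum_repr χ, map_sum]
  refine Finset.sum_eq_zero fun i _ ↦ ?_
  rw [map_smul, b.toWeightBasis_apply]
  by_cases hi : i = j
  · subst hi
    have : b.toWeightBasis.repr χ i = 0 := h
    rw [this, zero_smul]
  · rw [leviSum_root hi, smul_zero]

section

variable {V : Type*} [AddCommGroup V] [Module ℂ V] [LieRingModule (parabolic b j) V]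
  [LieModule ℂ (parabolic b j) V] {lam : Dual ℂ H}

/-- The heights of `lam - χ` are bounded if `χ` runs over the weights of an irreducible module whose
maximal weight `lam` is dominant for the Levi part: the sum of `lam - g χ` over the Weyl group of
the Levi part does not depend on `χ`. -/
theorem IsIrreducibleOfMaximalWeight.exists_height_le (hV : IsIrreducibleOfMaximalWeight b j V lam)
    (hlam : ∀ i : b.support, i ≠ j → ∃ m : ℕ, lam ((rootSystem H).coroot i) = m) :
    ∃ N : ℕ, ∀ (χ : Dual ℂ H) (w : V), IsWeightVector b j χ w → w ≠ 0 →
      ∀ n : ℕ, heightForm b (lam - χ) = n → n ≤ N := by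
  classical
  have h1 : ∀ g ∈ leviWeylGroup b j, ∀ (χ : Dual ℂ H) (w : V), IsWeightVector b j χ w → w ≠ 0 →
      ∃ w' : V, IsWeightVector b j (g χ) w' ∧ w' ≠ 0 := by
    intro g hg
    have hs : ∀ i : b.support, i ≠ j → ∀ (χ : Dual ℂ H) (w : V), IsWeightVector b j χ w → w ≠ 0 →
        ∃ w' : V, IsWeightVector b j ((rootSystem H).reflection i χ) w' ∧ w' ≠ 0 := by
      intro i hi χ w hw hw0
      obtain ⟨m, hm⟩ := hlam i hi
      obtain ⟨w', h0, h⟩ := hV.exists_reflection hi hm hw hw0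
      exact ⟨w', h, h0⟩
    induction hg using Subgroup.closure_induction'' with
    | one => exact fun χ w hw hw0 ↦ ⟨w, hw, hw0⟩
    | mem g hg =>
      obtain ⟨i, hi, rfl⟩ := hg
      exact hs i hi
    | inv_mem g hg =>
      obtain ⟨i, hi, rfl⟩ := hg
      rw [RootPairing.reflection_inv]
      exact hs i hi
    | mul g g' _ _ hg hg' =>
      intro χ w hw hw0
      obtain ⟨w', h, h0⟩ := hg' χ w hw hw0
      exact hg _ w' h h0
  let κ : Dual ℂ H := Fintype.card (leviWeylGroup b j) • lam - leviSum b j lam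
  have hκ : ∀ χ (w : V), IsWeightVector b j χ w → w ≠ 0 →
      (∀ g : leviWeylGroup b j, lam - g.1 χ ∈ posCone b) ∧
        κ = ∑ g : leviWeylGroup b j, (lam - g.1 χ) := by
    intro χ w hw hw0
    refine ⟨fun g ↦ ?_, ?_⟩
    · obtain ⟨w', h, h0⟩ := h1 g.1 g.2 χ w hw hw0
      exact (hV.coeffForm_eq h h0).1
    · have h2 := leviSum_eq_zero (hV.coeffForm_eq hw hw0).2
      rw [map_sub, sub_eq_zero] at h2
      rw [Finset.sum_sub_distrib, Finset.sum_const, Finset.card_univ]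
      simp only [κ]
      rw [h2, leviSum, LinearMap.sum_apply]
      rfl
  obtain ⟨v, hv0, hv⟩ := hV.exists_maximal_vector
  obtain ⟨h2, h3⟩ := hκ lam v hv.1 hv0
  obtain ⟨N, hN⟩ := exists_heightForm_eq_nat (b := b) (h3 ▸ sum_mem fun g _ ↦ h2 g : κ ∈ posCone b)
  refine ⟨N, fun χ w hw hw0 n hn ↦ ?_⟩
  obtain ⟨h4, h5⟩ := hκ χ w hw hw0
  obtain ⟨m, hm⟩ := exists_heightForm_eq_nat (b := b)
    (sum_mem fun g (_ : g ∈ Finset.univ.erase (1 : leviWeylGroup b j)) ↦ h4 g)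
  rw [← Finset.add_sum_erase _ _ (Finset.mem_univ (1 : leviWeylGroup b j))] at h5
  have h6 := congrArg (heightForm b) h5
  rw [map_add, hm, hN] at h6
  have h7 : (1 : leviWeylGroup b j).1 χ = χ := rfl
  rw [h7, hn] at h6
  have : N = n + m := by exact_mod_cast h6
  lia

variable (b j) in
/-- The span of the root vectors of the negative roots. -/
noncomputable def negPart : Submodule ℂ (parabolic b j) :=
  Submodule.span ℂ {x | ∃ α : H.root, ¬ b.IsPos α ∧ IsRootVector b j α x}

variable (b j) in
/-- The span of the products `y_1 ⋯ y_k v` of exactly `k` negative root vectors with `v`. -/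
noncomputable def negPower (v : V) : ℕ → Submodule ℂ V
  | 0 => Submodule.span ℂ {v}
  | k + 1 => Submodule.map₂ (LieModule.toEnd ℂ (parabolic b j) V : _ →ₗ[ℂ] _) (negPart b j)
      (negPower v k)

theorem fg_negPower (v : V) (k : ℕ) : (negPower b j v k).FG := by
  induction k with
  | zero => exact Submodule.fg_span_singleton v
  | succ k ih =>
    have : FiniteDimensional ℂ (parabolic b j) :=
      inferInstanceAs (FiniteDimensional ℂ (parabolic b j).toSubmodule)
    exact Submodule.FG.map₂ _ (IsNoetherian.noetherian _) ih

theorem negPower_le_weightSpan {v : V} (hv : IsWeightVector b j lam v) (k : ℕ) :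
    negPower b j v k ≤ weightSpan b j V {χ | ∃ n ≥ k, heightForm b (lam - χ) = (n : ℕ)} := by
  induction k with
  | zero =>
    rw [negPower, Submodule.span_le, Set.singleton_subset_iff]
    exact hv.mem_weightSpan ⟨0, le_rfl, by rw [sub_self, map_zero, Nat.cast_zero]⟩
  | succ k ih =>
    rw [negPower, Submodule.map₂_le]
    intro x hx w hw
    have hw' := ih hw
    clear hw
    induction hx using Submodule.span_induction with
    | zero => rw [map_zero]; exact zero_mem _
    | add x y _ _ hx hy => rw [map_add]; exact add_mem hx hy
    | smul c x _ hx => rw [map_smul]; exact Submodule.smul_mem _ c hx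
    | mem x hx =>
      obtain ⟨α, hα, hx⟩ := hx
      induction hw' using Submodule.span_induction with
      | zero => rw [map_zero]; exact zero_mem _
      | add x y _ _ hx hy => rw [map_add]; exact add_mem hx hy
      | smul c x _ hx => rw [map_smul]; exact Submodule.smul_mem _ c hx
      | mem w hw =>
        obtain ⟨χ, ⟨n, hn, hχ⟩, hw⟩ := hw
        obtain ⟨m, hm⟩ := exists_heightForm_eq_nat (neg_root_mem_posCone hα)
        refine (hw.lie_root hx).mem_weightSpan ⟨n + m, ?_, ?_⟩
        · have h0 : b.height α ≠ 0 := RootPairing.Base.height_ne_zero b α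
          have h1 : heightForm b (-(rootSystem H).root α) = (-b.height α : ℤ) := by
            rw [map_neg, heightForm_eq_height, Int.cast_neg]
          rw [hm] at h1
          have h2 : (m : ℤ) = -b.height α := by exact_mod_cast h1
          lia
        · rw [← sub_sub, sub_eq_add_neg (lam - χ), map_add, hχ, hm, Nat.cast_add]

theorem negFiltration_le_iSup (v : V) (k : ℕ) :
    negFiltration (b := b) (j := j) v k ≤ ⨆ n, negPower b j v n := by
  induction k with
  | zero => exact le_iSup (negPower b j v) 0
  | succ k ih =>
    refine sup_le ih (Submodule.span_le.mpr ?_)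
    rintro _ ⟨α, hα, x, hx, w, hw, rfl⟩
    have hw' := ih hw
    clear hw
    induction hw' using Submodule.iSup_induction' with
    | mem n w hw =>
      exact Submodule.mem_iSup_of_mem (n + 1)
        (Submodule.apply_mem_map₂ _ (Submodule.subset_span ⟨α, hα, hx⟩) hw)
    | zero => rw [lie_zero]; exact zero_mem _
    | add w w' _ _ hw hw' => rw [lie_add]; exact add_mem hw hw'

theorem IsIrreducibleOfMaximalWeight.finiteDimensional (hV : IsIrreducibleOfMaximalWeight b j V lam)
    (hlam : ∀ i : b.support, i ≠ j → ∃ m : ℕ, lam ((rootSystem H).coroot i) = m) :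
    FiniteDimensional ℂ V := by
  obtain ⟨N, hN⟩ := hV.exists_height_le hlam
  have hirr := hV.irreducible
  obtain ⟨v, hv0, hv⟩ := hV.exists_maximal_vector
  have h1 : ∀ k, N < k → negPower b j v k = ⊥ := by
    intro k hk
    rw [eq_bot_iff]
    intro w hw
    have h2 := negPower_le_weightSpan hv.1 k hw
    clear hw
    rw [Submodule.mem_bot]
    induction h2 using Submodule.span_induction with
    | zero => rfl
    | add x y _ _ hx hy => rw [hx, hy, add_zero]
    | smul c x _ hx => rw [hx, smul_zero]
    | mem w hw =>
      obtain ⟨χ, ⟨n, hn, hχ⟩, hw⟩ := hw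
      by_contra h0
      have := hN χ w hw h0 n hχ
      lia
  have h2 : ⨆ n : Fin (N + 1), negPower b j v n = ⊤ := by
    rw [eq_top_iff]
    intro w _
    obtain ⟨k, hk⟩ := (mem_lieSpan_iff hv).mp
      (lieSpan_eq_top (b := b) (j := j) hv0 ▸ LieSubmodule.mem_top w)
    have h3 : ⨆ n, negPower b j v n ≤ ⨆ n : Fin (N + 1), negPower b j v n := by
      refine iSup_le fun n ↦ ?_
      rcases lt_or_ge N n with h | h
      · rw [h1 n h]
        exact bot_le
      · exact le_iSup (fun n : Fin (N + 1) ↦ negPower b j v n) ⟨n, by lia⟩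
    exact h3 (negFiltration_le_iSup v k hk)
  have : ∀ n : Fin (N + 1), FiniteDimensional ℂ (negPower b j v n) := fun n ↦
    Module.Finite.iff_fg.mpr (fg_negPower v n)
  have h3 : FiniteDimensional ℂ (⨆ n : Fin (N + 1), negPower b j v n : Submodule ℂ V) :=
    Submodule.finiteDimensional_iSup _
  rw [h2] at h3
  exact Module.Finite.of_surjective (Submodule.subtype ⊤) fun w ↦ ⟨⟨w, trivial⟩, rfl⟩

end

/-- Each point of the quiver is the maximal weight of an irreducible representation of `P`. -/
theorem exists_irreducible [(rootSystem H).IsIrreducible] {lam : Dual ℂ H}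
    (hlam : lam ∈ weightLattice b)
    (hdom : ∀ i : b.support, i ≠ j → ∃ m : ℕ, lam ((rootSystem H).coroot i) = m) :
    ∃ (V : Type) (_ : AddCommGroup V) (_ : Module ℂ V) (_ : LieRingModule (parabolic b j) V)
      (_ : LieModule ℂ (parabolic b j) V), FiniteDimensional ℂ V ∧
      weightSpan b j V (weightLattice b) = ⊤ ∧ IsIrreducibleOfMaximalWeight b j V lam := by
  obtain ⟨V, i1, i2, i3, i4, hV⟩ := exists_isIrreducibleOfMaximalWeight (b := b) (j := j) lam
  refine ⟨V, i1, i2, i3, i4, hV.finiteDimensional hdom, ?_, hV⟩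
  refine top_le_iff.mp (hV.weightSpan_eq_top.ge.trans (weightSpan_mono fun χ hχ ↦ ?_))
  have := sub_mem hlam (rootLattice_le_weightLattice (posCone_le_rootLattice hχ))
  rwa [sub_sub_cancel] at this

/-! ### The index of the root lattice -/

theorem relIndex_eq_natAbs_cartanDet :
    (rootLattice b).relIndex (weightLattice b) = (cartanDet b).natAbs := by
  classical
  have hw : b.toCoweightBasis.dualBasis = fundamentalWeight b := by
    ext i : 1
    rw [Basis.coe_dualBasis]
    rfl
  let B₁ := b.toWeightBasis.addSubgroupOfClosure (rootLattice b) (by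
    rw [rootLattice]
    congr 2
    ext i : 1
    exact (b.toWeightBasis_apply i).symm)
  let B₂ := b.toCoweightBasis.dualBasis.addSubgroupOfClosure (weightLattice b) (by
    rw [hw, weightLattice])
  rw [AddSubgroup.relIndex_eq_natAbs_det _ _ rootLattice_le_weightLattice B₁ B₂, Basis.det_apply,
    cartanDet, ← Matrix.det_transpose]
  congr 2
  ext i k
  rw [Matrix.transpose_apply, Basis.toMatrix_apply]
  have h1 := Basis.addSubgroupOfClosure_repr_apply (weightLattice b) b.toCoweightBasis.dualBasis
    (by rw [hw, weightLattice]) ⟨B₁ i, rootLattice_le_weightLattice (SetLike.coe_mem _)⟩ k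
  rw [Basis.dualBasis_repr, b.toCoweightBasis_apply] at h1
  have h3 : (B₁ i : Dual ℂ H) = (rootSystem H).root i := by
    rw [Basis.addSubgroupOfClosure_apply, b.toWeightBasis_apply]
  have h2 : algebraMap ℤ ℂ (b.cartanMatrix i k) =
      (rootSystem H).root i ((rootSystem H).coroot k) :=
    (rootSystem H).algebraMap_pairingIn ℤ i k
  exact Int.cast_injective (α := ℂ) (h1.trans
    ((congrArg (fun χ : Dual ℂ H ↦ χ ((rootSystem H).coroot k)) h3).trans h2.symm))

/-- Integral matrices that are positive definite over `ℤ` have positive determinant. -/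
theorem det_pos_of_posDef_int {n : Type*} [Fintype n] [DecidableEq n] {M : Matrix n n ℤ}
    (hM : M.PosDef) : 0 < M.det := by
  have h0 : M.det ≠ 0 := by
    intro h
    obtain ⟨v, hv, h⟩ := Matrix.exists_mulVec_eq_zero_iff.mpr h
    have := hM.dotProduct_mulVec_pos hv
    rw [h, dotProduct_zero] at this
    exact lt_irrefl _ this
  let M' : Matrix n n ℝ := M.map (Int.castRingHom ℝ)
  have h1 : M'.PosSemidef := by
    refine Matrix.PosSemidef.of_dotProduct_mulVec_nonneg ?_ fun x ↦ ?_
    · ext i k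
      have := congrArg (Int.castRingHom ℝ) (hM.1.apply i k)
      simpa [M'] using this
    · rw [star_trivial]
      -- by continuity it suffices to consider rational vectors
      have hd : DenseRange (Pi.map (fun (_ : n) (q : ℚ) ↦ (q : ℝ))) :=
        DenseRange.piMap fun _ ↦ Rat.denseRange_cast
      refine hd.induction_on (p := fun x : n → ℝ ↦ 0 ≤ x ⬝ᵥ (M' *ᵥ x)) x ?_ fun q ↦ ?_
      · exact isClosed_le continuous_const (by fun_prop)
      · obtain ⟨d, hd⟩ := IsLocalization.exist_integer_multiples_of_finite (nonZeroDivisors ℤ) q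
        choose z hz using hd
        have hz' : (fun i ↦ ((z i : ℤ) : ℝ)) =
            (d : ℤ) • Pi.map (fun (_ : n) (q : ℚ) ↦ (q : ℝ)) q := by
          ext i
          have := congrArg (fun q : ℚ ↦ (q : ℝ)) (hz i)
          simpa using this
        have hd0 : (0 : ℝ) < ((d : ℤ) : ℝ) ^ 2 :=
          sq_pos_of_ne_zero (Int.cast_ne_zero.mpr (nonZeroDivisors.coe_ne_zero d))
        have h2 : (0 : ℤ) ≤ z ⬝ᵥ (M *ᵥ z) := hM.posSemidef.dotProduct_mulVec_nonneg z
        have h3 : (0 : ℝ) ≤ ((z ⬝ᵥ (M *ᵥ z) : ℤ) : ℝ) := by exact_mod_cast h2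
        have h4 : ((z ⬝ᵥ (M *ᵥ z) : ℤ) : ℝ) =
            (fun i ↦ ((z i : ℤ) : ℝ)) ⬝ᵥ (M' *ᵥ fun i ↦ ((z i : ℤ) : ℝ)) := by
          simp [dotProduct, Matrix.mulVec, M']
        rw [h4, hz', ← Int.cast_smul_eq_zsmul ℝ, Matrix.mulVec_smul, smul_dotProduct,
          dotProduct_smul, smul_smul, ← sq, smul_eq_mul] at h3
        exact nonneg_of_mul_nonneg_right h3 hd0
  have h2 := h1.det_nonneg
  have h3 : M'.det = (M.det : ℝ) := ((Int.castRingHom ℝ).map_det M).symm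
  rw [h3] at h2
  exact lt_of_le_of_ne (by exact_mod_cast h2) h0.symm

theorem cartanDet_pos : 0 < cartanDet b := by
  classical
  obtain ⟨d, hd, hpos⟩ := b.exists_cartanMatrix_mul_diagaonal_posDef
  have h1 := det_pos_of_posDef_int hpos
  rw [Matrix.det_mul, Matrix.det_diagonal] at h1
  have h2 := pos_of_mul_pos_left h1 (Finset.prod_nonneg fun i _ ↦ (hd i).le)
  rw [cartanDet]
  convert h2

theorem relIndex_eq_cartanDet :
    ((rootLattice b).relIndex (weightLattice b) : ℤ) = cartanDet b := by
  rw [relIndex_eq_natAbs_cartanDet, Int.natCast_natAbs, abs_of_pos cartanDet_pos]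

/-! ### Arrows and cosets of the root lattice -/

theorem IsIrreducibleOfMaximalWeight.mem_weightLattice {V : Type*} [AddCommGroup V] [Module ℂ V]
    [LieRingModule (parabolic b j) V] [LieModule ℂ (parabolic b j) V] [FiniteDimensional ℂ V]
    {lam : Dual ℂ H} (hV : IsIrreducibleOfMaximalWeight b j V lam)
    (hw : weightSpan b j V (weightLattice b) = ⊤) :
    lam ∈ weightLattice b ∧
      ∀ i : b.support, i ≠ j → ∃ m : ℕ, lam ((rootSystem H).coroot i) = m := by
  obtain ⟨v, hv0, hv⟩ := hV.exists_maximal_vector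
  refine ⟨?_, fun i hi ↦ IsMaximalMod.exists_nat (isMaximalMod_bot_iff.mpr hv) hv0 i hi⟩
  by_contra h
  exact hv0 (eq_zero_of_mem_weightSpan (hw ▸ Submodule.mem_top) hv.1 h)

/-- The two ends of an arrow are points of the quiver, and belong to the same coset of the root
lattice: otherwise the decomposition of the weights into cosets splits the extension. -/
theorem ExtNeZero.sub_mem_rootLattice {lam μ : Dual ℂ H} (h : ExtNeZero b j lam μ) :
    lam - μ ∈ rootLattice b ∧
    (lam ∈ weightLattice b ∧
      ∀ i : b.support, i ≠ j → ∃ m : ℕ, lam ((rootSystem H).coroot i) = m) ∧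
    (μ ∈ weightLattice b ∧
      ∀ i : b.support, i ≠ j → ∃ m : ℕ, μ ((rootSystem H).coroot i) = m) := by
  obtain ⟨E, i1, i2, i3, i4, F, hfd, hint, hF, hEF, hsplit⟩ := h
  have hE : weightSpan b j E (weightLattice b) = ⊤ := hint
  have : FiniteDimensional ℂ (E ⧸ F) := inferInstanceAs (FiniteDimensional ℂ (E ⧸ F.toSubmodule))
  have hFw := weightSpan_sub_eq_top hE F
  have hEFw := weightSpan_eq_top_of_surjective hE _ (LieSubmodule.Quotient.surjective_mk' F)
  refine ⟨?_, hEF.mem_weightLattice hEFw, hF.mem_weightLattice hFw⟩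
  by_contra hc
  let A : Set (Dual ℂ H) := {χ | μ - χ ∈ rootLattice b}
  let F' : LieSubmodule ℂ (parabolic b j) E := weightSubmodule Aᶜ (by
    intro χ hχ α _ h
    refine hχ ?_
    have := add_mem (show μ - (χ + (rootSystem H).root α) ∈ rootLattice b from h)
      (root_mem_rootLattice α)
    rwa [← sub_sub, sub_add_cancel] at this)
  have h1 : F.toSubmodule ≤ weightSpan b j E A := by
    intro x hx
    have hx' : (⟨x, hx⟩ : F) ∈ weightSpan b j F {χ | μ - χ ∈ posCone b} :=
      hF.weightSpan_eq_top ▸ Submodule.mem_top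
    obtain ⟨s, f, hs, hf, -, h2⟩ := exists_sum_of_mem_weightSpan hx'
    have h3 : x = ∑ χ ∈ s, (f χ : E) := by
      have := congrArg Subtype.val h2
      rwa [AddSubmonoidClass.coe_finsetSum] at this
    rw [h3]
    exact sum_mem fun χ hχ ↦ IsWeightVector.mem_weightSpan (isWeightVector_coe.mpr (hf χ))
      (posCone_le_rootLattice (hs χ hχ))
  have h2 : weightSpan b j E A ≤ F.toSubmodule := by
    refine Submodule.span_le.mpr ?_
    rintro w ⟨χ, hχ, hw⟩
    change w ∈ F
    rw [← LieSubmodule.Quotient.mk_eq_zero']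
    have hw' : IsWeightVector b j χ (LieSubmodule.Quotient.mk' F w) := hw.map _
    refine eq_zero_of_mem_weightSpan (hEF.weightSpan_eq_top.symm ▸ Submodule.mem_top) hw' ?_
    intro h
    refine hc ?_
    have := sub_mem (posCone_le_rootLattice h) hχ
    rwa [sub_sub_sub_cancel_right] at this
  refine hsplit ⟨F', ?_, ?_⟩
  · rw [← LieSubmodule.disjoint_toSubmodule]
    exact (disjoint_weightSpan disjoint_compl_right).mono_left h1
  · rw [← LieSubmodule.codisjoint_toSubmodule, codisjoint_iff_le_sup]
    have h3 : weightSpan b j E A ⊔ weightSpan b j E Aᶜ ≤ F.toSubmodule ⊔ F'.toSubmodule :=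
      sup_le_sup h2 le_rfl
    refine le_trans ?_ h3
    rw [← hE]
    refine Submodule.span_le.mpr ?_
    rintro w ⟨χ, -, hw⟩
    by_cases hχ : χ ∈ A
    · exact Submodule.mem_sup_left (hw.mem_weightSpan hχ)
    · exact Submodule.mem_sup_right (hw.mem_weightSpan hχ)

/-! ### The connected components -/

/-- The maximal weights in the connected component of a point of the quiver. -/
def componentSet (x : QuiverOf b j) : Set (Dual ℂ H) :=
  {lam | ∃ h, Quiver.WeaklyConnectedComponent.mk (V := QuiverOf b j) ⟨lam, h⟩ =
    Quiver.WeaklyConnectedComponent.mk x}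

theorem isLinkClosed_componentSet (x : QuiverOf b j) : IsLinkClosed b j (componentSet x) := by
  intro lam μ h
  obtain ⟨-, hlam, hμ⟩ := h.sub_mem_rootLattice
  let e : Quiver.Hom (V := QuiverOf b j) ⟨lam, hlam⟩ ⟨μ, hμ⟩ := PLift.up h
  have h1 : Quiver.WeaklyConnectedComponent.mk (V := QuiverOf b j) ⟨lam, hlam⟩ =
      Quiver.WeaklyConnectedComponent.mk (V := QuiverOf b j) ⟨μ, hμ⟩ :=
    (Quiver.WeaklyConnectedComponent.eq _ _).mpr ⟨(Quiver.Hom.toPos e).toPath⟩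
  exact ⟨fun ⟨_, h⟩ ↦ ⟨hμ, h1.symm.trans h⟩, fun ⟨_, h⟩ ↦ ⟨hlam, h1.trans h⟩⟩

/-- Sums over sets of roots of `𝔫` that are closed under adding positive roots do not lead out of a
connected component. -/
theorem add_sum_mem_componentSet [(rootSystem H).IsIrreducible] (x : QuiverOf b j)
    {I : Finset H.root} (hI : ∀ γ ∈ I, coeff b j γ < 0)
    (hclosed : ∀ α : H.root, b.IsPos α → ∀ γ ∈ I, ∀ δ : H.root,
      (rootSystem H).root δ = (rootSystem H).root α + (rootSystem H).root γ →
      coeff b j δ < 0 → δ ∈ I) :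
    x.1 + ∑ γ ∈ I, (rootSystem H).root γ ∈ componentSet x := by
  have hS := isLinkClosed_componentSet x
  obtain ⟨V, i1, i2, i3, i4, hfd, hw, hV⟩ := exists_irreducible x.2.1 x.2.2
  obtain ⟨v, hv0, hv⟩ := hV.exists_maximal_vector
  have hv' := isMaximalMod_bot_iff.mpr hv
  have hirr := hV.irreducible
  have hVS : AllWeightsIn b j V (componentSet x) :=
    allWeightsIn_of_lieSpan_eq_top hw hS hv' ⟨x.2, rfl⟩ (lieSpan_eq_top hv0)
  obtain ⟨T, j1, j2, j3, j4, t, -, -, hTS, ht0, ht⟩ :=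
    exists_maximal_add_sum hS hw hVS hv0 hv' hI hclosed
  exact hTS ⊥ _ t ht fun h ↦ ht0 h

variable (b j) in
/-- The weights whose addition does not lead out of a connected component. -/
def shifts : AddSubmonoid (Dual ℂ H) where
  carrier := {τ | ∀ x : QuiverOf b j, x.1 + τ ∈ componentSet x}
  zero_mem' x := by
    rw [add_zero]
    exact ⟨x.2, rfl⟩
  add_mem' {τ τ'} hτ hτ' x := by
    obtain ⟨h, hx⟩ := hτ x
    obtain ⟨h', hx'⟩ := hτ' ⟨x.1 + τ, h⟩
    simp only [add_assoc] at h' hx'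
    exact ⟨h', hx'.trans hx⟩

theorem exists_shifts [(rootSystem H).IsIrreducible] {q : Dual ℂ H} (hq : q ∈ rootLattice b) :
    ∃ τ ∈ shifts b j, ∃ τ' ∈ shifts b j, q + τ' = τ := by
  rw [← closure_nilradical_roots (j := j)] at hq
  induction hq using AddSubgroup.closure_induction with
  | mem q hq =>
    obtain ⟨β, hβ, rfl⟩ := hq
    obtain ⟨I, J, hI, hJ, hIc, hJc, h⟩ := exists_closed_sets β hβ
    exact ⟨_, fun x ↦ add_sum_mem_componentSet x hJ hJc, _,
      fun x ↦ add_sum_mem_componentSet x hI hIc, h.symm⟩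
  | zero => exact ⟨0, zero_mem _, 0, zero_mem _, add_zero _⟩
  | add q q' _ _ hq hq' =>
    obtain ⟨τ, hτ, σ, hσ, h⟩ := hq
    obtain ⟨τ', hτ', σ', hσ', h'⟩ := hq'
    exact ⟨τ + τ', add_mem hτ hτ', σ + σ', add_mem hσ hσ', by rw [← h, ← h']; abel⟩
  | neg q _ hq =>
    obtain ⟨τ, hτ, σ, hσ, h⟩ := hq
    exact ⟨σ, hσ, τ, hτ, by rw [← h]; abel⟩

/-- Two points of the quiver are connected if and only if they are congruent modulo the root
lattice. -/
theorem mk_eq_mk_iff [(rootSystem H).IsIrreducible] (x y : QuiverOf b j) :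
    Quiver.WeaklyConnectedComponent.mk x = Quiver.WeaklyConnectedComponent.mk y ↔
      x.1 - y.1 ∈ rootLattice b := by
  constructor
  · intro h
    obtain ⟨p⟩ := (Quiver.WeaklyConnectedComponent.eq x y).mp h
    clear h
    induction p with
    | nil => rw [sub_self]; exact zero_mem _
    | cons _ e ih =>
      rw [← sub_add_sub_cancel]
      refine add_mem ih ?_
      rcases e with ⟨⟨e⟩⟩ | ⟨⟨e⟩⟩
      · exact e.sub_mem_rootLattice.1
      · rw [← neg_sub]
        exact neg_mem e.sub_mem_rootLattice.1
  · intro h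
    obtain ⟨τ, hτ, σ, hσ, h⟩ := exists_shifts (j := j) h
    obtain ⟨h1, hx⟩ := hσ x
    obtain ⟨h2, hy⟩ := hτ y
    rw [← hx, ← hy]
    refine congrArg _ (Subtype.ext ?_)
    change x.1 + σ = y.1 + τ
    rw [← h]
    abel

/-- Each coset of the root lattice contains a point of the quiver. -/
theorem exists_quiverOf_sub_mem {χ : Dual ℂ H} (hχ : χ ∈ weightLattice b) :
    ∃ x : QuiverOf b j, x.1 - χ ∈ rootLattice b := by
  classical
  have hd : (rootLattice b).relIndex (weightLattice b) ≠ 0 := by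
    intro h
    have := relIndex_eq_cartanDet (b := b)
    rw [h] at this
    exact cartanDet_pos.ne this
  set d := (rootLattice b).relIndex (weightLattice b)
  choose n hn using mem_weightLattice_iff.mp hχ
  have hρ : ∑ i, fundamentalWeight b i ∈ weightLattice b :=
    sum_mem fun i _ ↦ AddSubgroup.subset_closure ⟨i, rfl⟩
  let k := ∑ i, (n i).natAbs
  have hq : (d * k) • ∑ i, fundamentalWeight b i ∈ rootLattice b := by
    rw [mul_nsmul]
    exact nsmul_mem ((rootLattice b).nsmul_relIndex_mem hρ) k
  refine ⟨⟨χ + (d * k) • ∑ i, fundamentalWeight b i, add_mem hχ (nsmul_mem hρ _), fun i _ ↦ ?_⟩, ?_⟩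
  · refine ⟨(n i + d * k).toNat, ?_⟩
    have h1 : (0 : ℤ) ≤ n i + d * k := by
      have h2 : (n i).natAbs ≤ k := Finset.single_le_sum (f := fun i ↦ (n i).natAbs)
        (fun i _ ↦ Nat.zero_le _) (Finset.mem_univ i)
      have h3 : k ≤ d * k := Nat.le_mul_of_pos_left k (Nat.pos_of_ne_zero hd)
      have h4 : (k : ℤ) ≤ d * k := by exact_mod_cast h3
      lia
    rw [← Int.cast_natCast (R := ℂ), Int.toNat_of_nonneg h1, LinearMap.add_apply, hn,
      LinearMap.smul_apply, LinearMap.sum_apply]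
    simp_rw [fundamentalWeight_coroot]
    simp
  · change χ + _ - χ ∈ _
    rwa [add_sub_cancel_left]

theorem nonempty_components_equiv [(rootSystem H).IsIrreducible] :
    Nonempty (Components b j ≃
      weightLattice b ⧸ (rootLattice b).addSubgroupOf (weightLattice b)) := by
  have hF : ∀ x y : QuiverOf b j,
      (QuotientAddGroup.mk ⟨x.1, x.2.1⟩ : weightLattice b ⧸ (rootLattice b).addSubgroupOf _) =
        QuotientAddGroup.mk ⟨y.1, y.2.1⟩ ↔ x.1 - y.1 ∈ rootLattice b := by
    intro x y
    rw [QuotientAddGroup.eq_iff_sub_mem]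
    rfl
  let F : Components b j → weightLattice b ⧸ (rootLattice b).addSubgroupOf (weightLattice b) :=
    Quotient.lift (fun x : QuiverOf b j ↦ QuotientAddGroup.mk ⟨x.1, x.2.1⟩) fun x y h ↦
      (hF x y).mpr ((mk_eq_mk_iff x y).mp (Quotient.sound h))
  refine ⟨Equiv.ofBijective F ⟨fun c d ↦ ?_, fun c ↦ ?_⟩⟩
  · induction c using Quotient.inductionOn with | _ x
    induction d using Quotient.inductionOn with | _ y
    exact fun h ↦ (mk_eq_mk_iff x y).mpr ((hF x y).mp h)
  · obtain ⟨⟨χ, hχ⟩, rfl⟩ := QuotientAddGroup.mk_surjective c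
    obtain ⟨x, hx⟩ := exists_quiverOf_sub_mem (j := j) hχ
    exact ⟨Quiver.WeaklyConnectedComponent.mk x, QuotientAddGroup.eq_iff_sub_mem.mpr hx⟩

theorem card_components [(rootSystem H).IsIrreducible] :
    Nat.card (Components b j) = (rootLattice b).relIndex (weightLattice b) := by
  obtain ⟨e⟩ := nonempty_components_equiv (b := b) (j := j)
  exact Nat.card_congr e

theorem finite_components [(rootSystem H).IsIrreducible] : Finite (Components b j) := by
  refine Nat.finite_of_card_ne_zero ?_
  rw [card_components]
  intro h
  have := relIndex_eq_cartanDet (b := b)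
  rw [h] at this
  exact cartanDet_pos.ne this

/-! ### Determinants of the classical Cartan matrices -/

/-- Expansion of the determinant along a leaf of the Dynkin diagram. -/
theorem det_of_leaf {n : ℕ} (M : Matrix (Fin (n + 2)) (Fin (n + 2)) ℤ) (h00 : M 0 0 = 2)
    (h01 : M 0 1 = -1) (h10 : M 1 0 = -1) (hr : ∀ k : Fin n, M 0 k.succ.succ = 0)
    (hc : ∀ k : Fin n, M k.succ.succ 0 = 0) :
    M.det = 2 * (M.submatrix Fin.succ Fin.succ).det
      - ((M.submatrix Fin.succ Fin.succ).submatrix Fin.succ Fin.succ).det := by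
  rw [Matrix.det_succ_row_zero, Fin.sum_univ_succ, Fin.sum_univ_succ]
  have h0 : ∀ k : Fin n, (-1 : ℤ) ^ ((k.succ.succ : Fin (n + 2)) : ℕ) * M 0 k.succ.succ *
      (M.submatrix Fin.succ k.succ.succ.succAbove).det = 0 := fun k ↦ by
    rw [hr, mul_zero, zero_mul]
  rw [Finset.sum_eq_zero fun k _ ↦ h0 k, h00]
  have h1 : (M.submatrix Fin.succ (Fin.succ (0 : Fin (n + 1))).succAbove).det =
      -((M.submatrix Fin.succ Fin.succ).submatrix Fin.succ Fin.succ).det := by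
    rw [Matrix.det_succ_column_zero, Fin.sum_univ_succ, Finset.sum_eq_zero]
    · have : M.submatrix Fin.succ (Fin.succ (0 : Fin (n + 1))).succAbove 0 0 = -1 := h10
      rw [this]
      have h2 : (M.submatrix Fin.succ (Fin.succ (0 : Fin (n + 1))).succAbove).submatrix
          (Fin.succAbove 0) Fin.succ =
          (M.submatrix Fin.succ Fin.succ).submatrix Fin.succ Fin.succ := by
        ext i k
        simp [Matrix.submatrix_apply]
      rw [h2]
      simp
    · intro k _
      have : M.submatrix Fin.succ (Fin.succ (0 : Fin (n + 1))).succAbove k.succ 0 = 0 := hc k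
      rw [this, mul_zero, zero_mul]
  have h3 : M 0 (Fin.succ (0 : Fin (n + 1))) = -1 := h01
  rw [h1, h3]
  simp only [Fin.val_zero, pow_zero, one_mul, Fin.succAbove_zero, Fin.val_succ, zero_add, pow_one]
  ring

theorem det_cartanMatrix_A : ∀ n : ℕ, (CartanMatrix.A n).det = n + 1
  | 0 => by simp
  | 1 => by simp [CartanMatrix.A_one]
  | n + 2 => by
    have h1 : (CartanMatrix.A (n + 2)).submatrix Fin.succ Fin.succ = CartanMatrix.A (n + 1) := by
      ext i k
      simp [CartanMatrix.A]
    have h2 : (CartanMatrix.A (n + 1)).submatrix Fin.succ Fin.succ = CartanMatrix.A n := by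
      ext i k
      simp [CartanMatrix.A]
    rw [det_of_leaf _ (by simp [CartanMatrix.A]) (by simp [CartanMatrix.A])
      (by simp [CartanMatrix.A]) (fun k ↦ by simp [CartanMatrix.A, Fin.ext_iff])
      (fun k ↦ by simp [CartanMatrix.A, Fin.ext_iff]), h1, h2, det_cartanMatrix_A (n + 1),
      det_cartanMatrix_A n]
    push_cast
    ring

theorem det_cartanMatrix_C : ∀ n : ℕ, (CartanMatrix.C (n + 1)).det = 2
  | 0 => by simp [CartanMatrix.C]
  | 1 => by simp [CartanMatrix.C_two, Matrix.det_fin_two]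
  | n + 2 => by
    have h (m : ℕ) :
        (CartanMatrix.C (m + 2)).submatrix Fin.succ Fin.succ = CartanMatrix.C (m + 1) := by
      ext i k
      simp only [CartanMatrix.C, Matrix.submatrix_apply, Matrix.of_apply]
      grind
    rw [det_of_leaf]
    · rw [h, h, det_cartanMatrix_C (n + 1), det_cartanMatrix_C n]
      norm_num
    all_goals
      intros
      simp only [CartanMatrix.C, Matrix.of_apply, Fin.ext_iff, Fin.val_zero, Fin.val_one,
        Fin.val_succ]
      split_ifs <;> lia

theorem det_cartanMatrix_B (n : ℕ) : (CartanMatrix.B (n + 1)).det = 2 := by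
  rw [← CartanMatrix.C_transpose, Matrix.det_transpose, det_cartanMatrix_C]

theorem det_cartanMatrix_D : ∀ n : ℕ, (CartanMatrix.D (n + 2)).det = 4
  | 0 => by simp [CartanMatrix.D_two, Matrix.det_fin_two]
  | 1 => by simp [CartanMatrix.D_three, Matrix.det_fin_three]
  | n + 2 => by
    have h (m : ℕ) (hm : 2 ≤ m) :
        (CartanMatrix.D (m + 1)).submatrix Fin.succ Fin.succ = CartanMatrix.D m := by
      ext i k
      simp only [CartanMatrix.D, Matrix.submatrix_apply, Matrix.of_apply, Fin.ext_iff,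
        Fin.val_succ]
      split_ifs <;> lia
    rw [det_of_leaf]
    · rw [h _ (by lia), h _ (by lia), det_cartanMatrix_D (n + 1), det_cartanMatrix_D n]
      norm_num
    all_goals
      intros
      simp only [CartanMatrix.D, Matrix.of_apply, Fin.ext_iff, Fin.val_zero, Fin.val_one,
        Fin.val_succ]
      split_ifs <;> lia

theorem HasType.cartanDet_eq {n k : ℕ} {A : Matrix (Fin n) (Fin n) ℤ} (h : HasType b j A k) :
    cartanDet b = A.det := by
  classical
  obtain ⟨e, he, -⟩ := h
  have : b.cartanMatrix = A.submatrix e e := by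
    ext i i'
    exact he i i'
  rw [← Matrix.det_submatrix_equiv_self e A, ← this, cartanDet]

/-! ### Cominuscule nodes -/

theorem isHermitianSymmetric_of_neg_one_le (h : ∀ α : H.root, -1 ≤ coeff b j α) :
    IsHermitianSymmetric b j := by
  have key : ∀ α β : H.root, coeff b j α < 0 → coeff b j β < 0 →
      ∀ x ∈ rootSpace H α.1, ∀ y ∈ rootSpace H β.1, ⁅x, y⁆ = 0 := by
    intro α β hα hβ x hx y hy
    have hsum : coeffForm b j ((rootSystem H).root α + (rootSystem H).root β) =
        ((coeff b j α + coeff b j β : ℤ) : ℂ) := by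
      rw [map_add, coeffForm_eq_coeff, coeffForm_eq_coeff, Int.cast_add]
    have hx' := rootSpace_le_parabolicSubmodule b j α hα.le hx
    have hy' := rootSpace_le_parabolicSubmodule b j β hβ.le hy
    rcases IsRootVector.lie (b := b) (j := j) (α := α) (β := β) (x := ⟨x, hx'⟩) (y := ⟨y, hy'⟩)
      hx hy with h0 | ⟨γ, hγ, -⟩ | h0
    · rw [h0, map_zero] at hsum
      have : coeff b j α + coeff b j β = 0 := by exact_mod_cast hsum.symm
      lia
    · have := coeff_add b j hγ
      have := h γ
      lia
    · exact congrArg Subtype.val h0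
  intro x hx y hy
  refine Submodule.iSup_induction _ (motive := fun x ↦ ⁅x, y⁆ = 0) hx (fun α x hx ↦ ?_)
    (zero_lie y) fun x x' h h' ↦ by rw [add_lie, h, h', add_zero]
  refine Submodule.iSup_induction _ (motive := fun y ↦ ⁅x, y⁆ = 0) hy (fun β y hy ↦ ?_)
    (lie_zero x) fun y y' h h' ↦ by rw [lie_add, h, h', add_zero]
  exact key α.1 β.1 α.2 β.2 x hx y hy

/-- An induction principle for the coefficient vectors of the roots, in terms of the Cartan matrix:
they are obtained from the unit vectors by sign changes and simple reflections. -/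
theorem coeff_induction {n : ℕ} {A : Matrix (Fin n) (Fin n) ℤ} {e : b.support ≃ Fin n}
    (he : ∀ i i', b.cartanMatrix i i' = A (e i) (e i')) {P : (Fin n → ℤ) → Prop}
    (hsimple : ∀ i, P (Pi.single i 1)) (hneg : ∀ c, P c → P (-c))
    (hrefl : ∀ c k, P c → P (c - Pi.single k (∑ i, c i * A i k))) (α : H.root) :
    P fun i ↦ coeff b (e.symm i) α := by
  classical
  refine b.induction_reflect (p := fun α ↦ P fun i ↦ coeff b (e.symm i) α) α ?_ ?_ ?_
  · intro α hα
    convert hneg _ hα using 1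
    ext i
    rw [Pi.neg_apply]
    have : (coeff b (e.symm i) ((rootSystem H).reflectionPerm α α) : ℂ) =
        -(coeff b (e.symm i) α : ℂ) := by
      rw [← coeffForm_eq_coeff, ← coeffForm_eq_coeff, RootPairing.root_reflectionPerm,
        RootPairing.reflection_apply_self, map_neg]
    exact_mod_cast this
  · intro k hk
    convert hsimple (e ⟨k, hk⟩) using 1
    ext i
    have hi : (⟨k, hk⟩ : b.support) = e.symm i ↔ i = e ⟨k, hk⟩ := by
      rw [Equiv.eq_symm_apply, eq_comm]
    have : (coeff b (e.symm i) k : ℂ) = ((Pi.single (e ⟨k, hk⟩) 1 : Fin n → ℤ) i : ℂ) := by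
      rw [← coeffForm_eq_coeff, coeffForm_root _ ⟨k, hk⟩, Pi.single_apply]
      simp only [hi]
      split_ifs <;> simp
    exact_mod_cast this
  · intro α k hα hk
    convert hrefl _ (e ⟨k, hk⟩) hα using 1
    ext i
    have hi : (⟨k, hk⟩ : b.support) = e.symm i ↔ i = e ⟨k, hk⟩ := by
      rw [Equiv.eq_symm_apply, eq_comm]
    have hpair : (rootSystem H).pairing α k =
        ((∑ i, coeff b (e.symm i) α * A i (e ⟨k, hk⟩) : ℤ) : ℂ) := by
      rw [← e.sum_comp]
      simp only [e.symm_apply_apply, ← he]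
      have h1 : (rootSystem H).root α =
          ∑ i : b.support, (coeff b i α : ℂ) • (rootSystem H).root i := by
        conv_lhs => rw [← b.toWeightBasis.sum_repr ((rootSystem H).root α)]
        refine Finset.sum_congr rfl fun i _ ↦ ?_
        rw [← coeffForm_eq_coeff, b.toWeightBasis_apply]
        rfl
      rw [← RootPairing.root_coroot_eq_pairing, h1, map_sum, LinearMap.sum_apply, Int.cast_sum]
      refine Finset.sum_congr rfl fun i _ ↦ ?_
      rw [map_smul, LinearMap.smul_apply, RootPairing.root_coroot_eq_pairing, Int.cast_mul,
        smul_eq_mul]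
      congr 1
      exact ((rootSystem H).algebraMap_pairingIn ℤ i k).symm
    have : (coeff b (e.symm i) ((rootSystem H).reflectionPerm k α) : ℂ) =
        (coeff b (e.symm i) α : ℂ) - (∑ i, coeff b (e.symm i) α * A i (e ⟨k, hk⟩) : ℤ) *
          ((Pi.single (e ⟨k, hk⟩) 1 : Fin n → ℤ) i : ℂ) := by
      rw [← hpair, ← coeffForm_eq_coeff, ← coeffForm_eq_coeff, RootPairing.root_reflectionPerm,
        RootPairing.reflection_apply_root, map_sub, map_smul, coeffForm_root _ ⟨k, hk⟩,
        Pi.single_apply]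
      simp only [hi]
      split_ifs <;> simp
    have h2 : coeff b (e.symm i) ((rootSystem H).reflectionPerm k α) =
        coeff b (e.symm i) α - (∑ i, coeff b (e.symm i) α * A i (e ⟨k, hk⟩)) *
          (Pi.single (e ⟨k, hk⟩) 1 : Fin n → ℤ) i := by
      exact_mod_cast this
    rw [h2, Pi.sub_apply, Pi.single_apply, Pi.single_apply]
    split_ifs <;> simp

/-- If the fundamental coweight of a node lies in a set of integral coweights that is stable under
the simple reflections and on which the simple roots take the values `-1`, `0` and `1` only, then so
does every root, and `X` is Hermitian symmetric. -/
theorem HasType.isHermitianSymmetric_of_orbit {n k : ℕ} {A : Matrix (Fin n) (Fin n) ℤ}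
    (h : HasType b j A k) (Ω : Set (Fin n → ℤ))
    (hnode : ∀ k' : Fin n, (k' : ℕ) = k → Pi.single k' 1 ∈ Ω) (hle : ∀ f ∈ Ω, ∀ i, |f i| ≤ 1)
    (hrefl : ∀ f ∈ Ω, ∀ m, (fun i ↦ f i - A i m * f m) ∈ Ω) : IsHermitianSymmetric b j := by
  obtain ⟨e, he, hk⟩ := h
  refine isHermitianSymmetric_of_neg_one_le fun α ↦ ?_
  have := coeff_induction he (P := fun c ↦ ∀ f ∈ Ω, |∑ i, f i * c i| ≤ 1) ?_ ?_ ?_ α _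
    (hnode _ hk)
  · simp only [Pi.single_apply, ite_mul, one_mul, zero_mul, Finset.sum_ite_eq', Finset.mem_univ,
      if_true, e.symm_apply_apply] at this
    exact (abs_le.mp this).1
  · intro i f hf
    simpa [Pi.single_apply] using hle f hf i
  · intro c hc f hf
    simpa using hc f hf
  · intro c m hc f hf
    convert hc _ (hrefl f hf m) using 2
    simp only [Pi.sub_apply, Pi.single_apply, mul_sub, Finset.sum_sub_distrib, sub_mul, mul_ite,
      mul_zero, Finset.sum_ite_eq', Finset.mem_univ, if_true, Finset.mul_sum]
    congr 1
    exact Finset.sum_congr rfl fun i _ ↦ by ring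

/-- The orbit of a fundamental coweight in type `A` consists of the sums `∑ s_i e_i` with
`s_i ∈ {0, 1}`, in the coordinates in which the simple roots are the `e_i - e_{i + 1}`. -/
theorem HasType.isHermitianSymmetric_A {n k : ℕ} (h : HasType b j (CartanMatrix.A n) k) :
    IsHermitianSymmetric b j := by
  refine h.isHermitianSymmetric_of_orbit
    {f | ∃ s : ℕ → ℤ, (∀ i, s i = 0 ∨ s i = 1) ∧ ∀ i, f i = s i - s (i + 1)} ?_ ?_ ?_
  · rintro k' rfl
    refine ⟨fun i ↦ if i ≤ k' then 1 else 0, fun i ↦ by grind, fun i ↦ ?_⟩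
    simp only [Pi.single_apply]
    grind
  · rintro f ⟨s, hs, hf⟩ i
    have h1 := hs i
    have h2 := hs (i + 1)
    rw [hf, abs_le]
    lia
  · rintro f ⟨s, hs, hf⟩ m
    refine ⟨Function.update (Function.update s m (s (m + 1))) (m + 1) (s m), fun i ↦ ?_,
      fun i ↦ ?_⟩
    · simp only [Function.update_apply]
      grind
    · simp only [hf, CartanMatrix.A, Matrix.of_apply, Function.update_apply]
      grind

/-- The orbit of the coweight consists of the vectors `± e_i`, the last simple root being
`e_{n - 1}`. (The set below contains the zero vector as well.) -/
theorem HasType.isHermitianSymmetric_B {n : ℕ} (h : HasType b j (CartanMatrix.B n) 0) :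
    IsHermitianSymmetric b j := by
  refine h.isHermitianSymmetric_of_orbit
    {f | ∃ s : ℕ → ℤ, (∀ i, |s i| ≤ 1) ∧ (∀ i i', s i ≠ 0 → s i' ≠ 0 → i = i') ∧
      ∀ i, f i = if (i : ℕ) = n - 1 then s i else s i - s (i + 1)} ?_ ?_ ?_
  · intro k hk
    refine ⟨fun i ↦ if i = 0 then 1 else 0, fun i ↦ by grind, fun i i' ↦ by grind, fun i ↦ ?_⟩
    simp only [Pi.single_apply]
    grind
  · rintro f ⟨s, hs, hs', hf⟩ i
    have h1 := hs i
    have h2 := hs (i + 1)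
    have h3 := hs' i (i + 1)
    rw [hf]
    grind
  · rintro f ⟨s, hs, hs', hf⟩ m
    refine ⟨if (m : ℕ) = n - 1 then Function.update s m (-s m) else
      Function.update (Function.update s m (s (m + 1))) (m + 1) (s m), fun i ↦ ?_, fun i i' ↦ ?_,
      fun i ↦ ?_⟩
    · have := hs i
      grind
    · grind
    · simp only [hf, CartanMatrix.B, Matrix.of_apply]
      grind

/-- The orbit of the coweight consists of the vectors `(± 1/2, …, ± 1/2)`, the last simple root
being `2 e_{n - 1}`; the entry `± 1/2` at `i` is written as `s i - 1/2`. -/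
theorem HasType.isHermitianSymmetric_C {n : ℕ} (h : HasType b j (CartanMatrix.C n) (n - 1)) :
    IsHermitianSymmetric b j := by
  refine h.isHermitianSymmetric_of_orbit
    {f | ∃ s : ℕ → ℤ, (∀ i, s i = 0 ∨ s i = 1) ∧
      ∀ i, f i = if (i : ℕ) = n - 1 then 2 * s i - 1 else s i - s (i + 1)} ?_ ?_ ?_
  · intro k hk
    refine ⟨fun i ↦ 1, fun i ↦ .inr rfl, fun i ↦ ?_⟩
    simp only [Pi.single_apply]
    grind
  · rintro f ⟨s, hs, hf⟩ i
    have h1 := hs i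
    have h2 := hs (i + 1)
    rw [hf, abs_le]
    lia
  · rintro f ⟨s, hs, hf⟩ m
    refine ⟨if (m : ℕ) = n - 1 then Function.update s m (1 - s m) else
      Function.update (Function.update s m (s (m + 1))) (m + 1) (s m), fun i ↦ ?_, fun i ↦ ?_⟩
    · have := hs i
      grind
    · simp only [hf, CartanMatrix.C, Matrix.of_apply]
      grind

/-- The orbit of the coweight consists of the vectors `± e_i`, the last simple root being
`e_{n + 1} + e_{n + 2}`. -/
theorem HasType.isHermitianSymmetric_D_zero {n : ℕ} (h : HasType b j (CartanMatrix.D (n + 3)) 0) :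
    IsHermitianSymmetric b j := by
  refine h.isHermitianSymmetric_of_orbit
    {f | ∃ s : ℕ → ℤ, (∀ i, |s i| ≤ 1) ∧ (∀ i i', s i ≠ 0 → s i' ≠ 0 → i = i') ∧
      ∀ i, f i = if (i : ℕ) = n + 2 then s (n + 1) + s (n + 2) else s i - s (i + 1)} ?_ ?_ ?_
  · intro k hk
    refine ⟨fun i ↦ if i = 0 then 1 else 0, fun i ↦ by grind, fun i i' ↦ by grind, fun i ↦ ?_⟩
    simp only [Pi.single_apply]
    grind
  · rintro f ⟨s, hs, hs', hf⟩ i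
    have h1 := hs i
    have h2 := hs (i + 1)
    have h3 := hs' i (i + 1)
    have h4 := hs (n + 1)
    have h5 := hs (n + 2)
    have h6 := hs' (n + 1) (n + 2)
    rw [hf]
    grind
  · rintro f ⟨s, hs, hs', hf⟩ m
    refine ⟨if (m : ℕ) = n + 2 then
        Function.update (Function.update s (n + 1) (-s (n + 2))) (n + 2) (-s (n + 1))
      else Function.update (Function.update s m (s (m + 1))) (m + 1) (s m), fun i ↦ ?_,
      fun i i' ↦ ?_, fun i ↦ ?_⟩
    · have := hs i
      grind
    · grind
    · simp only [hf, CartanMatrix.D, Matrix.of_apply]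
      grind (splits := 20)

/-- The orbit of the coweight consists of vectors `(± 1/2, …, ± 1/2)`, the last simple root being
`e_{n + 1} + e_{n + 2}`; the entry `± 1/2` at `i` is written as `s i - 1/2`. -/
theorem HasType.isHermitianSymmetric_D_last {n : ℕ}
    (h : HasType b j (CartanMatrix.D (n + 3)) (n + 2)) : IsHermitianSymmetric b j := by
  refine h.isHermitianSymmetric_of_orbit
    {f | ∃ s : ℕ → ℤ, (∀ i, s i = 0 ∨ s i = 1) ∧
      ∀ i, f i = if (i : ℕ) = n + 2 then s (n + 1) + s (n + 2) - 1 else s i - s (i + 1)} ?_ ?_ ?_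
  · intro k hk
    refine ⟨fun i ↦ 1, fun i ↦ .inr rfl, fun i ↦ ?_⟩
    simp only [Pi.single_apply]
    grind
  · rintro f ⟨s, hs, hf⟩ i
    have h1 := hs i
    have h2 := hs (i + 1)
    have h3 := hs (n + 1)
    have h4 := hs (n + 2)
    rw [hf, abs_le]
    lia
  · rintro f ⟨s, hs, hf⟩ m
    refine ⟨if (m : ℕ) = n + 2 then
        Function.update (Function.update s (n + 1) (1 - s (n + 2))) (n + 2) (1 - s (n + 1))
      else Function.update (Function.update s m (s (m + 1))) (m + 1) (s m), fun i ↦ ?_,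
      fun i ↦ ?_⟩
    · have := hs i
      grind
    · simp only [hf, CartanMatrix.D, Matrix.of_apply]
      grind (splits := 20)

/-- In the simply laced case the coefficient vectors of the roots are among the vectors of
square length `2`. -/
theorem HasType.isHermitianSymmetric_of_isSymm {n k : ℕ} {A : Matrix (Fin n) (Fin n) ℤ}
    (h : HasType b j A k) (hA : A.IsSymm) (hdiag : ∀ i, A i i = 2)
    (hle : ∀ c : Fin n → ℤ, c ⬝ᵥ A *ᵥ c = 2 → ∀ k' : Fin n, (k' : ℕ) = k → -1 ≤ c k') :
    IsHermitianSymmetric b j := by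
  obtain ⟨e, he, hk⟩ := h
  refine isHermitianSymmetric_of_neg_one_le fun α ↦ ?_
  have := hle _ (coeff_induction he (P := fun c ↦ c ⬝ᵥ A *ᵥ c = 2) ?_ ?_ ?_ α) _ hk
  · rwa [e.symm_apply_apply] at this
  · intro i
    simp [hdiag]
  · intro c hc
    rwa [Matrix.mulVec_neg, neg_dotProduct_neg]
  · intro c m hc
    have h1 : (∑ i, c i * A i m) = c ⬝ᵥ A *ᵥ Pi.single m 1 := by
      simp [dotProduct]
    have h2 : Pi.single m 1 ⬝ᵥ A *ᵥ c = c ⬝ᵥ A *ᵥ Pi.single m 1 := by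
      rw [Matrix.dotProduct_mulVec, ← Matrix.mulVec_transpose, hA, dotProduct_comm]
    have h3 : Pi.single m 1 ⬝ᵥ A *ᵥ Pi.single m 1 = 2 := by simp [hdiag]
    have h4 : Pi.single m (∑ i, c i * A i m) =
        (∑ i, c i * A i m) • (Pi.single m 1 : Fin n → ℤ) := by
      rw [← Pi.single_smul, smul_eq_mul, mul_one]
    rw [h4, Matrix.mulVec_sub, Matrix.mulVec_smul, dotProduct_sub, sub_dotProduct, sub_dotProduct,
      smul_dotProduct, smul_dotProduct, dotProduct_smul, dotProduct_smul, h2, h3, ← h1, hc]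
    simp only [smul_eq_mul]
    ring

theorem HasType.isHermitianSymmetric_E₆ (h : HasType b j CartanMatrix.E₆ 0) :
    IsHermitianSymmetric b j := by
  refine h.isHermitianSymmetric_of_isSymm CartanMatrix.E₆_isSymm CartanMatrix.E₆_diag ?_
  intro c hc k hk
  obtain rfl : k = 0 := Fin.ext hk
  have hq : c 0 * (2 * c 0 - c 2) + c 1 * (2 * c 1 - c 3) + c 2 * (-c 0 + 2 * c 2 - c 3) +
      c 3 * (-c 1 - c 2 + 2 * c 3 - c 4) + c 4 * (-c 3 + 2 * c 4 - c 5) +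
      c 5 * (-c 4 + 2 * c 5) = 2 := by
    refine Eq.trans ?_ hc
    simp [dotProduct, Matrix.mulVec, CartanMatrix.E₆, Fin.sum_univ_succ]
    ring
  -- completing squares along the diagram, towards the node `0`
  have h3 : 3 * c 0 ^ 2 ≤ 8 := by
    nlinarith [sq_nonneg (2 * c 1 - c 3), sq_nonneg (2 * c 5 - c 4), sq_nonneg (3 * c 4 - 2 * c 3),
      sq_nonneg (5 * c 3 - 6 * c 2), sq_nonneg (4 * c 2 - 5 * c 0)]
  nlinarith

theorem HasType.isHermitianSymmetric_E₇ (h : HasType b j CartanMatrix.E₇ 6) :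
    IsHermitianSymmetric b j := by
  refine h.isHermitianSymmetric_of_isSymm CartanMatrix.E₇_isSymm CartanMatrix.E₇_diag ?_
  intro c hc k hk
  obtain rfl : k = 6 := Fin.ext hk
  have hq : c 0 * (2 * c 0 - c 2) + c 1 * (2 * c 1 - c 3) + c 2 * (-c 0 + 2 * c 2 - c 3) +
      c 3 * (-c 1 - c 2 + 2 * c 3 - c 4) + c 4 * (-c 3 + 2 * c 4 - c 5) +
      c 5 * (-c 4 + 2 * c 5 - c 6) + c 6 * (-c 5 + 2 * c 6) = 2 := by
    refine Eq.trans ?_ hc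
    simp [dotProduct, Matrix.mulVec, CartanMatrix.E₇, Fin.sum_univ_succ]
    ring
  -- completing squares along the diagram, towards the node `6`
  have h3 : c 6 ^ 2 ≤ 3 := by
    nlinarith [sq_nonneg (2 * c 1 - c 3), sq_nonneg (2 * c 0 - c 2), sq_nonneg (3 * c 2 - 2 * c 3),
      sq_nonneg (5 * c 3 - 6 * c 4), sq_nonneg (4 * c 4 - 5 * c 5), sq_nonneg (3 * c 5 - 4 * c 6)]
  nlinarith

theorem HasType.card_components [(rootSystem H).IsIrreducible] {n k : ℕ}
    {A : Matrix (Fin n) (Fin n) ℤ} (h : HasType b j A k) {d : ℕ} (hd : A.det = d) :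
    Nat.card (Components b j) = d := by
  have := relIndex_eq_cartanDet (b := b)
  rw [h.cartanDet_eq, hd] at this
  rw [HomogeneousQuiver.card_components]
  exact_mod_cast this

end

end HomogeneousQuiver

open HomogeneousQuiver LieAlgebra.IsKilling in
theorem theorem5p12 {𝔤 : Type*} [LieRing 𝔤] [LieAlgebra ℂ 𝔤] [FiniteDimensional ℂ 𝔤]
    [LieAlgebra.IsSimple ℂ 𝔤] (H : LieSubalgebra ℂ 𝔤) [H.IsCartanSubalgebra]
    (b : (rootSystem H).Base) (j : b.support) :
    -- every irreducible Hermitian symmetric variety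
    (IsHermitianSymmetric b j →
      Finite (Components b j) ∧
      Nat.card (Components b j) = (rootLattice b).relIndex (weightLattice b) ∧
      (Nat.card (Components b j) : ℤ) = cartanDet b) ∧
    -- Grassmannians `SL(n+1) / P(α_{k+1})`
    (∀ n k : ℕ, HasType b j (CartanMatrix.A n) k →
      IsHermitianSymmetric b j ∧ Nat.card (Components b j) = n + 1) ∧
    -- odd quadrics `Spin(2n+1) / P(α_1)`
    (∀ n : ℕ, 2 ≤ n → HasType b j (CartanMatrix.B n) 0 →
      IsHermitianSymmetric b j ∧ Nat.card (Components b j) = 2) ∧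
    -- even quadrics `Spin(2n+2) / P(α_1)`
    (∀ n : ℕ, 2 ≤ n → HasType b j (CartanMatrix.D (n + 1)) 0 →
      IsHermitianSymmetric b j ∧ Nat.card (Components b j) = 4) ∧
    -- spinor varieties `Spin(2n+2) / P(α_{n+1})`
    (∀ n : ℕ, 3 ≤ n → HasType b j (CartanMatrix.D (n + 1)) n →
      IsHermitianSymmetric b j ∧ Nat.card (Components b j) = 4) ∧
    -- Lagrangian Grassmannians `Sp(2n) / P(α_n)`
    (∀ n : ℕ, 2 ≤ n → HasType b j (CartanMatrix.C n) (n - 1) →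
      IsHermitianSymmetric b j ∧ Nat.card (Components b j) = 2) ∧
    -- the Cayley plane: `E₆` modulo the parabolic of an end of a long arm of the diagram
    (HasType b j CartanMatrix.E₆ 0 →
      IsHermitianSymmetric b j ∧ Nat.card (Components b j) = 3) ∧
    -- `E₇` modulo the parabolic of the end of the longest arm of the diagram
    (HasType b j CartanMatrix.E₇ 6 →
      IsHermitianSymmetric b j ∧ Nat.card (Components b j) = 2) := by
  refine ⟨fun _ ↦ ⟨finite_components, card_components, ?_⟩, fun n k h ↦ ?_, fun n hn h ↦ ?_,
    fun n hn h ↦ ?_, fun n hn h ↦ ?_, fun n hn h ↦ ?_, fun h ↦ ?_, fun h ↦ ?_⟩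
  · rw [card_components, relIndex_eq_cartanDet]
  · exact ⟨h.isHermitianSymmetric_A, h.card_components (by rw [det_cartanMatrix_A, Nat.cast_succ])⟩
  · obtain ⟨n, rfl⟩ := Nat.exists_eq_add_of_le' hn
    exact ⟨h.isHermitianSymmetric_B, h.card_components (det_cartanMatrix_B _)⟩
  · obtain ⟨n, rfl⟩ := Nat.exists_eq_add_of_le' hn
    exact ⟨h.isHermitianSymmetric_D_zero, h.card_components (det_cartanMatrix_D _)⟩
  · obtain ⟨n, rfl⟩ := Nat.exists_eq_add_of_le' (Nat.le_of_succ_le hn)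
    exact ⟨h.isHermitianSymmetric_D_last, h.card_components (det_cartanMatrix_D _)⟩
  · obtain ⟨n, rfl⟩ := Nat.exists_eq_add_of_le' hn
    exact ⟨h.isHermitianSymmetric_C, h.card_components (det_cartanMatrix_C _)⟩
  · exact ⟨h.isHermitianSymmetric_E₆, h.card_components CartanMatrix.E₆_det⟩
  · exact ⟨h.isHermitianSymmetric_E₇, h.card_components CartanMatrix.E₇_det⟩
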